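/- Let $L,k_1,k_2,k_3,\rho_1,\rho_2>0$ with $$\frac{k_1}{\rho_1}=\frac{k_2}{\rho_2},\qquad k_1=k_3 .$$ Let $g:[0,\infty)\to[0,\infty)$ be non-increasing and differentiable with $g(0)>0$ and $k_2-\int_0^\infty g(s)\,ds>0$. Let $1\le p<\tfrac32$ and let $\xi:[0,\infty)\to(0,\infty)$ be non-increasing and differentiable with $g'(t)\le-\xi(t)g(t)^p$ for all $t\ge0$. For $l>0$ consider the Bresse system with finite memory $$\begin{cases} \rho_1\varphi_{tt}-k_1(\varphi_x+\psi+lw)_x-lk_3(w_x-l\varphi)=0,\\ \rho_2\psi_{tt}-k_2\psi_{xx}+k_1(\varphi_x+\psi+lw)+\int_0^tg(t-s)\psi_{xx}(s)\,ds=0,\\ \rho_1w_{tt}-k_3(w_x-l\varphi)_x+lk_1(\varphi_x+\psi+lw)=0 \end{cases}\qquad\text{in }(0,L)\times(0,\infty),$$ with boundary conditions $\varphi=\psi_x=w_x=0$ at $x=0,L$ and initial data $(\varphi,\varphi_t)(0)=(\varphi_0,\varphi_1)\in H^1_0(0,L)\times L^2(0,L)$ and $(\psi,\psi_t)(0)=(\psi_0,\psi_1)$,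 $(w,w_t)(0)=(w_0,w_1)$, both in $H^1_*(0,L)\times L^2_*(0,L)$, where $L^2_*$ and $H^1_*$ are the subspaces of functions of mean zero in $L^2(0,L)$ and $H^1(0,L)$. A weak solution is a triple $\varphi\in C([0,\infty);H^1_0)\cap C^1([0,\infty);L^2)$, $\psi,w\in C([0,\infty);H^1_*)\cap C^1([0,\infty);L^2_*)$ that attains the initial data and satisfies, for all $t\ge0$, all $\chi\in H^1_0(0,L)$ and all $\eta,\zeta\in H^1(0,L)$, with $\langle\cdot,\cdot\rangle$ the inner product of $L^2(0,L)$, $$\begin{aligned} &\tfrac{d}{dt}\rho_1\langle\varphi_t,\chi\rangle+k_1\langle\varphi_x+\psi+lw,\chi_x\rangle-lk_3\langle w_x-l\varphi,\chi\rangle=0,\\ &\tfrac{d}{dt}\rho_2\langle\psi_t,\eta\rangle+k_2\langle\psi_x,\eta_x\rangle+k_1\langle\varphi_x+\psi+lw,\eta\rangle-\int_0^tg(t-s)\langle\psi_x(s),\eta_x\rangle\,ds=0,\\ &\tfrac{d}{dt}\rho_1\langle w_t,\zeta\rangle+k_3\langle w_x-l\varphi,\zeta_x\rangle+lk_1\langle\varphi_x+\psi+lw,\zeta\rangle=0.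 \end{aligned}$$ Its energy is $$\begin{aligned}E(t)=\tfrac12\int_0^L\Big[&\rho_1\varphi_t^2+\rho_2\psi_t^2+\rho_1w_t^2+\Big(k_2-\int_0^tg(s)\,ds\Big)\psi_x^2+k_3(w_x-l\varphi)^2+k_1(\varphi_x+\psi+lw)^2\Big]dx\\ &+\tfrac12\int_0^L\!\int_0^tg(t-s)\big(\psi_x(t)-\psi_x(s)\big)^2ds\,dx .\end{aligned}$$ Then there is $l_0>0$, depending only on $L,k_1,k_2,k_3,\rho_1,\rho_2,g,\xi,p$, such that for every $l\in(0,l_0)$ and every $t_0>0$ the following holds. 1. If $p=1$, there is $\lambda>0$, independent of $t$ and of the initial data, such that for all initial data as above there is $C>0$, independent of $t$, such that the weak solution satisfies $$E(t)\le C\exp\Big(-\lambda\int_{t_0}^t\xi(s)\,ds\Big)\qquad\text{for all }t>t_0 .$$ 2. If $1<p<\tfrac32$, then for all initial data as above there is $C>0$, independent of $t$, such that the weak solution satisfies $$E(t)\le C\Big(\frac1{1+\int_{t_0}^t\xi^{2p-1}(s)\,ds}\Big)^{\frac1{2p-2}}\qquad\text{for all }t>t_0 .$$ 3. If $1<p<\tfrac32$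 and $$\int_{t_0}^{\infty}\Big(\frac1{1+\int_{t_0}^t\xi^{2p-1}(s)\,ds}\Big)^{\frac1{2p-2}}dt<\infty,$$ then for all initial data as above there is $C>0$, independent of $t$, such that the weak solution satisfies $$E(t)\le C\Big(\frac1{1+\int_{t_0}^t\xi^{p}(s)\,ds}\Big)^{\frac1{p-1}}\qquad\text{for all }t>t_0 .$$ -/

import Mathlib

noncomputable section

namespace Bresse

open MeasureTheory Set

/-- The real Hilbert space `L²(0,L)`. -/
abbrev L2 (L : ℝ) : Type := Lp ℝ 2 (volume.restrict (Ioo (0 : ℝ) L))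

/-- Test functions on `(0,L)`: smooth functions with compact support inside `(0,L)`. -/
def IsTestFun (L : ℝ) (η : ℝ → ℝ) : Prop :=
  ContDiff ℝ (⊤ : ℕ∞) η ∧ HasCompactSupport η ∧ tsupport η ⊆ Ioo 0 L

/-- `v` is the weak derivative of `u` on `(0,L)`. -/
def IsWeakDeriv (L : ℝ) (u v : L2 L) : Prop :=
  ∀ η : ℝ → ℝ, IsTestFun L η →
    ∫ x in Ioo (0 : ℝ) L, u x * deriv η x = -∫ x in Ioo (0 : ℝ) L, v x * η x

theorem IsTestFun.integrable_mul {L : ℝ} {η : ℝ → ℝ} (h : IsTestFun L η) (u : L2 L) :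
    Integrable (fun x => u x * η x) (volume.restrict (Ioo (0 : ℝ) L)) := by
  have h1 : MemLp η 2 (volume.restrict (Ioo (0 : ℝ) L)) :=
    h.1.continuous.memLp_of_hasCompactSupport h.2.1
  exact (Lp.memLp u).integrable_mul h1

theorem IsTestFun.integrable_mul_deriv {L : ℝ} {η : ℝ → ℝ} (h : IsTestFun L η) (u : L2 L) :
    Integrable (fun x => u x * deriv η x) (volume.restrict (Ioo (0 : ℝ) L)) := by
  have h1 : MemLp (deriv η) 2 (volume.restrict (Ioo (0 : ℝ) L)) :=
    (h.1.continuous_deriv (by simp)).memLp_of_hasCompactSupport h.2.1.deriv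
  exact (Lp.memLp u).integrable_mul h1

/-- The Sobolev space `H¹(0,L)`, realised as the set of pairs `(u, uₓ)` in `L² × L²` such that
`uₓ` is the weak derivative of `u` (which `u` determines uniquely), with the norm
`(‖u‖² + ‖uₓ‖²)^{1/2}`. -/
def H1 (L : ℝ) : Submodule ℝ (WithLp 2 (L2 L × L2 L)) where
  carrier := {U | IsWeakDeriv L U.fst U.snd}
  zero_mem' := by
    intro η _
    have h0 : ((0 : L2 L) : ℝ → ℝ) =ᵐ[volume.restrict (Ioo (0 : ℝ) L)] 0 := Lp.coeFn_zero _ _ _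
    have a1 : ∫ x in Ioo (0 : ℝ) L, (0 : L2 L) x * deriv η x = 0 := by
      apply integral_eq_zero_of_ae
      filter_upwards [h0] with x hx
      simp only [hx, Pi.zero_apply, zero_mul]
    have a2 : ∫ x in Ioo (0 : ℝ) L, (0 : L2 L) x * η x = 0 := by
      apply integral_eq_zero_of_ae
      filter_upwards [h0] with x hx
      simp only [hx, Pi.zero_apply, zero_mul]
    simp only [WithLp.zero_fst, WithLp.zero_snd, a1, a2, neg_zero]
  add_mem' := by
    intro U V hU hV η hη
    have a1 : ∫ x in Ioo (0 : ℝ) L, (U.fst + V.fst) x * deriv η x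
        = ∫ x in Ioo (0 : ℝ) L, (U.fst x * deriv η x + V.fst x * deriv η x) := by
      apply integral_congr_ae
      filter_upwards [Lp.coeFn_add U.fst V.fst] with x hx
      rw [hx, Pi.add_apply, add_mul]
    have a2 : ∫ x in Ioo (0 : ℝ) L, (U.snd + V.snd) x * η x
        = ∫ x in Ioo (0 : ℝ) L, (U.snd x * η x + V.snd x * η x) := by
      apply integral_congr_ae
      filter_upwards [Lp.coeFn_add U.snd V.snd] with x hx
      rw [hx, Pi.add_apply, add_mul]
    rw [WithLp.add_fst, WithLp.add_snd, a1, a2,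
      integral_add (hη.integrable_mul_deriv _) (hη.integrable_mul_deriv _),
      integral_add (hη.integrable_mul _) (hη.integrable_mul _), hU η hη, hV η hη]
    ring
  smul_mem' := by
    intro c U hU η hη
    have a1 : ∫ x in Ioo (0 : ℝ) L, (c • U.fst) x * deriv η x
        = ∫ x in Ioo (0 : ℝ) L, c * (U.fst x * deriv η x) := by
      apply integral_congr_ae
      filter_upwards [Lp.coeFn_smul c U.fst] with x hx
      rw [hx, Pi.smul_apply, smul_eq_mul, mul_assoc]
    have a2 : ∫ x in Ioo (0 : ℝ) L, (c • U.snd) x * η x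
        = ∫ x in Ioo (0 : ℝ) L, c * (U.snd x * η x) := by
      apply integral_congr_ae
      filter_upwards [Lp.coeFn_smul c U.snd] with x hx
      rw [hx, Pi.smul_apply, smul_eq_mul, mul_assoc]
    rw [WithLp.smul_fst, WithLp.smul_snd, a1, a2, integral_const_mul, integral_const_mul,
      hU η hη]
    ring

/-- The function `u ∈ L²(0,L)` underlying an element of `H¹(0,L)`. -/
def fn {L : ℝ} (U : H1 L) : L2 L := (U : WithLp 2 (L2 L × L2 L)).fst

/-- The weak derivative `uₓ ∈ L²(0,L)` of an element `u` of `H¹(0,L)`. -/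
def dx {L : ℝ} (U : H1 L) : L2 L := (U : WithLp 2 (L2 L × L2 L)).snd

/-- `H¹₀(0,L)`: the closure of the test functions in `H¹(0,L)`. -/
def H10 (L : ℝ) : Set (H1 L) :=
  closure {U | ∃ η : ℝ → ℝ, IsTestFun L η ∧ fn U =ᵐ[volume.restrict (Ioo (0 : ℝ) L)] η}

/-- `L²_*(0,L)`: the elements of `L²(0,L)` with mean zero. -/
def L2star (L : ℝ) : Set (L2 L) := {u | ∫ x in Ioo (0 : ℝ) L, u x = 0}

/-- `H¹_*(0,L)`: the elements of `H¹(0,L)` with mean zero. -/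
def H1star (L : ℝ) : Set (H1 L) := {U | fn U ∈ L2star L}

/-- A tuple `(φ, ψ, w, φₜ, ψₜ, wₜ)` of displacements and velocities at a fixed time. -/
structure State (L : ℝ) where
  φ : H1 L
  ψ : H1 L
  w : H1 L
  φt : L2 L
  ψt : L2 L
  wt : L2 L

/-- `(φ, φₜ) ∈ H¹₀ × L²` and `(ψ, ψₜ), (w, wₜ) ∈ H¹_* × L²_*`. -/
structure State.Admissible {L : ℝ} (U : State L) : Prop where
  φ_mem : U.φ ∈ H10 L
  ψ_mem : U.ψ ∈ H1star L
  w_mem : U.w ∈ H1star L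
  ψt_mem : U.ψt ∈ L2star L
  wt_mem : U.wt ∈ L2star L

/-- The shear term `φₓ + ψ + l w`. -/
def State.shear {L : ℝ} (l : ℝ) (U : State L) : L2 L := dx U.φ + fn U.ψ + l • fn U.w

/-- The axial term `wₓ - l φ`. -/
def State.axial {L : ℝ} (l : ℝ) (U : State L) : L2 L := dx U.w - l • fn U.φ

/-- `u = (φ, ψ, w, φₜ, ψₜ, wₜ)`, `t ≥ 0`, is a (global) weak solution with initial data `U₀` of

* `ρ₁ φₜₜ - k₁ (φₓ + ψ + l w)ₓ - l k₃ (wₓ - l φ) = 0`,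
* `ρ₂ ψₜₜ - k₂ ψₓₓ + k₁ (φₓ + ψ + l w) + ∫₀ᵗ g(t-s) ψₓₓ(s) ds = 0`,
* `ρ₁ wₜₜ - k₃ (wₓ - l φ)ₓ + l k₁ (φₓ + ψ + l w) = 0`

on `(0,L) × (0,∞)` with `φ = ψₓ = wₓ = 0` at `x = 0, L`: it has the regularity
`φ ∈ C(ℝ₊; H¹₀) ∩ C¹(ℝ₊; L²)`, `ψ, w ∈ C(ℝ₊; H¹_*) ∩ C¹(ℝ₊; L²_*)`, and the equations hold
after multiplication by `χ` and integration by parts in `x`, for every `χ ∈ H¹₀` in the first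
equation and for every `χ ∈ H¹` in the other two (this encodes the Neumann conditions). -/
structure IsWeakSolution (L l k₁ k₂ k₃ ρ₁ ρ₂ : ℝ) (g : ℝ → ℝ) (U₀ : State L)
    (u : ℝ → State L) : Prop where
  initial : u 0 = U₀
  admissible : ∀ t, 0 ≤ t → (u t).Admissible
  continuous_φ : ContinuousOn (fun t => (u t).φ) (Ici 0)
  continuous_ψ : ContinuousOn (fun t => (u t).ψ) (Ici 0)
  continuous_w : ContinuousOn (fun t => (u t).w) (Ici 0)
  deriv_φ : ∀ t, 0 ≤ t → HasDerivWithinAt (fun s => fn (u s).φ) (u t).φt (Ici 0) t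
  deriv_ψ : ∀ t, 0 ≤ t → HasDerivWithinAt (fun s => fn (u s).ψ) (u t).ψt (Ici 0) t
  deriv_w : ∀ t, 0 ≤ t → HasDerivWithinAt (fun s => fn (u s).w) (u t).wt (Ici 0) t
  continuous_φt : ContinuousOn (fun t => (u t).φt) (Ici 0)
  continuous_ψt : ContinuousOn (fun t => (u t).ψt) (Ici 0)
  continuous_wt : ContinuousOn (fun t => (u t).wt) (Ici 0)
  eq_φ : ∀ χ : H1 L, χ ∈ H10 L → ∀ t, 0 ≤ t →
    HasDerivWithinAt (fun s => ρ₁ * inner ℝ (u s).φt (fn χ))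
      (-(k₁ * inner ℝ ((u t).shear l) (dx χ)) + l * k₃ * inner ℝ ((u t).axial l) (fn χ)) (Ici 0) t
  eq_ψ : ∀ χ : H1 L, ∀ t, 0 ≤ t →
    HasDerivWithinAt (fun s => ρ₂ * inner ℝ (u s).ψt (fn χ))
      (-(k₂ * inner ℝ (dx (u t).ψ) (dx χ)) - k₁ * inner ℝ ((u t).shear l) (fn χ)
        + ∫ s in (0 : ℝ)..t, g (t - s) * inner ℝ (dx (u s).ψ) (dx χ)) (Ici 0) t
  eq_w : ∀ χ : H1 L, ∀ t, 0 ≤ t →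
    HasDerivWithinAt (fun s => ρ₁ * inner ℝ (u s).wt (fn χ))
      (-(k₃ * inner ℝ ((u t).axial l) (dx χ)) - l * k₁ * inner ℝ ((u t).shear l) (fn χ)) (Ici 0) t

/-- The energy
`E(t) = ½ ∫₀ᴸ [ρ₁ φₜ² + ρ₂ ψₜ² + ρ₁ wₜ² + (k₂ - ∫₀ᵗ g) ψₓ² + k₃ (wₓ - l φ)² + k₁ (φₓ + ψ + l w)²] dx
  + ½ (g ∘ ψₓ)(t)`, where `(g ∘ v)(t) = ∫₀ᵗ g(t-s) ‖v(t) - v(s)‖² ds`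
and all norms are those of `L²(0,L)`. -/
def energy {L : ℝ} (l k₁ k₂ k₃ ρ₁ ρ₂ : ℝ) (g : ℝ → ℝ) (u : ℝ → State L) (t : ℝ) : ℝ :=
  (1 / 2) * (ρ₁ * ‖(u t).φt‖ ^ 2 + ρ₂ * ‖(u t).ψt‖ ^ 2 + ρ₁ * ‖(u t).wt‖ ^ 2
      + (k₂ - ∫ s in (0 : ℝ)..t, g s) * ‖dx (u t).ψ‖ ^ 2
      + k₃ * ‖(u t).axial l‖ ^ 2 + k₁ * ‖(u t).shear l‖ ^ 2)
    + (1 / 2) * ∫ s in (0 : ℝ)..t, g (t - s) * ‖dx (u t).ψ - dx (u s).ψ‖ ^ 2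

/-- Hypothesis (A1) on the relaxation function `g : [0,∞) → [0,∞)`. -/
structure HypA1 (k₂ : ℝ) (g : ℝ → ℝ) : Prop where
  nonneg : ∀ t, 0 ≤ t → 0 ≤ g t
  antitone : AntitoneOn g (Ici 0)
  differentiable : DifferentiableOn ℝ g (Ici 0)
  pos_zero : 0 < g 0
  integrable : IntegrableOn g (Ioi 0)
  integral_lt : 0 < k₂ - ∫ s in Ioi (0 : ℝ), g s

/-- Hypothesis (A2): `g' ≤ -ξ g^p` on `[0,∞)` with `1 ≤ p < 3/2` and a positive, non-increasing,
differentiable function `ξ` on `[0,∞)` (derivatives at `0` are one-sided). -/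
structure HypA2 (g ξ : ℝ → ℝ) (p : ℝ) : Prop where
  pos : ∀ t, 0 ≤ t → 0 < ξ t
  antitone : AntitoneOn ξ (Ici 0)
  differentiable : DifferentiableOn ℝ ξ (Ici 0)
  one_le : 1 ≤ p
  lt : p < 3 / 2
  deriv_le : ∀ t, 0 ≤ t → derivWithin g (Ici 0) t ≤ -(ξ t * g t ^ p)

end Bresse

end

/-!
The boundary conditions `φ = ψₓ = wₓ = 0` are compatible with a sine expansion of `φ` and cosine
expansions of `ψ` and `w`: testing the weak formulation with `sin (μ x)` and `cos (μ x)`, where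
`μ = (n + 1) π / L`, closes into a system of three ordinary integro-differential equations for the
coefficients of frequency `μ` (`Mode`, `IsWeakSolution.mode`). The zeroth cosine coefficients vanish
because `ψ` and `w` have mean zero. In a single mode every quantity is differentiable in time, so
the multiplier method applies to weak solutions without regularisation. By Parseval's identity the
energy of the solution is the sum of the energies of its modes (`hasSum_sin`, `hasSum_cos`,
`IsWeakSolution.hasSum_energy`), so it suffices to bound the energy of each mode by a rate times its
initial energy, with constants that do not depend on `μ`.

*Lyapunov functional.* `exists_lyapunov` adds to a multiple of the energy a combination of
multipliers (`Mode.multiplier`) such that the derivative is at most `-κ E + C (g ∘ ψₓ)`, where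
`g ∘ ψₓ = ∫₀ᵗ g(t-s) ‖ψₓ(t) - ψₓ(s)‖² ds`. Equality of the wave speeds `k₁/ρ₁ = k₂/ρ₂` cancels the
term with `μ φₜ ψₜ`, which no energy norm controls uniformly in `μ`. The equality `k₁ = k₃` makes
the product `φₜ (wₓ - l φ) + wₜ (φₓ + ψ + l w)` a multiplier for the axial strain. The couplings
that remain are absorbed for small `l`. The positive lower bound of `∫₀ᵗ g` for `t ≥ t₀ > 0` gives
the control of `ψₜ`.

*Memory term.* The term `ξ (g ∘ ψₓ)` is compared with the dissipation `-E'`, which dominates half of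
`ξ (gᵖ ∘ ψₓ)`. Instead of Hölder's and Jensen's inequalities a pointwise splitting of `g` at a
threshold is used, which gives `ξ (g ∘ ψₓ) ≤ z K E(0) + C z^(1-r) (-E')` for every `z > 0`
(`MemoryBound`). For `p = 1` this holds with `r = 1`. For `p < 3/2` the function `ξ √g` is
integrable and `r = 2p - 1` is admissible (`exists_memoryBound_sqrt`). If `E` is integrable in time,
then `r = p` is admissible (`exists_memoryBound_of_integral`); the decay with `r = 2p - 1`
supplies this integrability in the last part of the theorem.

*Decay.* For the normalised energy `E / E(0)`, the choice `z ~ ξ E` makes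
`F = ξ^r E^(r-1) ℓ + C E`, with `ℓ` the Lyapunov functional, satisfy `F' ≤ -κ (ξ E)^r`
(`DecayData.exists_functional`). Integration gives exponential decay for `r = 1`
(`DecayData.exp_decay`) and polynomial decay for `r > 1` (`exists_poly_decay`).
-/

/-! ### Memory integrals -/

namespace Bresse

open MeasureTheory Set Filter Topology

/-- The memory integral `∫₀ᵗ k(s) (f(t) - f(t-s)) ds`. -/
noncomputable def defect (k f : ℝ → ℝ) (t : ℝ) : ℝ :=
  ∫ s in (0 : ℝ)..t, k s * (f t - f (t - s))

/-- The quadratic memory integral `∫₀ᵗ k(s) (f(t) - f(t-s))² ds`. -/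
noncomputable def variation (k f : ℝ → ℝ) (t : ℝ) : ℝ :=
  ∫ s in (0 : ℝ)..t, k s * (f t - f (t - s)) ^ 2

/-- The one-sided derivative of the relaxation function on `[0,∞)`. -/
noncomputable def kernelDeriv (g : ℝ → ℝ) : ℝ → ℝ := derivWithin g (Ici 0)

theorem hasDerivWithinAt_primitive {f : ℝ → ℝ} (hf : ContinuousOn f (Ici 0)) {a t : ℝ} (ha : 0 ≤ a)
    (ht : 0 ≤ t) : HasDerivWithinAt (fun t => ∫ s in a..t, f s) (f t) (Ici 0) t := by
  have hc : Continuous fun x => f (max x 0) :=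
    hf.comp_continuous (by fun_prop) fun x => mem_Ici.2 (le_max_right _ _)
  have h := (hc.integral_hasStrictDerivAt a t).hasDerivAt.hasDerivWithinAt (s := Ici 0)
  rw [max_eq_left ht] at h
  have key : ∀ x ∈ Ici (0 : ℝ), ∫ s in a..x, f s = ∫ s in a..x, f (max s 0) := by
    intro x hx
    apply intervalIntegral.integral_congr
    intro s hs
    have : 0 ≤ s := (le_min ha hx).trans hs.1
    simp only [max_eq_left this]
  exact h.congr key (key t ht)

section Kernel

variable {k₂ : ℝ} {g : ℝ → ℝ}

theorem HypA1.continuousOn (hg : HypA1 k₂ g) : ContinuousOn g (Ici 0) :=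
  hg.differentiable.continuousOn

theorem HypA1.intervalIntegrable (hg : HypA1 k₂ g) {a t : ℝ} (ha : 0 ≤ a) (ht : 0 ≤ t) :
    IntervalIntegrable g volume a t := by
  apply (hg.continuousOn.mono _).intervalIntegrable
  intro x hx
  exact le_trans (le_min ha ht) hx.1

theorem HypA1.hasDerivAt (hg : HypA1 k₂ g) {t : ℝ} (ht : 0 < t) :
    HasDerivAt g (kernelDeriv g t) t :=
  (hg.differentiable t ht.le).hasDerivWithinAt.hasDerivAt (Ici_mem_nhds ht)

theorem HypA1.kernelDeriv_nonpos (hg : HypA1 k₂ g) (t : ℝ) : kernelDeriv g t ≤ 0 :=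
  hg.antitone.derivWithin_nonpos

theorem HypA1.intervalIntegrable_kernelDeriv (hg : HypA1 k₂ g) {t : ℝ} (ht : 0 ≤ t) :
    IntervalIntegrable (kernelDeriv g) volume 0 t := by
  have h : IntervalIntegrable (fun x => -kernelDeriv g x) volume 0 t := by
    apply intervalIntegral.intervalIntegrable_deriv_of_nonneg (g := fun x => - g x)
    · rw [uIcc_of_le ht]
      exact (hg.continuousOn.mono Icc_subset_Ici_self).neg
    · intro x hx
      rw [min_eq_left ht] at hx
      exact (hg.hasDerivAt hx.1).neg
    · intro x _
      linarith [hg.kernelDeriv_nonpos x]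
  exact h.neg.congr fun x _ => neg_neg _

theorem HypA1.integral_kernelDeriv (hg : HypA1 k₂ g) {t : ℝ} (ht : 0 ≤ t) :
    ∫ s in (0 : ℝ)..t, kernelDeriv g s = g t - g 0 :=
  intervalIntegral.integral_eq_sub_of_hasDerivAt_of_le ht
    (hg.continuousOn.mono Icc_subset_Ici_self) (fun _ hx => hg.hasDerivAt hx.1)
    (hg.intervalIntegrable_kernelDeriv ht)

theorem HypA1.integral_nonneg (hg : HypA1 k₂ g) {t : ℝ} (ht : 0 ≤ t) :
    0 ≤ ∫ s in (0 : ℝ)..t, g s :=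
  intervalIntegral.integral_nonneg ht fun s hs => hg.nonneg s hs.1

theorem HypA1.integral_le (hg : HypA1 k₂ g) {t : ℝ} (ht : 0 ≤ t) :
    ∫ s in (0 : ℝ)..t, g s ≤ ∫ s in Ioi (0 : ℝ), g s := by
  rw [intervalIntegral.integral_of_le ht]
  apply setIntegral_mono_set hg.integrable _ Ioc_subset_Ioi_self.eventuallyLE
  filter_upwards [ae_restrict_mem measurableSet_Ioi] with x hx
  exact hg.nonneg x (le_of_lt hx)

theorem HypA1.integral_mono (hg : HypA1 k₂ g) {s t : ℝ} (hs : 0 ≤ s) (hst : s ≤ t) :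
    ∫ s in (0 : ℝ)..s, g s ≤ ∫ s in (0 : ℝ)..t, g s := by
  have h := intervalIntegral.integral_add_adjacent_intervals
    (hg.intervalIntegrable le_rfl hs) (hg.intervalIntegrable hs (hs.trans hst))
  have h2 : 0 ≤ ∫ s in s..t, g s :=
    intervalIntegral.integral_nonneg hst fun x hx => hg.nonneg x (hs.trans hx.1)
  linarith

theorem HypA1.integral_pos (hg : HypA1 k₂ g) {t : ℝ} (ht : 0 < t) :
    0 < ∫ s in (0 : ℝ)..t, g s :=
  intervalIntegral.integral_pos ht (hg.continuousOn.mono Icc_subset_Ici_self)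
    (fun x hx => hg.nonneg x hx.1.le) ⟨0, left_mem_Icc.2 ht.le, hg.pos_zero⟩

theorem HypA1.hasDerivWithinAt_integral (hg : HypA1 k₂ g) {t : ℝ} (ht : 0 ≤ t) :
    HasDerivWithinAt (fun t => ∫ s in (0 : ℝ)..t, g s) (g t) (Ici 0) t :=
  hasDerivWithinAt_primitive hg.continuousOn le_rfl ht

end Kernel

/-- `f` is continuously differentiable on `[0,∞)` with derivative `f'`. -/
structure IsC1 (f f' : ℝ → ℝ) : Prop where
  hasDeriv : ∀ t, 0 ≤ t → HasDerivWithinAt f (f' t) (Ici 0) t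
  continuousOn_deriv : ContinuousOn f' (Ici 0)

theorem IsC1.continuousOn {f f' : ℝ → ℝ} (h : IsC1 f f') : ContinuousOn f (Ici 0) :=
  fun t ht => (h.hasDeriv t ht).continuousWithinAt

theorem IsC1.sq {f f' : ℝ → ℝ} (h : IsC1 f f') :
    IsC1 (fun t => f t ^ 2) (fun t => 2 * f t * f' t) where
  hasDeriv t ht := by
    exact ((h.hasDeriv t ht).fun_pow 2).congr_deriv (by norm_num)
  continuousOn_deriv := (continuousOn_const.mul h.continuousOn).mul h.continuousOn_deriv

theorem continuousOn_delay {f : ℝ → ℝ} (hf : ContinuousOn f (Ici 0)) {t : ℝ} (ht : 0 ≤ t) :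
    ContinuousOn (fun s => f (t - s)) (uIcc 0 t) := by
  rw [uIcc_of_le ht]
  exact hf.comp (by fun_prop) fun s hs => by simpa using hs.2

theorem intervalIntegrable_mul_delay {k f : ℝ → ℝ} {t : ℝ} (ht : 0 ≤ t)
    (hk : IntervalIntegrable k volume 0 t) (hf : ContinuousOn f (Ici 0)) :
    IntervalIntegrable (fun s => k s * f (t - s)) volume 0 t :=
  hk.mul_continuousOn (continuousOn_delay hf ht)

theorem intervalIntegrable_defect {k f : ℝ → ℝ} {t : ℝ} (ht : 0 ≤ t)
    (hk : IntervalIntegrable k volume 0 t) (hf : ContinuousOn f (Ici 0)) :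
    IntervalIntegrable (fun s => k s * (f t - f (t - s))) volume 0 t :=
  hk.mul_continuousOn (continuousOn_const.sub (continuousOn_delay hf ht))

theorem intervalIntegrable_variation {k f : ℝ → ℝ} {t : ℝ} (ht : 0 ≤ t)
    (hk : IntervalIntegrable k volume 0 t) (hf : ContinuousOn f (Ici 0)) :
    IntervalIntegrable (fun s => k s * (f t - f (t - s)) ^ 2) volume 0 t :=
  hk.mul_continuousOn ((continuousOn_const.sub (continuousOn_delay hf ht)).pow 2)

/-- Cauchy–Schwarz for the weight `k`. -/
theorem defect_sq_le {k f : ℝ → ℝ} {t : ℝ} (ht : 0 ≤ t)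
    (hk : IntervalIntegrable k volume 0 t) (hf : ContinuousOn f (Ici 0))
    (hpos : ∀ s ∈ Icc 0 t, 0 ≤ k s) :
    defect k f t ^ 2 ≤ (∫ s in (0 : ℝ)..t, k s) * variation k f t := by
  have h1 := intervalIntegrable_defect ht hk hf
  have h2 := intervalIntegrable_variation ht hk hf
  have key : ∀ x : ℝ, 0 ≤ (∫ s in (0 : ℝ)..t, k s) * (x * x) + (-2 * defect k f t) * x
      + variation k f t := by
    intro x
    have e : ∫ s in (0 : ℝ)..t, k s * (f t - f (t - s) - x) ^ 2
        = (∫ s in (0 : ℝ)..t, k s) * (x * x) + (-2 * defect k f t) * x + variation k f t := by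
      have : (fun s => k s * (f t - f (t - s) - x) ^ 2) = fun s => (x * x) * k s
          + (-2 * x) * (k s * (f t - f (t - s))) + k s * (f t - f (t - s)) ^ 2 := by
        ext s; ring
      rw [this, intervalIntegral.integral_add ((hk.const_mul _).add (h1.const_mul _)) h2,
        intervalIntegral.integral_add (hk.const_mul _) (h1.const_mul _),
        intervalIntegral.integral_const_mul, intervalIntegral.integral_const_mul, defect,
        variation]
      ring
    rw [← e]
    exact intervalIntegral.integral_nonneg ht fun s hs => mul_nonneg (hpos s hs) (sq_nonneg _)
  have := discrim_le_zero key
  rw [discrim] at this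
  nlinarith

section Derivatives

variable {k₂ : ℝ} {g f f' : ℝ → ℝ}

theorem HypA1.conv_eq_integral (hg : HypA1 k₂ g) (hf : ContinuousOn f (Ici 0)) {t : ℝ}
    (ht : 0 ≤ t) : ∀ x ∈ Ici (0 : ℝ), x ≤ t + 1 →
      ∫ s in (0 : ℝ)..x, g s * f (x - s)
      = (∫ s in (0 : ℝ)..x, g s) * f 0
        + ∫ s in (0 : ℝ)..t + 1, g s * (f (max (x - s) 0) - f 0) := by
    intro x hx hxt
    have hx' : (0 : ℝ) ≤ x := hx
    have hint : ∀ a b : ℝ, 0 ≤ a → 0 ≤ b →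
        IntervalIntegrable (fun s => g s * (f (max (x - s) 0) - f 0)) volume a b := by
      intro a b ha hb
      apply (hg.intervalIntegrable ha hb).mul_continuousOn
      apply Continuous.continuousOn
      exact (hf.comp_continuous (by fun_prop) fun x => mem_Ici.2 (le_max_right _ _)).sub
        continuous_const
    rw [← intervalIntegral.integral_add_adjacent_intervals (hint 0 x le_rfl hx)
      (hint x (t + 1) hx (by linarith)), ← intervalIntegral.integral_mul_const, ← add_assoc,
      ← intervalIntegral.integral_add ((hg.intervalIntegrable le_rfl hx).mul_const _)
        (hint 0 x le_rfl hx)]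
    have z : ∫ s in x..t + 1, g s * (f (max (x - s) 0) - f 0) = 0 := by
      apply intervalIntegral.integral_zero_ae
      filter_upwards with s hs
      rw [uIoc_of_le hxt] at hs
      rw [max_eq_right (by linarith [hs.1]), sub_self, mul_zero]
    rw [z, add_zero]
    apply intervalIntegral.integral_congr
    intro s hs
    rw [uIcc_of_le hx] at hs
    simp only [max_eq_left (sub_nonneg.2 hs.2)]
    ring

/-- Leibniz rule for a convolution. The function `f - f 0`, extended by `0` to the left, is
locally Lipschitz, which allows differentiation under an integral over a fixed interval. -/
theorem HypA1.hasDerivWithinAt_conv_aux (hg : HypA1 k₂ g) (hf : IsC1 f f') {t : ℝ} (ht : 0 ≤ t) :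
    HasDerivWithinAt (fun t => ∫ s in (0 : ℝ)..t, g s * f (t - s))
      (g t * f 0 + ∫ s in (0 : ℝ)..t, g s * f' (t - s)) (Ici 0) t := by
  set F : ℝ → ℝ := fun x => f (max x 0) - f 0 with hF
  have hT : (0 : ℝ) ≤ t + 1 := by linarith
  have hFc : Continuous F :=
    (hf.continuousOn.comp_continuous (by fun_prop) fun x => mem_Ici.2 (le_max_right _ _)).sub
      continuous_const
  have hf'c : Continuous fun x => f' (max x 0) :=
    hf.continuousOn_deriv.comp_continuous (by fun_prop) fun x => mem_Ici.2 (le_max_right _ _)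
  obtain ⟨K, hK⟩ := isCompact_Icc.exists_bound_of_continuousOn
    (hf.continuousOn_deriv.mono (fun x hx => hx.1 : Icc 0 (t + 1) ⊆ Ici 0))
  have hK0 : 0 ≤ K := (norm_nonneg _).trans (hK 0 ⟨le_rfl, hT⟩)
  have hgc : ContinuousOn g (uIcc 0 (t + 1)) := by
    rw [uIcc_of_le hT]; exact hg.continuousOn.mono Icc_subset_Ici_self
  have hmeas : ∀ φ : ℝ → ℝ, Continuous φ →
      AEStronglyMeasurable (fun s => g s * φ s) (volume.restrict (uIoc 0 (t + 1))) := by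
    intro φ hφ
    exact ((hgc.mul hφ.continuousOn).mono uIoc_subset_uIcc).aestronglyMeasurable
      measurableSet_uIoc
  have main := intervalIntegral.hasDerivAt_integral_of_dominated_loc_of_lip
    (μ := volume) (a := 0) (b := t + 1) (x₀ := t) (s := Metric.ball t 1)
    (F := fun x s => g s * F (x - s))
    (F' := fun s => (Iic t).indicator (fun s => g s * f' (max (t - s) 0)) s)
    (bound := fun s => |g s| * K) (Metric.ball_mem_nhds t one_pos)
    (Eventually.of_forall fun x => hmeas _ (by fun_prop))
    (hgc.mul (Continuous.continuousOn (by fun_prop))).intervalIntegrable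
    ((hmeas _ (hf'c.comp (by fun_prop : Continuous fun s => t - s))).indicator measurableSet_Iic)
    (by
      filter_upwards with s hs
      rw [uIoc_of_le hT] at hs
      apply LipschitzOnWith.of_dist_le_mul
      intro x hx y hy
      rw [Real.dist_eq, Real.dist_eq, Real.coe_nnabs, abs_mul, abs_abs, abs_of_nonneg hK0,
        ← mul_sub, abs_mul, mul_assoc]
      apply mul_le_mul_of_nonneg_left _ (abs_nonneg _)
      rw [Metric.mem_ball, Real.dist_eq, abs_lt] at hx hy
      have hle := Convex.norm_image_sub_le_of_norm_hasDerivWithin_le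
        (f := f) (f' := f') (s := Icc 0 (t + 1)) (C := K) (x := max (y - s) 0)
        (y := max (x - s) 0)
        (fun z hz => (hf.hasDeriv z hz.1).mono Icc_subset_Ici_self) hK (convex_Icc _ _)
        ⟨le_max_right _ _, max_le (by linarith [hs.1]) hT⟩
        ⟨le_max_right _ _, max_le (by linarith [hs.1]) hT⟩
      have h3 : |max (x - s) 0 - max (y - s) 0| ≤ |x - y| := by
        simpa using abs_max_sub_max_le_abs (x - s) (y - s) 0
      have h4 : F (x - s) - F (y - s) = f (max (x - s) 0) - f (max (y - s) 0) := by
        simp only [hF]; ring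
      rw [h4]
      exact hle.trans (mul_le_mul_of_nonneg_left h3 hK0))
    ((hgc.abs.mul continuousOn_const).intervalIntegrable)
    (by
      have : ∀ᵐ s : ℝ, s ≠ t := by simp [ae_iff]
      filter_upwards [this] with s hst hs
      rcases lt_or_gt_of_ne hst with h | h
      · have hp : 0 < t - s := sub_pos.2 h
        rw [indicator_of_mem (mem_Iic.2 h.le), max_eq_left hp.le]
        apply HasDerivAt.const_mul
        have h5 : HasDerivAt F (f' (t - s)) (t - s) := by
          have := ((hf.hasDeriv _ hp.le).hasDerivAt (Ici_mem_nhds hp)).sub_const (f 0)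
          apply this.congr_of_eventuallyEq
          filter_upwards [Ioi_mem_nhds hp] with z hz
          simp only [hF, max_eq_left (le_of_lt (mem_Ioi.1 hz))]
        exact h5.comp_sub_const t s
      · have hp : t - s < 0 := sub_neg.2 h
        rw [indicator_of_notMem (by simpa using h)]
        have h5 : HasDerivAt F 0 (t - s) := by
          apply (hasDerivAt_const (t - s) (0 : ℝ)).congr_of_eventuallyEq
          filter_upwards [Iio_mem_nhds hp] with z hz
          simp only [hF, max_eq_right (le_of_lt (mem_Iio.1 hz)), sub_self]
        simpa using (h5.comp_sub_const t s).const_mul (g s))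
  have h1 := (hg.hasDerivWithinAt_integral ht).mul_const (f 0)
  have h2 := h1.add main.2.hasDerivWithinAt
  have e1 : ∫ s in (0 : ℝ)..t + 1, (Iic t).indicator (fun s => g s * f' (max (t - s) 0)) s
      = ∫ s in (0 : ℝ)..t, g s * f' (t - s) := by
    rw [intervalIntegral.integral_of_le hT, intervalIntegral.integral_of_le ht,
      setIntegral_indicator measurableSet_Iic]
    have : Ioc 0 (t + 1) ∩ Iic t = Ioc 0 t := by
      ext x; simp only [mem_inter_iff, mem_Ioc, mem_Iic]
      constructor
      · rintro ⟨⟨a, b⟩, c⟩; exact ⟨a, c⟩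
      · rintro ⟨a, c⟩; exact ⟨⟨a, by linarith⟩, c⟩
    rw [this]
    apply setIntegral_congr_fun measurableSet_Ioc
    intro s hs
    simp only [max_eq_left (sub_nonneg.2 hs.2)]
  rw [e1] at h2
  refine HasDerivWithinAt.congr_of_eventuallyEq h2 ?_ ?_
  · have hm : Iio (t + 1) ∈ 𝓝[Ici 0] t := mem_nhdsWithin_of_mem_nhds (Iio_mem_nhds (by linarith))
    filter_upwards [hm, self_mem_nhdsWithin] with x hx1 hx0
    exact hg.conv_eq_integral hf.continuousOn ht x hx0 (le_of_lt hx1)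
  · exact hg.conv_eq_integral hf.continuousOn ht t ht (by linarith)

/-- The derivative of the convolution `g * f`, with no derivative of `f` involved. -/
theorem HypA1.hasDerivWithinAt_conv (hg : HypA1 k₂ g) (hf : IsC1 f f') {t : ℝ} (ht : 0 ≤ t) :
    HasDerivWithinAt (fun t => ∫ s in (0 : ℝ)..t, g s * f (t - s))
      (g t * f t - defect (kernelDeriv g) f t) (Ici 0) t := by
  have h := hg.hasDerivWithinAt_conv_aux hf ht
  have hp := intervalIntegral.integral_deriv_mul_eq_sub_of_hasDeriv_right (a := 0) (b := t)
    (u := g) (v := fun s => f t - f (t - s)) (u' := kernelDeriv g) (v' := fun s => f' (t - s))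
    (by rw [uIcc_of_le ht]; exact hg.continuousOn.mono Icc_subset_Ici_self)
    (continuousOn_const.sub (continuousOn_delay hf.continuousOn ht))
    (fun x hx => by
      rw [min_eq_left ht] at hx
      exact (hg.hasDerivAt hx.1).hasDerivWithinAt)
    (fun x hx => by
      rw [min_eq_left ht, max_eq_right ht] at hx
      have hpos : 0 < t - x := sub_pos.2 hx.2
      have h1 := (hf.hasDeriv _ hpos.le).hasDerivAt (Ici_mem_nhds hpos)
      have h2 := (h1.comp_const_sub t x).const_sub (f t)
      rw [neg_neg] at h2
      exact h2.hasDerivWithinAt)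
    (hg.intervalIntegrable_kernelDeriv ht)
    (continuousOn_delay hf.continuousOn_deriv ht).intervalIntegrable
  rw [intervalIntegral.integral_add
    (intervalIntegrable_defect ht (hg.intervalIntegrable_kernelDeriv ht) hf.continuousOn)
    (intervalIntegrable_mul_delay ht (hg.intervalIntegrable le_rfl ht) hf.continuousOn_deriv)] at hp
  simp only [sub_self, sub_zero, mul_zero] at hp
  convert h using 1
  rw [defect]
  linarith

theorem HypA1.defect_eq (hg : HypA1 k₂ g) (hf : ContinuousOn f (Ici 0)) {t : ℝ} (ht : 0 ≤ t) :
    defect g f t = (∫ s in (0 : ℝ)..t, g s) * f t - ∫ s in (0 : ℝ)..t, g s * f (t - s) := by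
  have hgi := hg.intervalIntegrable le_rfl ht
  rw [defect, ← intervalIntegral.integral_mul_const,
    ← intervalIntegral.integral_sub (hgi.mul_const _) (intervalIntegrable_mul_delay ht hgi hf)]
  congr 1; ext s; ring

theorem variation_eq {k : ℝ → ℝ} {t : ℝ} (ht : 0 ≤ t) (hk : IntervalIntegrable k volume 0 t)
    (hf : ContinuousOn f (Ici 0)) :
    variation k f t = 2 * f t * defect k f t - defect k (fun s => f s ^ 2) t := by
  rw [variation, defect, defect, ← intervalIntegral.integral_const_mul,
    ← intervalIntegral.integral_sub ((intervalIntegrable_defect ht hk hf).const_mul _)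
      (intervalIntegrable_defect (f := fun s => f s ^ 2) ht hk (hf.pow 2))]
  congr 1; ext s; ring

theorem HypA1.hasDerivWithinAt_defect (hg : HypA1 k₂ g) (hf : IsC1 f f') {t : ℝ} (ht : 0 ≤ t) :
    HasDerivWithinAt (defect g f)
      ((∫ s in (0 : ℝ)..t, g s) * f' t + defect (kernelDeriv g) f t) (Ici 0) t := by
  have h := ((hg.hasDerivWithinAt_integral ht).mul (hf.hasDeriv t ht)).sub
    (hg.hasDerivWithinAt_conv hf ht)
  refine (h.congr (fun x hx => hg.defect_eq hf.continuousOn hx)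
    (hg.defect_eq hf.continuousOn ht)).congr_deriv ?_
  ring

theorem HypA1.hasDerivWithinAt_variation (hg : HypA1 k₂ g) (hf : IsC1 f f') {t : ℝ}
    (ht : 0 ≤ t) :
    HasDerivWithinAt (variation g f)
      (2 * f' t * defect g f t + variation (kernelDeriv g) f t) (Ici 0) t := by
  have h := ((hf.hasDeriv t ht).const_mul 2).mul (hg.hasDerivWithinAt_defect hf ht) |>.sub
    (hg.hasDerivWithinAt_defect hf.sq ht)
  have e : ∀ x ∈ Ici (0 : ℝ), variation g f x
      = 2 * f x * defect g f x - defect g (fun s => f s ^ 2) x := fun x hx =>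
    variation_eq hx (hg.intervalIntegrable le_rfl hx) hf.continuousOn
  refine (h.congr e (e t ht)).congr_deriv ?_
  rw [variation_eq ht (hg.intervalIntegrable_kernelDeriv ht) hf.continuousOn]
  ring

end Derivatives

end Bresse

/-! ### Algebraic estimates for a single mode -/

namespace Bresse

theorem mul_le_eps {ε : ℝ} (hε : 0 < ε) (x y : ℝ) : x * y ≤ ε * x ^ 2 + y ^ 2 / (4 * ε) := by
  have h : 0 ≤ ε * (x - y / (2 * ε)) ^ 2 := by positivity
  have e : ε * (x - y / (2 * ε)) ^ 2 = ε * x ^ 2 + y ^ 2 / (4 * ε) - x * y := by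
    field_simp; ring
  linarith

theorem neg_mul_le_eps {ε : ℝ} (hε : 0 < ε) (x y : ℝ) :
    -(x * y) ≤ ε * x ^ 2 + y ^ 2 / (4 * ε) := by
  have := mul_le_eps hε (-x) y
  rw [neg_sq] at this
  linarith

/-- The displacement `a` is controlled by the two strains `S`, `N` and by `b`. -/
theorem sq_mul_le_strains {μ l a b c S N : ℝ} (hμ : 0 < μ) (hl : 0 < l) (hlμ : 4 * l ≤ μ)
    (hS : S = μ * a + b + l * c) (hN : N = μ * c + l * a) :
    (μ * a) ^ 2 ≤ 5 * (S ^ 2 + b ^ 2) + N ^ 2 / 6 := by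
  set τ := l / μ with hτ
  have hτ0 : 0 ≤ τ := by positivity
  have hτ1 : τ ≤ 1 / 4 := by rw [hτ, div_le_iff₀ hμ]; linarith
  have hlτ : l = τ * μ := by rw [hτ]; field_simp
  set x := μ * a with hx
  have e : x * (1 - τ ^ 2) = S - b - τ * N := by
    rw [hS, hN, hlτ, hx]; ring
  have hτ2 : τ ^ 2 ≤ 1 / 16 := by nlinarith
  have h1 : (x * (1 - τ ^ 2)) ^ 2 = x ^ 2 * (1 - τ ^ 2) ^ 2 := by ring
  have h2 : (15 / 16 : ℝ) ^ 2 ≤ (1 - τ ^ 2) ^ 2 := by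
    apply pow_le_pow_left₀ (by norm_num); linarith
  have h3 : x ^ 2 * (15 / 16) ^ 2 ≤ (S - b - τ * N) ^ 2 := by
    rw [← e, h1]; exact mul_le_mul_of_nonneg_left h2 (sq_nonneg _)
  have h4 : (S - b - τ * N) ^ 2 ≤ 2 * (S - b) ^ 2 + 2 * (τ ^ 2 * N ^ 2) := by
    linarith only [sq_nonneg (S - b + τ * N)]
  have h5 : τ ^ 2 * N ^ 2 ≤ 1 / 16 * N ^ 2 := mul_le_mul_of_nonneg_right hτ2 (sq_nonneg _)
  linarith only [h3, h4, h5, sq_nonneg (S + b), sq_nonneg S, sq_nonneg b, sq_nonneg N]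

/-- The part of the Lyapunov derivative that controls the axial strain and the velocities `a'`
and `c'`; it uses that `l` is small compared with `μ`. -/
theorem axial_estimate {k₁ ρ₁ μ l a b c a1 b1 c1 S N : ℝ} (hk₁ : 0 < k₁) (hρ₁ : 0 < ρ₁)
    (hμ : 0 < μ) (hl : 0 < l) (hlμ : 4 * l ≤ μ)
    (hS : S = μ * a + b + l * c) (hN : N = μ * c + l * a) :
    (1 / l) * (-(l * k₁ * N ^ 2) + l * k₁ * S ^ 2 + ρ₁ * l * a1 ^ 2 - ρ₁ * l * c1 ^ 2
        - ρ₁ * c1 * b1)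
      + 2 * (-(ρ₁ * a1 ^ 2) + k₁ * μ * a * S + l * k₁ * a * N)
    ≤ -(k₁ / 2 * N ^ 2) - 3 / 4 * ρ₁ * c1 ^ 2 - ρ₁ * a1 ^ 2 + 19 * k₁ * S ^ 2
      + 18 * k₁ * b ^ 2 + ρ₁ / l ^ 2 * b1 ^ 2 := by
  have hx := sq_mul_le_strains hμ hl hlμ hS hN
  set x := μ * a with hx'
  have h1 : 2 * (x * S) ≤ 1 / 16 * x ^ 2 + 16 * S ^ 2 := by
    linarith only [sq_nonneg (x - 16 * S)]
  have h2 : 2 * (l * a * N) ≤ 1 / 4 * (x ^ 2 + N ^ 2) := by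
    have : l * a = (l / μ) * x := by rw [hx']; field_simp
    have hτ0 : 0 ≤ l / μ := by positivity
    have hτ1 : l / μ ≤ 1 / 4 := by rw [div_le_iff₀ hμ]; linarith
    rw [this]
    have h3 : 2 * (x * N) ≤ x ^ 2 + N ^ 2 := by linarith only [sq_nonneg (x - N)]
    calc 2 * (l / μ * x * N) = l / μ * (2 * (x * N)) := by ring
      _ ≤ l / μ * (x ^ 2 + N ^ 2) := mul_le_mul_of_nonneg_left h3 hτ0
      _ ≤ 1 / 4 * (x ^ 2 + N ^ 2) := mul_le_mul_of_nonneg_right hτ1 (by positivity)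
  have h3 : -(c1 * (b1 / l)) ≤ 1 / 4 * c1 ^ 2 + (b1 / l) ^ 2 / (4 * (1 / 4)) :=
    neg_mul_le_eps (by norm_num) _ _
  have h4 : 2 * (x * S) + 2 * (l * a * N) ≤ 1 / 2 * N ^ 2 + 18 * S ^ 2 + 18 * b ^ 2 := by
    linarith only [h1, h2, hx, sq_nonneg S, sq_nonneg b, sq_nonneg N]
  have h5 := mul_le_mul_of_nonneg_left h4 hk₁.le
  have h6 := mul_le_mul_of_nonneg_left h3 hρ₁.le
  have e1 : (1 / l) * (-(l * k₁ * N ^ 2) + l * k₁ * S ^ 2 + ρ₁ * l * a1 ^ 2 - ρ₁ * l * c1 ^ 2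
        - ρ₁ * c1 * b1)
      + 2 * (-(ρ₁ * a1 ^ 2) + k₁ * μ * a * S + l * k₁ * a * N)
      = -(k₁ * N ^ 2) + k₁ * S ^ 2 - ρ₁ * a1 ^ 2 - ρ₁ * c1 ^ 2 + ρ₁ * -(c1 * (b1 / l))
        + k₁ * (2 * (x * S) + 2 * (l * a * N)) := by
    rw [hx']; field_simp; ring
  have e2 : ρ₁ / l ^ 2 * b1 ^ 2 = ρ₁ * ((b1 / l) ^ 2 / (4 * (1 / 4))) := by
    field_simp
  rw [e1, e2]
  linarith only [h5, h6]

/-- The part of the Lyapunov derivative that controls `ψₓ`. -/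
theorem bending_estimate {k₁ ρ₂ h h₁ μ₀ b b1 S B M : ℝ} (hh₁ : 0 < h₁) (hμ₀ : 0 < μ₀)
    (hh : h₁ ≤ h) (hb : μ₀ ^ 2 * b ^ 2 ≤ B ^ 2) :
    ρ₂ * b1 ^ 2 - h * B ^ 2 - M * B - k₁ * S * b
      ≤ ρ₂ * b1 ^ 2 - h₁ / 2 * B ^ 2 + 1 / h₁ * M ^ 2 + k₁ ^ 2 / (h₁ * μ₀ ^ 2) * S ^ 2 := by
  have h1 := neg_mul_le_eps (ε := h₁ / 4) (by positivity) B M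
  have h2 := neg_mul_le_eps (ε := h₁ / 4) (by positivity) (μ₀ * b) (k₁ / μ₀ * S)
  have e1 : M ^ 2 / (4 * (h₁ / 4)) = 1 / h₁ * M ^ 2 := by field_simp
  have e2 : (k₁ / μ₀ * S) ^ 2 / (4 * (h₁ / 4)) = k₁ ^ 2 / (h₁ * μ₀ ^ 2) * S ^ 2 := by field_simp
  have e3 : μ₀ * b * (k₁ / μ₀ * S) = k₁ * S * b := by field_simp
  have e4 : (μ₀ * b) ^ 2 = μ₀ ^ 2 * b ^ 2 := by ring
  rw [e1] at h1
  rw [e2, e3, e4] at h2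
  have h3 := mul_le_mul_of_nonneg_right hh (sq_nonneg B)
  have h4 := mul_le_mul_of_nonneg_left hb (by positivity : 0 ≤ h₁ / 4)
  linarith only [h1, h2, h3, h4]

/-- The part of the Lyapunov derivative that controls the shear strain. The coupling term
`l N (h B + M)` is harmless because `l` is small compared with the weight `M₂`. -/
theorem shear_estimate {k₁ k₂ ρ₁ ρ₂ h g₀ gt l a1 b1 c1 S N B M W Δ M₂ : ℝ} (hk₁ : 0 < k₁)
    (hρ₁ : 0 < ρ₁) (hh0 : 0 ≤ h) (hh : h ≤ k₂)
    (hl : 4 * M₂ ^ 2 * l ^ 2 * k₂ ^ 2 ≤ k₁) (hgt0 : 0 ≤ gt) (hgt : gt ≤ g₀)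
    (hW : W ^ 2 ≤ 2 * g₀ * Δ) (hB : gt * B ^ 2 ≤ 2 * Δ) :
    M₂ * (-(k₁ * S ^ 2) + ρ₂ * b1 ^ 2 + ρ₂ * l * b1 * c1 + l * N * (h * B + M)
        + ρ₁ / k₁ * a1 * (gt * B - W))
      ≤ -(M₂ * k₁ * S ^ 2) + M₂ * ρ₂ * b1 ^ 2 + ρ₁ / 4 * c1 ^ 2 + (M₂ * ρ₂ * l) ^ 2 / ρ₁ * b1 ^ 2
        + k₁ / 8 * N ^ 2 + B ^ 2 + 4 * M₂ ^ 2 * l ^ 2 / k₁ * M ^ 2 + ρ₁ / 4 * a1 ^ 2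
        + 8 * g₀ * M₂ ^ 2 * ρ₁ / k₁ ^ 2 * Δ := by
  have h1 := mul_le_eps (ε := ρ₁ / 4) (by positivity) c1 (M₂ * ρ₂ * l * b1)
  have h2 := mul_le_eps (ε := k₁ / 8) (by positivity) N (M₂ * l * (h * B + M))
  have h3 := mul_le_eps (ε := ρ₁ / 4) (by positivity) a1 (M₂ * (ρ₁ / k₁) * (gt * B - W))
  have e1 : (M₂ * ρ₂ * l * b1) ^ 2 / (4 * (ρ₁ / 4)) = (M₂ * ρ₂ * l) ^ 2 / ρ₁ * b1 ^ 2 := by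
    field_simp
  have e2 : (M₂ * l * (h * B + M)) ^ 2 / (4 * (k₁ / 8))
      = 2 * M₂ ^ 2 * l ^ 2 / k₁ * (h * B + M) ^ 2 := by field_simp; ring
  have e3 : (M₂ * (ρ₁ / k₁) * (gt * B - W)) ^ 2 / (4 * (ρ₁ / 4))
      = M₂ ^ 2 * ρ₁ / k₁ ^ 2 * (gt * B - W) ^ 2 := by field_simp
  rw [e1] at h1
  rw [e2] at h2
  rw [e3] at h3
  have h4 : (h * B + M) ^ 2 ≤ 2 * (k₂ ^ 2 * B ^ 2) + 2 * M ^ 2 := by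
    have : h ^ 2 * B ^ 2 ≤ k₂ ^ 2 * B ^ 2 :=
      mul_le_mul_of_nonneg_right (pow_le_pow_left₀ hh0 hh 2) (sq_nonneg _)
    linarith only [this, sq_nonneg (h * B - M)]
  have h5 : (gt * B - W) ^ 2 ≤ 8 * g₀ * Δ := by
    have h51 : gt * (gt * B ^ 2) ≤ g₀ * (2 * Δ) :=
      mul_le_mul hgt hB (by positivity) (hgt0.trans hgt)
    linarith only [h51, hW, sq_nonneg (gt * B + W)]
  have h6 := mul_le_mul_of_nonneg_left h4 (by positivity : 0 ≤ 2 * M₂ ^ 2 * l ^ 2 / k₁)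
  have h7 := mul_le_mul_of_nonneg_left h5 (by positivity : 0 ≤ M₂ ^ 2 * ρ₁ / k₁ ^ 2)
  have h8 : 4 * M₂ ^ 2 * l ^ 2 * k₂ ^ 2 / k₁ * B ^ 2 ≤ 1 * B ^ 2 :=
    mul_le_mul_of_nonneg_right ((div_le_one hk₁).2 hl) (sq_nonneg _)
  have e6 : 2 * M₂ ^ 2 * l ^ 2 / k₁ * (2 * (k₂ ^ 2 * B ^ 2) + 2 * M ^ 2)
      = 4 * M₂ ^ 2 * l ^ 2 * k₂ ^ 2 / k₁ * B ^ 2 + 4 * M₂ ^ 2 * l ^ 2 / k₁ * M ^ 2 := by ring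
  have e7 : M₂ ^ 2 * ρ₁ / k₁ ^ 2 * (8 * g₀ * Δ) = 8 * g₀ * M₂ ^ 2 * ρ₁ / k₁ ^ 2 * Δ := by ring
  rw [e6] at h6
  rw [e7] at h7
  have e8 : M₂ * (-(k₁ * S ^ 2) + ρ₂ * b1 ^ 2 + ρ₂ * l * b1 * c1 + l * N * (h * B + M)
        + ρ₁ / k₁ * a1 * (gt * B - W))
      = -(M₂ * k₁ * S ^ 2) + M₂ * ρ₂ * b1 ^ 2 + c1 * (M₂ * ρ₂ * l * b1)
        + N * (M₂ * l * (h * B + M)) + a1 * (M₂ * (ρ₁ / k₁) * (gt * B - W)) := by ring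
  rw [e8]
  linarith only [h1, h2, h3, h6, h7, h8]

/-- The part of the Lyapunov derivative that controls `ψₜ`, with a weight `M₁` chosen so large
that `K b'²` is absorbed. -/
theorem memory_estimate {k₁ k₂ ρ₂ h g₀ γ G μ₀ μ b1 S B m R P Δ M₁ K : ℝ}
    (hρ₂ : 0 < ρ₂) (hμ₀ : 0 < μ₀) (hμ : μ₀ ≤ μ) (hh0 : 0 ≤ h) (hh : h ≤ k₂)
    (hG : γ ≤ G) (hm : (μ * m) ^ 2 ≤ k₂ * P) (hR : (μ * R) ^ 2 ≤ 2 * g₀ * Δ) (hM₁ : 0 < M₁)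
    (hK : 0 < K) (hMK : M₁ * ρ₂ * γ = 2 * K) :
    M₁ * (-(ρ₂ * G * b1 ^ 2) - ρ₂ * b1 * R + h * (μ * m) * B + (μ * m) ^ 2 + k₁ * m * S)
      ≤ -(K * b1 ^ 2) + 1 / 2 * B ^ 2 + 1 / 2 * S ^ 2
        + (M₁ ^ 2 * k₂ ^ 2 / 2 + M₁ + M₁ ^ 2 * k₁ ^ 2 / (2 * μ₀ ^ 2)) * (k₂ * P)
        + (M₁ * ρ₂) ^ 2 / (4 * K) * (2 * g₀ / μ₀ ^ 2) * Δ := by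
  have hμ2 : μ₀ ^ 2 ≤ μ ^ 2 := pow_le_pow_left₀ hμ₀.le hμ 2
  have hm' : m ^ 2 ≤ k₂ * P / μ₀ ^ 2 := by
    rw [le_div_iff₀ (by positivity)]
    linarith only [hm, mul_le_mul_of_nonneg_right hμ2 (sq_nonneg m)]
  have hR' : R ^ 2 ≤ 2 * g₀ / μ₀ ^ 2 * Δ := by
    rw [div_mul_eq_mul_div, le_div_iff₀ (by positivity)]
    linarith only [hR, mul_le_mul_of_nonneg_right hμ2 (sq_nonneg R)]
  have h1 := neg_mul_le_eps hK b1 (M₁ * ρ₂ * R)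
  have h2 := mul_le_eps (ε := 1 / 2) (by norm_num) B (M₁ * h * (μ * m))
  have h3 := mul_le_eps (ε := 1 / 2) (by norm_num) S (M₁ * k₁ * m)
  have h4 : M₁ * ρ₂ * γ * b1 ^ 2 ≤ M₁ * ρ₂ * G * b1 ^ 2 :=
    mul_le_mul_of_nonneg_right (mul_le_mul_of_nonneg_left hG (by positivity)) (sq_nonneg _)
  rw [hMK] at h4
  have h5 : (M₁ * ρ₂ * R) ^ 2 / (4 * K) ≤ (M₁ * ρ₂) ^ 2 / (4 * K) * (2 * g₀ / μ₀ ^ 2) * Δ := by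
    have := mul_le_mul_of_nonneg_left hR' (by positivity : 0 ≤ (M₁ * ρ₂) ^ 2 / (4 * K))
    calc (M₁ * ρ₂ * R) ^ 2 / (4 * K) = (M₁ * ρ₂) ^ 2 / (4 * K) * R ^ 2 := by ring
      _ ≤ _ := this
      _ = _ := by ring
  have h6 : (M₁ * h * (μ * m)) ^ 2 / (4 * (1 / 2)) ≤ M₁ ^ 2 * k₂ ^ 2 / 2 * (k₂ * P) := by
    have h61 : h ^ 2 * (μ * m) ^ 2 ≤ k₂ ^ 2 * (k₂ * P) :=
      mul_le_mul (pow_le_pow_left₀ hh0 hh 2) hm (sq_nonneg _) (sq_nonneg _)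
    have := mul_le_mul_of_nonneg_left h61 (by positivity : 0 ≤ M₁ ^ 2 / 2)
    calc (M₁ * h * (μ * m)) ^ 2 / (4 * (1 / 2)) = M₁ ^ 2 / 2 * (h ^ 2 * (μ * m) ^ 2) := by ring
      _ ≤ _ := this
      _ = _ := by ring
  have h7 : (M₁ * k₁ * m) ^ 2 / (4 * (1 / 2)) ≤ M₁ ^ 2 * k₁ ^ 2 / (2 * μ₀ ^ 2) * (k₂ * P) := by
    have := mul_le_mul_of_nonneg_left hm' (by positivity : 0 ≤ M₁ ^ 2 * k₁ ^ 2 / 2)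
    calc (M₁ * k₁ * m) ^ 2 / (4 * (1 / 2)) = M₁ ^ 2 * k₁ ^ 2 / 2 * m ^ 2 := by ring
      _ ≤ _ := this
      _ = _ := by field_simp
  have h8 := mul_le_mul_of_nonneg_left hm hM₁.le
  have e : M₁ * (-(ρ₂ * G * b1 ^ 2) - ρ₂ * b1 * R + h * (μ * m) * B + (μ * m) ^ 2 + k₁ * m * S)
      = -(M₁ * ρ₂ * G * b1 ^ 2) + -(b1 * (M₁ * ρ₂ * R)) + B * (M₁ * h * (μ * m))
        + S * (M₁ * k₁ * m) + M₁ * (μ * m) ^ 2 := by ring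
  rw [e]
  linarith only [h1, h2, h3, h4, h5, h6, h7, h8]

/-- The combined estimate. The weights `M₂`, `M₃` and the threshold `l₀` depend only on the
physical constants; the weight `M₁` and the constant `C` depend also on `l` and on the lower bound
`γ` of `∫₀ᵗ g`, but never on the frequency `μ`. -/
theorem exists_weights {k₁ k₂ ρ₁ ρ₂ h₁ μ₀ g₀ : ℝ} (hk₁ : 0 < k₁) (hk₂ : 0 < k₂) (hρ₁ : 0 < ρ₁)
    (hρ₂ : 0 < ρ₂) (hh₁ : 0 < h₁) (hμ₀ : 0 < μ₀) (hg₀ : 0 < g₀) :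
    ∃ l₀ : ℝ, 0 < l₀ ∧ 4 * l₀ ≤ μ₀ ∧ ∃ M₂ M₃ : ℝ, ∀ l : ℝ, 0 < l → l < l₀ → ∀ γ : ℝ, 0 < γ →
      ∃ M₁ C : ℝ, 0 ≤ C ∧ ∀ μ h G gt a b c a1 b1 c1 S N m R P Δ : ℝ, μ₀ ≤ μ → h₁ ≤ h → h ≤ k₂ →
        γ ≤ G → 0 ≤ gt → gt ≤ g₀ → 0 ≤ P → 0 ≤ Δ → S = μ * a + b + l * c → N = μ * c + l * a →
        (μ * m) ^ 2 ≤ k₂ * P → (μ * R) ^ 2 ≤ 2 * g₀ * Δ → gt * (μ * b) ^ 2 ≤ 2 * Δ →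
        M₁ * (-(ρ₂ * G * b1 ^ 2) - ρ₂ * b1 * R + h * (μ * m) * (μ * b) + (μ * m) ^ 2
            + k₁ * m * S)
          + M₂ * (-(k₁ * S ^ 2) + ρ₂ * b1 ^ 2 + ρ₂ * l * b1 * c1
            + l * N * (h * (μ * b) + μ * m) + ρ₁ / k₁ * a1 * (gt * (μ * b) - μ * R))
          + M₃ * (ρ₂ * b1 ^ 2 - h * (μ * b) ^ 2 - (μ * m) * (μ * b) - k₁ * S * b)
          + (1 / l) * (-(l * k₁ * N ^ 2) + l * k₁ * S ^ 2 + ρ₁ * l * a1 ^ 2 - ρ₁ * l * c1 ^ 2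
            - ρ₁ * c1 * b1)
          + 2 * (-(ρ₁ * a1 ^ 2) + k₁ * μ * a * S + l * k₁ * a * N)
        ≤ -(1 / 2 * (μ * b) ^ 2 + 1 / 2 * S ^ 2 + 3 * k₁ / 8 * N ^ 2 + ρ₁ / 2 * c1 ^ 2
            + ρ₁ / 2 * a1 ^ 2 + b1 ^ 2) + C * (P + Δ) := by
  -- `M₃ h₁ / 2` has to exceed the coefficient of `ψₓ²` in the axial estimate, and `M₂ k₁` the
  -- coefficients of the squared shear strain in the axial and bending estimates
  obtain ⟨M₃, hM₃⟩ : ∃ x, x = 2 * (18 * k₁ / μ₀ ^ 2 + 2) / h₁ := ⟨_, rfl⟩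
  have hM₃0 : 0 < M₃ := by rw [hM₃]; positivity
  obtain ⟨M₂, hM₂⟩ : ∃ x, x = (M₃ * (k₁ ^ 2 / (h₁ * μ₀ ^ 2)) + 19 * k₁ + 1) / k₁ := ⟨_, rfl⟩
  have hM₂0 : 0 < M₂ := by rw [hM₂]; positivity
  have hM₂k : M₂ * k₁ = M₃ * (k₁ ^ 2 / (h₁ * μ₀ ^ 2)) + 19 * k₁ + 1 := by
    rw [hM₂]; field_simp
  have hM₃h : M₃ * (h₁ / 2) = 18 * k₁ / μ₀ ^ 2 + 2 := by rw [hM₃]; field_simp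
  refine ⟨min (μ₀ / 4) (Real.sqrt k₁ / (2 * M₂ * k₂)), by positivity, ?_, M₂, M₃, ?_⟩
  · linarith [min_le_left (μ₀ / 4) (Real.sqrt k₁ / (2 * M₂ * k₂))]
  intro l hl hll γ hγ
  have hl1 : 4 * l ≤ μ₀ := by linarith [hll.le.trans (min_le_left _ _)]
  have hl2 : 4 * M₂ ^ 2 * l ^ 2 * k₂ ^ 2 ≤ k₁ := by
    have h1 := hll.le.trans (min_le_right _ _)
    rw [le_div_iff₀ (by positivity)] at h1
    have h2 := pow_le_pow_left₀ (by positivity) h1 2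
    rw [Real.sq_sqrt hk₁.le] at h2
    exact (by ring : 4 * M₂ ^ 2 * l ^ 2 * k₂ ^ 2 = (l * (2 * M₂ * k₂)) ^ 2).trans_le h2
  -- the sum of all coefficients of `b1 ^ 2` in the other estimates; `1 / l` is harmless here, since
  -- `M₁` does not enter the smallness condition on `l`
  obtain ⟨K, hK⟩ : ∃ x, x = ρ₁ / l ^ 2 + M₃ * ρ₂ + M₂ * ρ₂ + (M₂ * ρ₂ * l) ^ 2 / ρ₁ + 1 := ⟨_, rfl⟩
  have hK0 : 0 < K := by rw [hK]; positivity
  obtain ⟨M₁, hM₁⟩ : ∃ x, x = 2 * K / (ρ₂ * γ) := ⟨_, rfl⟩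
  have hM₁0 : 0 < M₁ := by rw [hM₁]; positivity
  have hMK : M₁ * ρ₂ * γ = 2 * K := by rw [hM₁]; field_simp
  obtain ⟨C₁, hC₁⟩ : ∃ x, x = (M₃ * (1 / h₁) + 4 * M₂ ^ 2 * l ^ 2 / k₁
      + (M₁ ^ 2 * k₂ ^ 2 / 2 + M₁ + M₁ ^ 2 * k₁ ^ 2 / (2 * μ₀ ^ 2))) * k₂ := ⟨_, rfl⟩
  obtain ⟨C₂, hC₂⟩ : ∃ x, x = 8 * g₀ * M₂ ^ 2 * ρ₁ / k₁ ^ 2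
    + (M₁ * ρ₂) ^ 2 / (4 * K) * (2 * g₀ / μ₀ ^ 2) := ⟨_, rfl⟩
  have hC₁0 : 0 ≤ C₁ := by rw [hC₁]; positivity
  have hC₂0 : 0 ≤ C₂ := by rw [hC₂]; positivity
  refine ⟨M₁, C₁ + C₂, by positivity, ?_⟩
  intro μ h G gt a b c a1 b1 c1 S N m R P Δ hμ hh hhk hG hgt0 hgt hP hΔ hS hN hm hR hB
  have hμ0 : 0 < μ := hμ₀.trans_le hμ
  have hh0 : 0 ≤ h := hh₁.le.trans hh
  have hb : μ₀ ^ 2 * b ^ 2 ≤ (μ * b) ^ 2 := by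
    rw [mul_pow]
    exact mul_le_mul_of_nonneg_right (pow_le_pow_left₀ hμ₀.le hμ 2) (sq_nonneg b)
  have A1 := axial_estimate (a1 := a1) (b1 := b1) (c1 := c1) hk₁ hρ₁ hμ0 hl (hl1.trans hμ) hS hN
  have A2 := mul_le_mul_of_nonneg_left (bending_estimate (k₁ := k₁) (ρ₂ := ρ₂) (b1 := b1) (S := S)
    (M := μ * m) hh₁ hμ₀ hh hb) hM₃0.le
  have A3 := shear_estimate (ρ₂ := ρ₂) (a1 := a1) (b1 := b1) (c1 := c1) (S := S) (N := N)
    (M := μ * m) hk₁ hρ₁ hh0 hhk hl2 hgt0 hgt hR hB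
  have A4 := memory_estimate (k₁ := k₁) (b1 := b1) (S := S) (B := μ * b) hρ₂ hμ₀ hμ hh0 hhk hG hm
    hR hM₁0 hK0 hMK
  have hb2 : 18 * k₁ * b ^ 2 ≤ 18 * k₁ / μ₀ ^ 2 * (μ * b) ^ 2 := by
    rw [div_mul_eq_mul_div, le_div_iff₀ (by positivity)]
    linarith only [mul_le_mul_of_nonneg_left hb hk₁.le]
  have hm2 := mul_le_mul_of_nonneg_left hm
    (by positivity : 0 ≤ M₃ * (1 / h₁) + 4 * M₂ ^ 2 * l ^ 2 / k₁)
  have e2 : M₃ * (ρ₂ * b1 ^ 2 - h₁ / 2 * (μ * b) ^ 2 + 1 / h₁ * (μ * m) ^ 2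
      + k₁ ^ 2 / (h₁ * μ₀ ^ 2) * S ^ 2)
      = M₃ * ρ₂ * b1 ^ 2 - (18 * k₁ / μ₀ ^ 2 + 2) * (μ * b) ^ 2 + M₃ * (1 / h₁) * (μ * m) ^ 2
        + M₃ * (k₁ ^ 2 / (h₁ * μ₀ ^ 2)) * S ^ 2 := by rw [← hM₃h]; ring
  rw [e2] at A2
  rw [hM₂k] at A3
  have hPC : 0 ≤ C₂ * P := by positivity
  have hDC : 0 ≤ C₁ * Δ := by positivity
  have e3 : K * b1 ^ 2 = ρ₁ / l ^ 2 * b1 ^ 2 + M₃ * ρ₂ * b1 ^ 2 + M₂ * ρ₂ * b1 ^ 2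
    + (M₂ * ρ₂ * l) ^ 2 / ρ₁ * b1 ^ 2 + b1 ^ 2 := by rw [hK]; ring
  rw [e3] at A4
  have hN2 := mul_nonneg hk₁.le (sq_nonneg N)
  have ha2 := mul_nonneg hρ₁.le (sq_nonneg a1)
  have e4 : (C₁ + C₂) * (P + Δ) = (M₃ * (1 / h₁) + 4 * M₂ ^ 2 * l ^ 2 / k₁) * (k₂ * P)
      + (M₁ ^ 2 * k₂ ^ 2 / 2 + M₁ + M₁ ^ 2 * k₁ ^ 2 / (2 * μ₀ ^ 2)) * (k₂ * P)
      + 8 * g₀ * M₂ ^ 2 * ρ₁ / k₁ ^ 2 * Δ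
      + (M₁ * ρ₂) ^ 2 / (4 * K) * (2 * g₀ / μ₀ ^ 2) * Δ + C₂ * P + C₁ * Δ := by
    rw [hC₁, hC₂]; ring
  rw [e4]
  linarith only [A1, A2, A3, A4, hb2, hm2, hPC, hDC, hN2, ha2]

/-- The combination of multipliers is bounded, uniformly in `μ ≥ μ₀`, by the squares that the energy
controls. -/
theorem exists_functional_bound {k₁ k₂ ρ₁ ρ₂ h₁ μ₀ l M₁ M₂ M₃ : ℝ} (hk₂ : 0 < k₂)
    (hρ₁ : 0 < ρ₁) (hμ₀ : 0 < μ₀) (hh₁ : 0 < h₁) (hl : 0 < l)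
    (hl4 : 4 * l ≤ μ₀) :
    ∃ C : ℝ, 0 ≤ C ∧ ∀ μ h a b c a1 b1 c1 S N m P : ℝ, μ₀ ≤ μ → h₁ ≤ h → h ≤ k₂ → 0 ≤ P →
      S = μ * a + b + l * c → N = μ * c + l * a → (μ * m) ^ 2 ≤ k₂ * P →
      |M₁ * (-(ρ₂ * b1 * m)) + M₂ * (ρ₂ * b1 * S - ρ₁ / k₁ * a1 * (h * (μ * b) + μ * m))
        + M₃ * (ρ₂ * b * b1) + (1 / l) * (ρ₁ * (a1 * N - c1 * S)) + 2 * (-(ρ₁ * a * a1))|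
      ≤ C * (a1 ^ 2 + b1 ^ 2 + c1 ^ 2 + S ^ 2 + N ^ 2 + (μ * b) ^ 2 + P) := by
  obtain ⟨α, hα⟩ : ∃ x, x = 1 + 1 / μ₀ ^ 2 + k₂ / μ₀ ^ 2 + (2 * k₂ ^ 2 + 2 * k₂)
    + (5 * (1 + 1 / μ₀ ^ 2) + 1) / μ₀ ^ 2 := ⟨_, rfl⟩
  refine ⟨α * (|M₁ * ρ₂| + |M₂ * ρ₂| + |M₂ * (ρ₁ / k₁)| + |M₃ * ρ₂| + |1 / l * ρ₁| + |1 / l * ρ₁|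
    + |2 * ρ₁|), mul_nonneg (by rw [hα]; positivity) (by positivity), ?_⟩
  intro μ h a b c a1 b1 c1 S N m P hμ hh hhk hP hS hN hm
  obtain ⟨V, hV⟩ : ∃ x, x = a1 ^ 2 + b1 ^ 2 + c1 ^ 2 + S ^ 2 + N ^ 2 + (μ * b) ^ 2 + P := ⟨_, rfl⟩
  have hμ0 : 0 < μ := hμ₀.trans_le hμ
  have hh0 : 0 ≤ h := hh₁.le.trans hh
  have hV0 : 0 ≤ V := by rw [hV]; positivity
  have hμ2 : μ₀ ^ 2 ≤ μ ^ 2 := pow_le_pow_left₀ hμ₀.le hμ 2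
  have down : ∀ x y : ℝ, (μ * x) ^ 2 ≤ y → x ^ 2 ≤ y / μ₀ ^ 2 := by
    intro x y hxy
    rw [le_div_iff₀ (by positivity)]
    linarith only [hxy, mul_le_mul_of_nonneg_right hμ2 (sq_nonneg x)]
  have p1 : 0 ≤ 1 / μ₀ ^ 2 := by positivity
  have p2 : 0 ≤ k₂ / μ₀ ^ 2 := by positivity
  have p3 : 0 ≤ 2 * k₂ ^ 2 + 2 * k₂ := by positivity
  have p4 : 0 ≤ (5 * (1 + 1 / μ₀ ^ 2) + 1) / μ₀ ^ 2 := by positivity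
  have up : ∀ x β : ℝ, x ^ 2 ≤ β * V → β ≤ α → x ^ 2 ≤ α * V := fun x β h1 h2 =>
    h1.trans (mul_le_mul_of_nonneg_right h2 hV0)
  have s1 := sq_nonneg a1
  have s2 := sq_nonneg b1
  have s3 := sq_nonneg c1
  have s4 := sq_nonneg S
  have s5 := sq_nonneg N
  have s6 := sq_nonneg (μ * b)
  have hBV : (μ * b) ^ 2 ≤ V := by rw [hV]; linarith only [s1, s2, s3, s4, s5, s6, hP]
  have hPV : k₂ * P ≤ k₂ * V := mul_le_mul_of_nonneg_left
    (by rw [hV]; linarith only [s1, s2, s3, s4, s5, s6, hP]) hk₂.le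
  have q : ∀ x : ℝ, x ^ 2 ≤ V → x ^ 2 ≤ α * V := fun x hx =>
    up x 1 (by rwa [one_mul]) (by rw [hα]; linarith only [p1, p2, p3, p4])
  have qa1 : a1 ^ 2 ≤ α * V := q _ (by rw [hV]; linarith only [s1, s2, s3, s4, s5, s6, hP])
  have qb1 : b1 ^ 2 ≤ α * V := q _ (by rw [hV]; linarith only [s1, s2, s3, s4, s5, s6, hP])
  have qc1 : c1 ^ 2 ≤ α * V := q _ (by rw [hV]; linarith only [s1, s2, s3, s4, s5, s6, hP])
  have qS' : S ^ 2 ≤ V := by rw [hV]; linarith only [s1, s2, s3, s4, s5, s6, hP]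
  have qN' : N ^ 2 ≤ V := by rw [hV]; linarith only [s1, s2, s3, s4, s5, s6, hP]
  have qb' : b ^ 2 ≤ 1 / μ₀ ^ 2 * V := by
    have := down b V hBV
    rwa [one_div, ← div_eq_inv_mul]
  have qb : b ^ 2 ≤ α * V := up _ _ qb' (by rw [hα]; linarith only [p1, p2, p3, p4])
  have qm : m ^ 2 ≤ α * V := by
    have := down m _ (hm.trans hPV)
    exact up _ (k₂ / μ₀ ^ 2) (by rw [div_mul_eq_mul_div]; exact this)
      (by rw [hα]; linarith only [p1, p2, p3, p4])
  have qβ : (h * (μ * b) + μ * m) ^ 2 ≤ α * V := by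
    apply up _ (2 * k₂ ^ 2 + 2 * k₂) _ (by rw [hα]; linarith only [p1, p2, p3, p4])
    have h1 : h ^ 2 * (μ * b) ^ 2 ≤ k₂ ^ 2 * V :=
      mul_le_mul (pow_le_pow_left₀ hh0 hhk 2) hBV (sq_nonneg _) (sq_nonneg _)
    linarith only [h1, hm, hPV, sq_nonneg (h * (μ * b) - μ * m)]
  have qa : a ^ 2 ≤ α * V := by
    have h1 := sq_mul_le_strains hμ0 hl (hl4.trans hμ) hS hN
    have h2 : (μ * a) ^ 2 ≤ (5 * (1 + 1 / μ₀ ^ 2) + 1) * V := by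
      linarith only [h1, qS', qN', qb', s5, hV0]
    have := down a _ h2
    exact up _ ((5 * (1 + 1 / μ₀ ^ 2) + 1) / μ₀ ^ 2)
      (by rw [div_mul_eq_mul_div]; exact this) (by rw [hα]; linarith only [p1, p2, p3, p4])
  have prod : ∀ k x y : ℝ, x ^ 2 ≤ α * V → y ^ 2 ≤ α * V → |k * (x * y)| ≤ |k| * (α * V) := by
    intro k x y hx hy
    rw [abs_mul]
    apply mul_le_mul_of_nonneg_left _ (abs_nonneg _)
    rw [abs_le]
    constructor <;> linarith only [hx, hy, sq_nonneg (x + y), sq_nonneg (x - y)]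
  have e : M₁ * (-(ρ₂ * b1 * m)) + M₂ * (ρ₂ * b1 * S - ρ₁ / k₁ * a1 * (h * (μ * b) + μ * m))
        + M₃ * (ρ₂ * b * b1) + (1 / l) * (ρ₁ * (a1 * N - c1 * S)) + 2 * (-(ρ₁ * a * a1))
      = M₂ * ρ₂ * (b1 * S) + M₃ * ρ₂ * (b * b1) + (1 / l * ρ₁) * (a1 * N)
        - M₁ * ρ₂ * (b1 * m) - M₂ * (ρ₁ / k₁) * (a1 * (h * (μ * b) + μ * m))
        - (1 / l * ρ₁) * (c1 * S) - 2 * ρ₁ * (a * a1) := by ring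
  rw [e]
  have r1 := abs_le.1 (prod (M₂ * ρ₂) _ _ qb1 (q S qS'))
  have r2 := abs_le.1 (prod (M₃ * ρ₂) _ _ qb qb1)
  have r3 := abs_le.1 (prod (1 / l * ρ₁) _ _ qa1 (q N qN'))
  have r4 := abs_le.1 (prod (M₁ * ρ₂) _ _ qb1 qm)
  have r5 := abs_le.1 (prod (M₂ * (ρ₁ / k₁)) _ _ qa1 qβ)
  have r6 := abs_le.1 (prod (1 / l * ρ₁) _ _ qc1 (q S qS'))
  have r7 := abs_le.1 (prod (2 * ρ₁) _ _ qa qa1)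
  rw [← hV, abs_le]
  constructor <;> linarith only [r1.1, r1.2, r2.1, r2.2, r3.1, r3.2, r4.1, r4.2, r5.1, r5.2, r6.1,
    r6.2, r7.1, r7.2]

end Bresse

/-! ### The Lyapunov functional of a single mode -/

namespace Bresse

open MeasureTheory Set Filter Topology

theorem variation_nonneg {k₂ : ℝ} {g : ℝ → ℝ} (hg : HypA1 k₂ g) (f : ℝ → ℝ) {t : ℝ} (ht : 0 ≤ t) :
    0 ≤ variation g f t :=
  intervalIntegral.integral_nonneg ht fun s hs => mul_nonneg (hg.nonneg s hs.1) (sq_nonneg _)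

theorem variation_kernelDeriv_nonpos {k₂ : ℝ} {g : ℝ → ℝ} (hg : HypA1 k₂ g) (f : ℝ → ℝ) {t : ℝ}
    (ht : 0 ≤ t) :
    variation (kernelDeriv g) f t ≤ 0 := by
  have : 0 ≤ ∫ s in (0 : ℝ)..t, -(kernelDeriv g s * (f t - f (t - s)) ^ 2) :=
    intervalIntegral.integral_nonneg ht fun s _ => by
      have := mul_nonneg (neg_nonneg.2 (hg.kernelDeriv_nonpos s)) (sq_nonneg (f t - f (t - s)))
      linarith
  rw [intervalIntegral.integral_neg] at this
  rw [variation]; linarith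

/-- A Fourier mode of frequency `μ` of the Bresse system with `k₃ = k₁`: the coefficients
`a`, `b`, `c` of `φ`, `ψ`, `w` against `sin (μ x)`, `cos (μ x)`, `cos (μ x)`, their velocities
`a'`, `b'`, `c'`, and the system of integro-differential equations that they solve on `[0,∞)`. -/
structure Mode (k₁ k₂ ρ₁ ρ₂ l μ : ℝ) (g : ℝ → ℝ) where
  a : ℝ → ℝ
  b : ℝ → ℝ
  c : ℝ → ℝ
  a' : ℝ → ℝ
  b' : ℝ → ℝ
  c' : ℝ → ℝ
  deriv_a : ∀ t, 0 ≤ t → HasDerivWithinAt a (a' t) (Ici 0) t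
  deriv_b : IsC1 b b'
  deriv_c : ∀ t, 0 ≤ t → HasDerivWithinAt c (c' t) (Ici 0) t
  eq_a : ∀ t, 0 ≤ t → HasDerivWithinAt (fun s => ρ₁ * a' s)
    (-(k₁ * μ * (μ * a t + b t + l * c t)) - l * k₁ * (μ * c t + l * a t)) (Ici 0) t
  eq_b : ∀ t, 0 ≤ t → HasDerivWithinAt (fun s => ρ₂ * b' s)
    (-(k₂ * μ ^ 2 * b t) - k₁ * (μ * a t + b t + l * c t)
      + μ ^ 2 * ∫ s in (0 : ℝ)..t, g s * b (t - s)) (Ici 0) t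
  eq_c : ∀ t, 0 ≤ t → HasDerivWithinAt (fun s => ρ₁ * c' s)
    (-(k₁ * μ * (μ * c t + l * a t)) - l * k₁ * (μ * a t + b t + l * c t)) (Ici 0) t

namespace Mode

variable {k₁ k₂ ρ₁ ρ₂ l μ : ℝ} {g : ℝ → ℝ}

/-- The coefficient of `φₓ + ψ + l w` against `cos (μ x)`. -/
def shear (X : Mode k₁ k₂ ρ₁ ρ₂ l μ g) (t : ℝ) : ℝ := μ * X.a t + X.b t + l * X.c t

/-- The coefficient of `-(wₓ - l φ)` against `sin (μ x)`. -/
def axial (X : Mode k₁ k₂ ρ₁ ρ₂ l μ g) (t : ℝ) : ℝ := μ * X.c t + l * X.a t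

/-- The memory part `g ∘ ψₓ` of the energy of a mode. -/
noncomputable def memory (X : Mode k₁ k₂ ρ₁ ρ₂ l μ g) (t : ℝ) : ℝ := μ ^ 2 * variation g X.b t

/-- The energy of a mode. -/
noncomputable def energy (X : Mode k₁ k₂ ρ₁ ρ₂ l μ g) (t : ℝ) : ℝ :=
  (1 / 2) * (ρ₁ * X.a' t ^ 2 + ρ₂ * X.b' t ^ 2 + ρ₁ * X.c' t ^ 2
    + (k₂ - ∫ s in (0 : ℝ)..t, g s) * (μ * X.b t) ^ 2 + k₁ * X.axial t ^ 2 + k₁ * X.shear t ^ 2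
    + X.memory t)

/-- The rate of energy dissipation of a mode. -/
noncomputable def dissipation (X : Mode k₁ k₂ ρ₁ ρ₂ l μ g) (t : ℝ) : ℝ :=
  (1 / 2) * (g t * (μ * X.b t) ^ 2 - μ ^ 2 * variation (kernelDeriv g) X.b t)

theorem hasDeriv_a' (X : Mode k₁ k₂ ρ₁ ρ₂ l μ g) (hρ₁ : 0 < ρ₁) {t : ℝ} (ht : 0 ≤ t) :
    HasDerivWithinAt X.a' ((-(k₁ * μ * X.shear t) - l * k₁ * X.axial t) / ρ₁) (Ici 0) t := by
  refine ((X.eq_a t ht).div_const ρ₁).congr_of_eventuallyEq_of_mem ?_ ht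
  exact Eventually.of_forall fun x => by field_simp

theorem hasDeriv_b' (X : Mode k₁ k₂ ρ₁ ρ₂ l μ g) (hg : HypA1 k₂ g) (hρ₂ : 0 < ρ₂) {t : ℝ}
    (ht : 0 ≤ t) :
    HasDerivWithinAt X.b' ((-((k₂ - ∫ s in (0 : ℝ)..t, g s) * μ ^ 2 * X.b t)
      - μ ^ 2 * defect g X.b t - k₁ * X.shear t) / ρ₂) (Ici 0) t := by
  refine (((X.eq_b t ht).div_const ρ₂).congr_of_eventuallyEq_of_mem ?_ ht).congr_deriv ?_
  · exact Eventually.of_forall fun x => by field_simp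
  · rw [hg.defect_eq X.deriv_b.continuousOn ht, shear]
    congr 1; ring

theorem hasDeriv_c' (X : Mode k₁ k₂ ρ₁ ρ₂ l μ g) (hρ₁ : 0 < ρ₁) {t : ℝ} (ht : 0 ≤ t) :
    HasDerivWithinAt X.c' ((-(k₁ * μ * X.axial t) - l * k₁ * X.shear t) / ρ₁) (Ici 0) t := by
  refine ((X.eq_c t ht).div_const ρ₁).congr_of_eventuallyEq_of_mem ?_ ht
  exact Eventually.of_forall fun x => by field_simp

theorem hasDeriv_shear (X : Mode k₁ k₂ ρ₁ ρ₂ l μ g) {t : ℝ} (ht : 0 ≤ t) :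
    HasDerivWithinAt X.shear (μ * X.a' t + X.b' t + l * X.c' t) (Ici 0) t :=
  (((X.deriv_a t ht).const_mul μ).add (X.deriv_b.hasDeriv t ht)).add
    ((X.deriv_c t ht).const_mul l)

theorem hasDeriv_axial (X : Mode k₁ k₂ ρ₁ ρ₂ l μ g) {t : ℝ} (ht : 0 ≤ t) :
    HasDerivWithinAt X.axial (μ * X.c' t + l * X.a' t) (Ici 0) t :=
  ((X.deriv_c t ht).const_mul μ).add ((X.deriv_a t ht).const_mul l)

theorem hasDeriv_energy (X : Mode k₁ k₂ ρ₁ ρ₂ l μ g) (hg : HypA1 k₂ g) (hρ₁ : 0 < ρ₁)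
    (hρ₂ : 0 < ρ₂) {t : ℝ} (ht : 0 ≤ t) :
    HasDerivWithinAt X.energy (-X.dissipation t) (Ici 0) t := by
  have hG := (hg.hasDerivWithinAt_integral ht).const_sub k₂
  have hB := (((X.deriv_b.hasDeriv t ht).const_mul μ).fun_pow 2)
  have hV := (hg.hasDerivWithinAt_variation X.deriv_b ht).const_mul (μ ^ 2)
  have h := ((((((((X.hasDeriv_a' hρ₁ ht).fun_pow 2).const_mul ρ₁).fun_add
    (((X.hasDeriv_b' hg hρ₂ ht).fun_pow 2).const_mul ρ₂)).fun_add
    (((X.hasDeriv_c' hρ₁ ht).fun_pow 2).const_mul ρ₁)).fun_add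
    (hG.fun_mul hB)).fun_add (((X.hasDeriv_axial ht).fun_pow 2).const_mul k₁)).fun_add
    (((X.hasDeriv_shear ht).fun_pow 2).const_mul k₁)).fun_add hV
  refine (h.const_mul (1 / 2)).congr_deriv ?_
  simp only [dissipation, Nat.cast_ofNat, Nat.add_one_sub_one, pow_one]
  field_simp
  ring

theorem memory_nonneg (X : Mode k₁ k₂ ρ₁ ρ₂ l μ g) (hg : HypA1 k₂ g) {t : ℝ} (ht : 0 ≤ t) :
    0 ≤ X.memory t := mul_nonneg (sq_nonneg _) (variation_nonneg hg _ ht)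

theorem dissipation_nonneg (X : Mode k₁ k₂ ρ₁ ρ₂ l μ g) (hg : HypA1 k₂ g) {t : ℝ} (ht : 0 ≤ t) :
    0 ≤ X.dissipation t := by
  have h1 := mul_nonneg (hg.nonneg t ht) (sq_nonneg (μ * X.b t))
  have h2 := mul_nonneg (sq_nonneg μ)
    (neg_nonneg.2 (variation_kernelDeriv_nonpos hg X.b ht))
  rw [dissipation]; linarith

theorem continuousOn_energy (X : Mode k₁ k₂ ρ₁ ρ₂ l μ g) (hg : HypA1 k₂ g) (hρ₁ : 0 < ρ₁)
    (hρ₂ : 0 < ρ₂) : ContinuousOn X.energy (Ici 0) :=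
  fun _ ht => (X.hasDeriv_energy hg hρ₁ hρ₂ ht).continuousWithinAt

theorem antitoneOn_energy (X : Mode k₁ k₂ ρ₁ ρ₂ l μ g) (hg : HypA1 k₂ g) (hρ₁ : 0 < ρ₁)
    (hρ₂ : 0 < ρ₂) : AntitoneOn X.energy (Ici 0) := by
  apply antitoneOn_of_hasDerivWithinAt_nonpos (convex_Ici 0) (X.continuousOn_energy hg hρ₁ hρ₂)
    (f' := fun t => -X.dissipation t)
  · intro t ht
    rw [interior_Ici] at ht ⊢
    exact (X.hasDeriv_energy hg hρ₁ hρ₂ (le_of_lt ht)).mono Ioi_subset_Ici_self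
  · intro t ht
    rw [interior_Ici] at ht
    exact neg_nonpos.2 (X.dissipation_nonneg hg (le_of_lt ht))

/-- The energy controls the velocities, the strains and the memory term. -/
theorem squares_le_energy (X : Mode k₁ k₂ ρ₁ ρ₂ l μ g) (hg : HypA1 k₂ g) (hk₁ : 0 < k₁)
    (hρ₁ : 0 < ρ₁) (hρ₂ : 0 < ρ₂) {t : ℝ} (ht : 0 ≤ t) :
    X.a' t ^ 2 + X.b' t ^ 2 + X.c' t ^ 2 + X.shear t ^ 2 + X.axial t ^ 2 + (μ * X.b t) ^ 2
      + X.memory t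
    ≤ 2 * (1 / ρ₁ + 1 / ρ₂ + 1 / k₁ + 1 / (k₂ - ∫ s in Ioi (0 : ℝ), g s) + 1) * X.energy t := by
  have hh := hg.integral_lt
  have hle := hg.integral_le ht
  have hP := X.memory_nonneg hg ht
  obtain ⟨h₁, hh₁⟩ : ∃ x, x = k₂ - ∫ s in Ioi (0 : ℝ), g s := ⟨_, rfl⟩
  rw [← hh₁] at hh ⊢
  have hB : h₁ * (μ * X.b t) ^ 2 ≤ (k₂ - ∫ s in (0 : ℝ)..t, g s) * (μ * X.b t) ^ 2 :=
    mul_le_mul_of_nonneg_right (by linarith) (sq_nonneg _)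
  obtain ⟨T, hT⟩ : ∃ x, x = 2 * X.energy t := ⟨_, rfl⟩
  have hT' := hT
  rw [energy] at hT'
  have n1 := mul_nonneg hρ₁.le (sq_nonneg (X.a' t))
  have n2 := mul_nonneg hρ₂.le (sq_nonneg (X.b' t))
  have n3 := mul_nonneg hρ₁.le (sq_nonneg (X.c' t))
  have n4 := mul_nonneg hk₁.le (sq_nonneg (X.shear t))
  have n5 := mul_nonneg hk₁.le (sq_nonneg (X.axial t))
  have n6 := mul_nonneg hh.le (sq_nonneg (μ * X.b t))
  have div : ∀ {k : ℝ}, 0 < k → ∀ {x : ℝ}, k * x ≤ T → x ≤ 1 / k * T := by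
    intro k hk x hx
    rw [one_div, inv_mul_eq_div, le_div_iff₀ hk]
    linarith
  have d1 : X.a' t ^ 2 + X.c' t ^ 2 ≤ 1 / ρ₁ * T := div hρ₁ (by linarith)
  have d2 : X.b' t ^ 2 ≤ 1 / ρ₂ * T := div hρ₂ (by linarith)
  have d3 : X.shear t ^ 2 + X.axial t ^ 2 ≤ 1 / k₁ * T := div hk₁ (by linarith)
  have d4 : (μ * X.b t) ^ 2 ≤ 1 / h₁ * T := div hh (by linarith)
  have d5 : X.memory t ≤ T := by linarith
  have e : 2 * (1 / ρ₁ + 1 / ρ₂ + 1 / k₁ + 1 / h₁ + 1) * X.energy t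
      = 1 / ρ₁ * T + 1 / ρ₂ * T + 1 / k₁ * T + 1 / h₁ * T + T := by rw [hT]; ring
  rw [e]
  linarith

theorem energy_nonneg (X : Mode k₁ k₂ ρ₁ ρ₂ l μ g) (hg : HypA1 k₂ g) (hk₁ : 0 < k₁)
    (hρ₁ : 0 < ρ₁) (hρ₂ : 0 < ρ₂) {t : ℝ} (ht : 0 ≤ t) : 0 ≤ X.energy t := by
  have h := X.squares_le_energy hg hk₁ hρ₁ hρ₂ ht
  have hP := X.memory_nonneg hg ht
  have hh := hg.integral_lt
  have h0 : 0 ≤ X.a' t ^ 2 + X.b' t ^ 2 + X.c' t ^ 2 + X.shear t ^ 2 + X.axial t ^ 2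
    + (μ * X.b t) ^ 2 + X.memory t := by positivity
  exact nonneg_of_mul_nonneg_right (h0.trans h) (by positivity)

/-- The combination of multipliers used in the Lyapunov functional. The second summand exploits
the equality of the wave speeds, the fourth one the equality `k₁ = k₃`. -/
noncomputable def multiplier (X : Mode k₁ k₂ ρ₁ ρ₂ l μ g) (M₁ M₂ M₃ t : ℝ) : ℝ :=
  M₁ * (-(ρ₂ * X.b' t * defect g X.b t))
    + M₂ * (ρ₂ * X.b' t * X.shear t - ρ₁ / k₁ * X.a' t
      * ((k₂ - ∫ s in (0 : ℝ)..t, g s) * (μ * X.b t) + μ * defect g X.b t))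
    + M₃ * (ρ₂ * X.b t * X.b' t) + (1 / l) * (ρ₁ * (X.a' t * X.axial t - X.c' t * X.shear t))
    + 2 * (-(ρ₁ * X.a t * X.a' t))

theorem hasDeriv_multiplier (X : Mode k₁ k₂ ρ₁ ρ₂ l μ g) (hg : HypA1 k₂ g) (hk₁ : 0 < k₁)
    (hρ₁ : 0 < ρ₁) (hρ₂ : 0 < ρ₂) (hl : 0 < l) (hspeed : k₁ / ρ₁ = k₂ / ρ₂) (M₁ M₂ M₃ : ℝ) {t : ℝ}
    (ht : 0 ≤ t) :
    HasDerivWithinAt (X.multiplier M₁ M₂ M₃)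
      (M₁ * (-(ρ₂ * (∫ s in (0 : ℝ)..t, g s) * X.b' t ^ 2)
            - ρ₂ * X.b' t * defect (kernelDeriv g) X.b t
            + (k₂ - ∫ s in (0 : ℝ)..t, g s) * (μ * defect g X.b t) * (μ * X.b t)
            + (μ * defect g X.b t) ^ 2 + k₁ * defect g X.b t * X.shear t)
          + M₂ * (-(k₁ * X.shear t ^ 2) + ρ₂ * X.b' t ^ 2 + ρ₂ * l * X.b' t * X.c' t
            + l * X.axial t * ((k₂ - ∫ s in (0 : ℝ)..t, g s) * (μ * X.b t) + μ * defect g X.b t)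
            + ρ₁ / k₁ * X.a' t * (g t * (μ * X.b t) - μ * defect (kernelDeriv g) X.b t))
          + M₃ * (ρ₂ * X.b' t ^ 2 - (k₂ - ∫ s in (0 : ℝ)..t, g s) * (μ * X.b t) ^ 2
            - (μ * defect g X.b t) * (μ * X.b t) - k₁ * X.shear t * X.b t)
          + (1 / l) * (-(l * k₁ * X.axial t ^ 2) + l * k₁ * X.shear t ^ 2
            + ρ₁ * l * X.a' t ^ 2 - ρ₁ * l * X.c' t ^ 2 - ρ₁ * X.c' t * X.b' t)
          + 2 * (-(ρ₁ * X.a' t ^ 2) + k₁ * μ * X.a t * X.shear t + l * k₁ * X.a t * X.axial t))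
      (Ici 0) t := by
  have hG := (hg.hasDerivWithinAt_integral ht).const_sub k₂
  have ha := X.deriv_a t ht
  have hb := X.deriv_b.hasDeriv t ht
  have ha' := X.hasDeriv_a' hρ₁ ht
  have hb' := X.hasDeriv_b' hg hρ₂ ht
  have hc' := X.hasDeriv_c' hρ₁ ht
  have hS := X.hasDeriv_shear ht
  have hN := X.hasDeriv_axial ht
  have hm := hg.hasDerivWithinAt_defect X.deriv_b ht
  have h1 := ((hb'.const_mul ρ₂).fun_mul hm).fun_neg.const_mul M₁
  have h2 := (((hb'.const_mul ρ₂).fun_mul hS).fun_sub ((ha'.const_mul (ρ₁ / k₁)).fun_mul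
    ((hG.fun_mul (hb.const_mul μ)).fun_add (hm.const_mul μ)))).const_mul M₂
  have h3 := ((hb.const_mul ρ₂).fun_mul hb').const_mul M₃
  have h4 := (((ha'.fun_mul hN).fun_sub (hc'.fun_mul hS)).const_mul ρ₁).const_mul (1 / l)
  have h5 := (((ha.const_mul ρ₁).fun_mul ha').fun_neg).const_mul 2
  refine ((((h1.fun_add h2).fun_add h3).fun_add h4).fun_add h5).congr_deriv ?_
  have hk₂ : k₂ = k₁ * ρ₂ / ρ₁ := by
    rw [div_eq_div_iff hρ₁.ne' hρ₂.ne'] at hspeed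
    field_simp; linarith
  congr 1
  · congr 1
    · congr 1
      · congr 1
        · field_simp; ring
        · congr 1
          generalize (∫ s in (0 : ℝ)..t, g s) = G
          subst hk₂
          field_simp; ring
      · field_simp; ring
    · field_simp; ring
  · field_simp; ring

end Mode

/-- For `t ≥ t₀`, every mode of frequency at least `μ₀` has a functional `ℓ`, equivalent to its
energy, whose derivative is at most `-κ E + C (g ∘ ψₓ)`. -/
def HasLyapunov (k₁ k₂ ρ₁ ρ₂ l μ₀ t₀ κ c C : ℝ) (g : ℝ → ℝ) : Prop :=
  ∀ (μ : ℝ) (X : Mode k₁ k₂ ρ₁ ρ₂ l μ g), μ₀ ≤ μ →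
    ∃ ℓ : ℝ → ℝ, ∀ t, t₀ ≤ t → X.energy t ≤ ℓ t ∧ ℓ t ≤ c * X.energy t ∧
      ∃ d, HasDerivWithinAt ℓ d (Ici 0) t ∧ d ≤ -κ * X.energy t + C * X.memory t

/-- The Lyapunov functional of a mode, with constants that do not depend on the frequency. -/
theorem exists_lyapunov {k₁ k₂ ρ₁ ρ₂ μ₀ : ℝ} {g : ℝ → ℝ} (hg : HypA1 k₂ g) (hk₁ : 0 < k₁)
    (hk₂ : 0 < k₂) (hρ₁ : 0 < ρ₁) (hρ₂ : 0 < ρ₂) (hμ₀ : 0 < μ₀) (hspeed : k₁ / ρ₁ = k₂ / ρ₂) :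
    ∃ l₀ : ℝ, 0 < l₀ ∧ ∀ l : ℝ, 0 < l → l < l₀ → ∀ t₀ : ℝ, 0 < t₀ →
      ∃ κ c C : ℝ, 0 < κ ∧ 0 < c ∧ 0 < C ∧ HasLyapunov k₁ k₂ ρ₁ ρ₂ l μ₀ t₀ κ c C g := by
  have hh₁ := hg.integral_lt
  obtain ⟨l₀, hl₀, hl₀μ, M₂, M₃, H⟩ := exists_weights hk₁ hk₂ hρ₁ hρ₂ hh₁ hμ₀ hg.pos_zero
  refine ⟨l₀, hl₀, fun l hl hll t₀ ht₀ => ?_⟩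
  obtain ⟨M₁, C, hC, H⟩ := H l hl hll _ (hg.integral_pos ht₀)
  obtain ⟨C', hC', HB⟩ := exists_functional_bound (k₁ := k₁) (ρ₂ := ρ₂) (M₁ := M₁) (M₂ := M₂)
    (M₃ := M₃) hk₂ hρ₁ hμ₀ hh₁ hl (by linarith)
  obtain ⟨D, hD⟩ : ∃ x, x = C' * (2 * (1 / ρ₁ + 1 / ρ₂ + 1 / k₁
    + 1 / (k₂ - ∫ s in Ioi (0 : ℝ), g s) + 1)) := ⟨_, rfl⟩
  have hD0 : 0 ≤ D := by rw [hD]; positivity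
  have hκ : 0 < 1 / (2 + k₁ + k₂ + ρ₂) := by positivity
  refine ⟨1 / (2 + k₁ + k₂ + ρ₂), (C + D + 1) + D, C + 1, hκ, by positivity, by positivity,
    fun μ X hμ => ?_⟩
  -- the multiple `C` of the energy absorbs the dissipation on the right of the combined estimate,
  -- and `D + 1` makes the functional at least as large as the energy
  refine ⟨fun t => (C + D + 1) * X.energy t + X.multiplier M₁ M₂ M₃ t,
    fun t htt => ?_⟩
  have ht : 0 ≤ t := ht₀.le.trans htt
  have hE := X.energy_nonneg hg hk₁ hρ₁ hρ₂ ht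
  have hP := X.memory_nonneg hg ht
  have hΔ := X.dissipation_nonneg hg ht
  have hG1 := hg.integral_mono ht₀.le htt
  have hG2 := hg.integral_le ht
  have hG3 := hg.integral_nonneg ht
  have hgt := hg.nonneg t ht
  have hgt0 := hg.antitone (mem_Ici.2 le_rfl) ht ht
  have hm : (μ * defect g X.b t) ^ 2 ≤ k₂ * X.memory t := by
    have h1 := defect_sq_le ht (hg.intervalIntegrable le_rfl ht) X.deriv_b.continuousOn
      (fun s hs => hg.nonneg s hs.1)
    have h2 := variation_nonneg hg X.b ht
    have h3 : (∫ s in (0 : ℝ)..t, g s) * variation g X.b t ≤ k₂ * variation g X.b t :=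
      mul_le_mul_of_nonneg_right (by linarith) h2
    rw [mul_pow, Mode.memory, mul_left_comm]
    exact mul_le_mul_of_nonneg_left (h1.trans h3) (sq_nonneg _)
  have hV := variation_kernelDeriv_nonpos hg X.b ht
  have hgB : g t * (μ * X.b t) ^ 2 ≤ 2 * X.dissipation t := by
    have := mul_nonneg (sq_nonneg μ) (neg_nonneg.2 hV)
    rw [Mode.dissipation]; linarith
  have hR : (μ * defect (kernelDeriv g) X.b t) ^ 2 ≤ 2 * g 0 * X.dissipation t := by
    have h1 := defect_sq_le (k := fun s => -kernelDeriv g s) ht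
      (hg.intervalIntegrable_kernelDeriv ht).neg X.deriv_b.continuousOn
      (fun s _ => neg_nonneg.2 (hg.kernelDeriv_nonpos s))
    have e1 : defect (fun s => -kernelDeriv g s) X.b t = -defect (kernelDeriv g) X.b t := by
      simp only [defect, neg_mul, intervalIntegral.integral_neg]
    have e2 : variation (fun s => -kernelDeriv g s) X.b t = -variation (kernelDeriv g) X.b t := by
      simp only [variation, neg_mul, intervalIntegral.integral_neg]
    rw [e1, e2, neg_sq, intervalIntegral.integral_neg, hg.integral_kernelDeriv ht] at h1
    have h2 : -(g t - g 0) * -variation (kernelDeriv g) X.b t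
        ≤ g 0 * -variation (kernelDeriv g) X.b t :=
      mul_le_mul_of_nonneg_right (by linarith) (neg_nonneg.2 hV)
    have h3 := mul_le_mul_of_nonneg_left (h1.trans h2) (sq_nonneg μ)
    have h4 := mul_nonneg hg.pos_zero.le (mul_nonneg hgt (sq_nonneg (μ * X.b t)))
    rw [mul_pow, Mode.dissipation]
    linarith
  have hbd := HB μ (k₂ - ∫ s in (0 : ℝ)..t, g s) (X.a t) (X.b t) (X.c t) (X.a' t) (X.b' t)
    (X.c' t) (X.shear t) (X.axial t) (defect g X.b t) (X.memory t) hμ (by linarith) (by linarith)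
    hP rfl rfl hm
  have hsq := mul_le_mul_of_nonneg_left (X.squares_le_energy hg hk₁ hρ₁ hρ₂ ht) hC'
  rw [← mul_assoc, ← hD] at hsq
  have hmul : |X.multiplier M₁ M₂ M₃ t| ≤ D * X.energy t := hbd.trans hsq
  have hmul' := abs_le.1 hmul
  have hCE := mul_nonneg hC hE
  refine ⟨by linarith only [hmul'.1, hCE], by linarith only [hmul'.2], _,
    ((X.hasDeriv_energy hg hρ₁ hρ₂ ht).const_mul _).fun_add
    (X.hasDeriv_multiplier hg hk₁ hρ₁ hρ₂ hl hspeed M₁ M₂ M₃ ht), ?_⟩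
  have key := H μ (k₂ - ∫ s in (0 : ℝ)..t, g s) (∫ s in (0 : ℝ)..t, g s) (g t) (X.a t) (X.b t)
    (X.c t) (X.a' t) (X.b' t) (X.c' t) (X.shear t) (X.axial t) (defect g X.b t)
    (defect (kernelDeriv g) X.b t) (X.memory t) (X.dissipation t) hμ (by linarith) (by linarith)
    hG1 hgt hgt0 hP hΔ rfl rfl hm hR hgB
  have hlow : 1 / (2 + k₁ + k₂ + ρ₂) * X.energy t
      ≤ 1 / 2 * (μ * X.b t) ^ 2 + 1 / 2 * X.shear t ^ 2 + 3 * k₁ / 8 * X.axial t ^ 2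
        + ρ₁ / 2 * X.c' t ^ 2 + ρ₁ / 2 * X.a' t ^ 2 + X.b' t ^ 2 + X.memory t := by
    rw [one_div, inv_mul_eq_div, div_le_iff₀ (by positivity), Mode.energy]
    have n1 := mul_nonneg hρ₁.le (sq_nonneg (X.a' t))
    have n3 := mul_nonneg hρ₁.le (sq_nonneg (X.c' t))
    have n4 := mul_nonneg hk₁.le (sq_nonneg (X.axial t))
    have n5 := mul_nonneg hG3 (sq_nonneg (μ * X.b t))
    obtain ⟨T, hT⟩ : ∃ x, x = 1 / 2 * (μ * X.b t) ^ 2 + 1 / 2 * X.shear t ^ 2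
        + 3 * k₁ / 8 * X.axial t ^ 2
        + ρ₁ / 2 * X.c' t ^ 2 + ρ₁ / 2 * X.a' t ^ 2 + X.b' t ^ 2 + X.memory t := ⟨_, rfl⟩
    have t1 : (μ * X.b t) ^ 2 / 2 ≤ T := by
      rw [hT]; linarith [sq_nonneg (X.shear t), sq_nonneg (X.b' t)]
    have t2 : X.shear t ^ 2 / 2 ≤ T := by
      rw [hT]; linarith [sq_nonneg (μ * X.b t), sq_nonneg (X.b' t)]
    have t3 : X.b' t ^ 2 ≤ T := by
      rw [hT]; linarith [sq_nonneg (X.shear t), sq_nonneg (μ * X.b t)]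
    have u1 := mul_le_mul_of_nonneg_left t1 hk₂.le
    have u2 := mul_le_mul_of_nonneg_left t2 hk₁.le
    have u3 := mul_le_mul_of_nonneg_left t3 hρ₂.le
    have u4 := mul_nonneg hρ₂.le (sq_nonneg (X.b' t))
    rw [← hT]
    have : T * (2 + k₁ + k₂ + ρ₂) = 2 * T + k₁ * T + k₂ * T + ρ₂ * T := by ring
    rw [this]
    linarith [sq_nonneg (X.shear t), sq_nonneg (X.b' t), sq_nonneg (μ * X.b t)]
  have hDΔ := mul_nonneg hD0 hΔ
  linarith only [key, hlow, hDΔ, hΔ]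

end Bresse

/-! ### Differential inequalities -/

namespace Bresse

open MeasureTheory Set Filter Topology

/-- A continuous function whose right derivatives are nonpositive does not increase. -/
theorem le_of_right_deriv_nonpos {f : ℝ → ℝ} {a b : ℝ} (hab : a ≤ b)
    (hf : ContinuousOn f (Icc a b))
    (h : ∀ x ∈ Ico a b, ∃ d, HasDerivWithinAt f d (Ici x) x ∧ d ≤ 0) : f b ≤ f a := by
  choose! f' hf' hf'0 using h
  exact image_le_of_deriv_right_le_deriv_boundary (B := fun _ => f a) (B' := fun _ => 0) hf hf'
    le_rfl continuousOn_const (fun x _ => hasDerivWithinAt_const _ _ _) hf'0 ⟨hab, le_rfl⟩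

theorem le_of_deriv_nonpos {f : ℝ → ℝ} {a b : ℝ} (ha : 0 ≤ a) (hab : a ≤ b)
    (h : ∀ x ∈ Icc a b, ∃ d, HasDerivWithinAt f d (Ici 0) x ∧ d ≤ 0) : f b ≤ f a := by
  apply le_of_right_deriv_nonpos hab
  · intro x hx
    obtain ⟨d, hd, -⟩ := h x hx
    exact hd.continuousWithinAt.mono fun y hy => ha.trans hy.1
  · intro x hx
    obtain ⟨d, hd, hd0⟩ := h x ⟨hx.1, hx.2.le⟩
    exact ⟨d, hd.mono fun y hy => (ha.trans hx.1).trans hy, hd0⟩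

/-- The weight `ξ`: positive, non-increasing and differentiable on `[0,∞)`. -/
structure IsWeight (ξ : ℝ → ℝ) : Prop where
  pos : ∀ t, 0 ≤ t → 0 < ξ t
  antitone : AntitoneOn ξ (Ici 0)
  differentiable : DifferentiableOn ℝ ξ (Ici 0)

theorem IsWeight.continuousOn_rpow {ξ : ℝ → ℝ} (hξ : IsWeight ξ) (r : ℝ) :
    ContinuousOn (fun t => ξ t ^ r) (Ici 0) :=
  hξ.differentiable.continuousOn.rpow_const fun t ht => Or.inl (hξ.pos t ht).ne'

/-- The setting of the decay lemmas on `[t₀, T]`: a normalised energy `E` with dissipation rate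
`D`, and an equivalent functional `ℓ` whose derivative is controlled up to a multiple of `D`. -/
structure DecayData (ξ : ℝ → ℝ) (r κ c C t₀ T : ℝ) (E D ℓ : ℝ → ℝ) : Prop where
  deriv_E : ∀ t ∈ Icc t₀ T, HasDerivWithinAt E (-D t) (Ici 0) t
  D_nonneg : ∀ t ∈ Icc t₀ T, 0 ≤ D t
  E_pos : ∀ t ∈ Icc t₀ T, 0 < E t
  E_le : ∀ t ∈ Icc t₀ T, E t ≤ 1
  le_ℓ : ∀ t ∈ Icc t₀ T, E t ≤ ℓ t
  ℓ_le : ∀ t ∈ Icc t₀ T, ℓ t ≤ c * E t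
  deriv_ℓ : ∀ t ∈ Icc t₀ T, ∃ d, HasDerivWithinAt ℓ d (Ici 0) t ∧
    ξ t * d ≤ -κ * (ξ t * E t) + C * (ξ t * E t) ^ (1 - r) * D t

/-- The functional `F = ξ^r E^(r-1) ℓ + C E` is equivalent to `E` and satisfies
`F' ≤ -κ (ξ E)^r`. -/
theorem DecayData.exists_functional {ξ : ℝ → ℝ} {r κ c C t₀ T : ℝ} {E D ℓ : ℝ → ℝ}
    (h : DecayData ξ r κ c C t₀ T E D ℓ) (hξ : IsWeight ξ) (ht₀ : 0 ≤ t₀) (hr : 1 ≤ r) :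
    ∃ F : ℝ → ℝ, ∀ t ∈ Icc t₀ T, C * E t ≤ F t ∧ F t ≤ (ξ t₀ ^ r * c + C) * E t ∧
      ∃ d, HasDerivWithinAt F d (Ici 0) t ∧ d ≤ -κ * (ξ t * E t) ^ r := by
  refine ⟨fun t => ξ t ^ r * E t ^ (r - 1) * ℓ t + C * E t, fun t ht => ?_⟩
  have ht0 : 0 ≤ t := ht₀.trans ht.1
  have hE := h.E_pos t ht
  have hx := hξ.pos t ht0
  have hℓ : 0 < ℓ t := hE.trans_le (h.le_ℓ t ht)
  have hD := h.D_nonneg t ht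
  refine ⟨?_, ?_, ?_⟩
  · have : 0 ≤ ξ t ^ r * E t ^ (r - 1) * ℓ t := by positivity
    linarith
  · have h1 : ξ t ^ r ≤ ξ t₀ ^ r :=
      Real.rpow_le_rpow hx.le (hξ.antitone (mem_Ici.2 ht₀) (mem_Ici.2 ht0) ht.1) (by linarith)
    have h2 : E t ^ (r - 1) ≤ 1 := Real.rpow_le_one hE.le (h.E_le t ht) (by linarith)
    have h3 : ξ t ^ r * E t ^ (r - 1) ≤ ξ t₀ ^ r * 1 :=
      mul_le_mul h1 h2 (by positivity) (Real.rpow_nonneg (hξ.pos t₀ ht₀).le _)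
    have h4 := mul_le_mul h3 (h.ℓ_le t ht) hℓ.le
      (mul_nonneg (Real.rpow_nonneg (hξ.pos t₀ ht₀).le _) zero_le_one)
    linarith
  obtain ⟨d, hd, hdle⟩ := h.deriv_ℓ t ht
  have hξ' : HasDerivWithinAt ξ (derivWithin ξ (Ici 0) t) (Ici 0) t :=
    (hξ.differentiable t ht0).hasDerivWithinAt
  have hξ'0 : derivWithin ξ (Ici 0) t ≤ 0 := hξ.antitone.derivWithin_nonpos
  have d1 := hξ'.rpow_const (p := r) (Or.inl hx.ne')
  have d2 := (h.deriv_E t ht).rpow_const (p := r - 1) (Or.inl hE.ne')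
  refine ⟨_, ((d1.fun_mul d2).fun_mul hd).fun_add ((h.deriv_E t ht).const_mul C), ?_⟩
  have hxE : 0 < ξ t * E t := mul_pos hx hE
  have k1 : 0 ≤ -derivWithin ξ (Ici 0) t * r * ξ t ^ (r - 1) * E t ^ (r - 1) * ℓ t := by
    have := neg_nonneg.2 hξ'0
    positivity
  have k2 : 0 ≤ ξ t ^ r * (D t * (r - 1) * E t ^ (r - 1 - 1)) * ℓ t := by
    have : 0 ≤ r - 1 := by linarith
    positivity
  have k3 : ξ t ^ r * E t ^ (r - 1) * d = (ξ t * E t) ^ (r - 1) * (ξ t * d) := by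
    rw [Real.mul_rpow hx.le hE.le, Real.rpow_sub_one hx.ne' r]
    field_simp
  have k4 := mul_le_mul_of_nonneg_left hdle (Real.rpow_nonneg hxE.le (r - 1))
  have k5 : (ξ t * E t) ^ (r - 1) * (-κ * (ξ t * E t) + C * (ξ t * E t) ^ (1 - r) * D t)
      = -κ * (ξ t * E t) ^ r + C * D t := by
    have e1 : (ξ t * E t) ^ (r - 1) * (ξ t * E t) = (ξ t * E t) ^ r := by
      rw [Real.rpow_sub_one hxE.ne']; field_simp
    have e2 : (ξ t * E t) ^ (r - 1) * (ξ t * E t) ^ (1 - r) = 1 := by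
      rw [← Real.rpow_add hxE]; simp
    linear_combination (-κ) * e1 + C * D t * e2
  rw [k5, ← k3] at k4
  linarith only [k1, k2, k4]

/-- Exponential decay, the case `r = 1`. -/
theorem DecayData.exp_decay {ξ : ℝ → ℝ} {κ c C t₀ T : ℝ} {E D ℓ : ℝ → ℝ}
    (h : DecayData ξ 1 κ c C t₀ T E D ℓ) (hξ : IsWeight ξ) (ht₀ : 0 ≤ t₀) (hT : t₀ ≤ T)
    (hκ : 0 < κ) (hc : 0 < c) (hC : 0 < C) :
    E T ≤ (ξ t₀ * c + C) / C * Real.exp (-(κ / (ξ t₀ * c + C)) * ∫ s in t₀..T, ξ s) := by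
  obtain ⟨F, hF⟩ := h.exists_functional hξ ht₀ le_rfl
  simp only [Real.rpow_one] at hF
  have hξ₀ := hξ.pos t₀ ht₀
  obtain ⟨K, hK⟩ : ∃ x, x = ξ t₀ * c + C := ⟨_, rfl⟩
  have hK0 : 0 < K := by rw [hK]; positivity
  rw [← hK] at hF ⊢
  have mono := le_of_deriv_nonpos (f := fun t => F t * Real.exp (κ / K * ∫ s in t₀..t, ξ s)) ht₀ hT
    (fun t ht => by
      have ht0 : 0 ≤ t := ht₀.trans ht.1
      obtain ⟨h1, h2, d, hd, hdle⟩ := hF t ht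
      refine ⟨_, hd.fun_mul ((hasDerivWithinAt_primitive hξ.differentiable.continuousOn ht₀
        ht0).const_mul (κ / K)).exp, ?_⟩
      have h3 : κ / K * ξ t * F t ≤ κ * (ξ t * E t) := by
        have := mul_le_mul_of_nonneg_left h2
          (mul_nonneg (div_pos hκ hK0).le (hξ.pos t ht0).le)
        calc _ ≤ _ := this
          _ = _ := by field_simp
      have h4 : (d + κ / K * ξ t * F t) * Real.exp (κ / K * ∫ s in t₀..t, ξ s) ≤ 0 :=
        mul_nonpos_of_nonpos_of_nonneg (by linarith) (Real.exp_pos _).le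
      linarith only [h4])
  simp only [intervalIntegral.integral_same, mul_zero, Real.exp_zero, mul_one] at mono
  have hT' := hF T ⟨hT, le_rfl⟩
  have h0' := hF t₀ ⟨le_rfl, hT⟩
  have hE1 := h.E_le t₀ ⟨le_rfl, hT⟩
  have h5 : F t₀ ≤ K := h0'.2.1.trans (by nlinarith)
  have h6 : C * E T * Real.exp (κ / K * ∫ s in t₀..T, ξ s) ≤ K :=
    (mul_le_mul_of_nonneg_right hT'.1 (Real.exp_pos _).le).trans (mono.trans h5)
  rw [neg_mul, Real.exp_neg, ← div_eq_mul_inv, le_div_iff₀ (Real.exp_pos _), le_div_iff₀ hC]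
  linarith

/-- Polynomial decay, the case `r > 1`. -/
theorem exists_poly_decay {ξ : ℝ → ℝ} {r κ c C t₀ : ℝ} (hξ : IsWeight ξ) (ht₀ : 0 ≤ t₀)
    (hr : 1 < r) (hκ : 0 < κ) (hc : 0 < c) (hC : 0 < C) :
    ∃ K : ℝ, 0 < K ∧ ∀ (T : ℝ) (E D ℓ : ℝ → ℝ), t₀ ≤ T → DecayData ξ r κ c C t₀ T E D ℓ →
      E T ≤ K * (1 / (1 + ∫ s in t₀..T, ξ s ^ r)) ^ (1 / (r - 1)) := by
  have hξ₀ := hξ.pos t₀ ht₀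
  obtain ⟨M, hM⟩ : ∃ x, x = ξ t₀ ^ r * c + C := ⟨_, rfl⟩
  have hM0 : 0 < M := by rw [hM]; positivity
  have hr1 : 0 < r - 1 := by linarith
  obtain ⟨q, hq⟩ : ∃ x, x = (r - 1) * (κ * M ^ (-r)) := ⟨_, rfl⟩
  have hq0 : 0 < q := by rw [hq]; positivity
  obtain ⟨m, hm⟩ : ∃ x, x = min (M ^ (1 - r)) q := ⟨_, rfl⟩
  have hm0 : 0 < m := by rw [hm]; positivity
  refine ⟨1 / C * (1 / m) ^ (1 / (r - 1)), by positivity, fun T E D ℓ hT h => ?_⟩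
  obtain ⟨F, hF⟩ := h.exists_functional hξ ht₀ hr.le
  rw [← hM] at hF
  have hFpos : ∀ t ∈ Icc t₀ T, 0 < F t := fun t ht =>
    (mul_pos hC (h.E_pos t ht)).trans_le (hF t ht).1
  have mono := le_of_deriv_nonpos
    (f := fun t => q * (∫ s in t₀..t, ξ s ^ r) - F t ^ (1 - r)) ht₀ hT
    (fun t ht => by
      have ht0 : 0 ≤ t := ht₀.trans ht.1
      obtain ⟨h1, h2, d, hd, hdle⟩ := hF t ht
      have hFt := hFpos t ht
      have hx := hξ.pos t ht0
      have hE := h.E_pos t ht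
      refine ⟨_, ((hasDerivWithinAt_primitive (hξ.continuousOn_rpow r) ht₀ ht0).const_mul q).fun_sub
        (hd.rpow_const (Or.inl hFt.ne')), ?_⟩
      have e1 : (1 - r - 1 : ℝ) = -r := by ring
      rw [e1]
      have h3 : F t ^ r ≤ M ^ r * E t ^ r := by
        rw [← Real.mul_rpow hM0.le hE.le]
        exact Real.rpow_le_rpow hFt.le h2 (by linarith)
      have h4 : M ^ (-r) * ξ t ^ r ≤ F t ^ (-r) * (ξ t * E t) ^ r := by
        rw [Real.mul_rpow hx.le hE.le, Real.rpow_neg hM0.le, Real.rpow_neg hFt.le,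
          inv_mul_eq_div, inv_mul_eq_div, div_le_div_iff₀ (by positivity) (by positivity)]
        have := mul_le_mul_of_nonneg_left h3 (Real.rpow_nonneg hx.le r)
        linarith
      have h5 : d * F t ^ (-r) ≤ -κ * (ξ t * E t) ^ r * F t ^ (-r) :=
        mul_le_mul_of_nonneg_right hdle (Real.rpow_nonneg hFt.le _)
      have h6 := mul_le_mul_of_nonneg_left h4 hκ.le
      have h7 : d * F t ^ (-r) ≤ -(κ * (M ^ (-r) * ξ t ^ r)) := by linarith
      have h8 := mul_le_mul_of_nonneg_left h7 hr1.le
      rw [hq]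
      linarith only [h8])
  simp only [intervalIntegral.integral_same, mul_zero, zero_sub] at mono
  have h0' := hF t₀ ⟨le_rfl, hT⟩
  have hT' := hF T ⟨hT, le_rfl⟩
  have hFT := hFpos T ⟨hT, le_rfl⟩
  have hF0 := hFpos t₀ ⟨le_rfl, hT⟩
  have hFM : F t₀ ≤ M := h0'.2.1.trans (by nlinarith [h.E_le t₀ ⟨le_rfl, hT⟩])
  have h9 : M ^ (1 - r) ≤ F t₀ ^ (1 - r) :=
    Real.rpow_le_rpow_of_nonpos hF0 hFM (by linarith)
  obtain ⟨I, hI⟩ : ∃ x, x = ∫ s in t₀..T, ξ s ^ r := ⟨_, rfl⟩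
  have hI0 : 0 ≤ I := by
    rw [hI]
    exact intervalIntegral.integral_nonneg hT fun s hs =>
      Real.rpow_nonneg (hξ.pos s (ht₀.trans hs.1)).le _
  rw [← hI] at mono ⊢
  have h10 : m * (1 + I) ≤ F T ^ (1 - r) := by
    have a1 : m ≤ M ^ (1 - r) := hm ▸ min_le_left _ _
    have a2 : m ≤ q := hm ▸ min_le_right _ _
    have a3 := mul_le_mul_of_nonneg_right a2 hI0
    linarith
  have h11 : F T ≤ (1 / (m * (1 + I))) ^ (1 / (r - 1)) := by
    have e1 : F T = (1 / F T ^ (1 - r)) ^ (1 / (r - 1)) := by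
      rw [one_div, ← Real.rpow_neg hFT.le, ← Real.rpow_mul hFT.le]
      have : -(1 - r) * (1 / (r - 1)) = 1 := by field_simp; ring
      rw [this, Real.rpow_one]
    rw [e1]
    apply Real.rpow_le_rpow (by positivity) _ (by positivity)
    exact one_div_le_one_div_of_le (by positivity) h10
  have e2 : (1 / (m * (1 + I))) ^ (1 / (r - 1))
      = (1 / m) ^ (1 / (r - 1)) * (1 / (1 + I)) ^ (1 / (r - 1)) := by
    rw [← Real.mul_rpow (by positivity) (by positivity)]
    congr 1; field_simp
  rw [e2] at h11
  have h12 : E T ≤ 1 / C * F T := by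
    rw [one_div, inv_mul_eq_div, le_div_iff₀ hC]; linarith [hT'.1]
  calc E T ≤ 1 / C * F T := h12
    _ ≤ 1 / C * ((1 / m) ^ (1 / (r - 1)) * (1 / (1 + I)) ^ (1 / (r - 1))) :=
      mul_le_mul_of_nonneg_left h11 (by positivity)
    _ = _ := by ring

end Bresse

/-! ### Absorbing the memory term -/

namespace Bresse

open MeasureTheory Set Filter Topology

theorem HypA2.isWeight {g ξ : ℝ → ℝ} {p : ℝ} (h : HypA2 g ξ p) : IsWeight ξ :=
  ⟨h.pos, h.antitone, h.differentiable⟩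

theorem HypA1.continuousOn_rpow {k₂ : ℝ} {g : ℝ → ℝ} (hg : HypA1 k₂ g) {q : ℝ} (hq : 0 ≤ q) :
    ContinuousOn (fun s => g s ^ q) (Ici 0) :=
  hg.continuousOn.rpow_const fun _ _ => Or.inr hq

theorem intervalIntegrable_of_continuousOn {f : ℝ → ℝ} (hf : ContinuousOn f (Ici 0)) {t : ℝ}
    (ht : 0 ≤ t) : IntervalIntegrable f volume 0 t := by
  apply (hf.mono _).intervalIntegrable
  rw [uIcc_of_le ht]
  exact Icc_subset_Ici_self

/-- `ξ √g` is integrable because `p < 3/2`: by `g' ≤ -ξ g^p` it is bounded by the derivative of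
`-g^(3/2-p) / (3/2-p)`. Where `g` vanishes it stays zero, so that right derivatives exist there. -/
theorem integral_mul_sqrt_le {k₂ : ℝ} {g ξ : ℝ → ℝ} {p : ℝ} (hg : HypA1 k₂ g)
    (h : HypA2 g ξ p) {T : ℝ} (hT : 0 ≤ T) :
    ∫ s in (0 : ℝ)..T, ξ s * g s ^ (1 / 2 : ℝ) ≤ 1 / (3 / 2 - p) * g 0 ^ (3 / 2 - p) := by
  obtain ⟨σ, hσ⟩ : ∃ x, x = 3 / 2 - p := ⟨_, rfl⟩
  have hσ0 : 0 < σ := by rw [hσ]; linarith [h.lt]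
  rw [← hσ]
  have hc : ContinuousOn (fun s => ξ s * g s ^ (1 / 2 : ℝ)) (Ici 0) :=
    h.differentiable.continuousOn.mul (hg.continuousOn_rpow (by norm_num))
  have key := le_of_right_deriv_nonpos
    (f := fun t => (∫ s in (0 : ℝ)..t, ξ s * g s ^ (1 / 2 : ℝ)) + 1 / σ * g t ^ σ) hT
    (by
      apply ContinuousOn.add
      · intro t ht
        exact ((hasDerivWithinAt_primitive hc le_rfl ht.1).continuousWithinAt).mono
          Icc_subset_Ici_self
      · exact (continuousOn_const.mul (hg.continuousOn_rpow hσ0.le)).mono Icc_subset_Ici_self)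
    (fun t ht => by
      have h1 := (hasDerivWithinAt_primitive hc le_rfl ht.1).mono (Ici_subset_Ici.2 ht.1)
      rcases (hg.nonneg t ht.1).eq_or_lt with h0 | h0
      · have h2 : HasDerivWithinAt (fun t => 1 / σ * g t ^ σ) 0 (Ici t) t := by
          have hz : ∀ x ∈ Ici t, 1 / σ * g x ^ σ = 0 := by
            intro x hx
            have hx0 : (0 : ℝ) ≤ x := ht.1.trans hx
            have : g x = 0 := le_antisymm
              ((hg.antitone (mem_Ici.2 ht.1) (mem_Ici.2 hx0) hx).trans h0.symm.le)
              (hg.nonneg x hx0)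
            rw [this, Real.zero_rpow hσ0.ne', mul_zero]
          exact (hasDerivWithinAt_const t _ (0 : ℝ)).congr hz (hz t self_mem_Ici)
        refine ⟨_, h1.fun_add h2, ?_⟩
        rw [← h0, Real.zero_rpow (by norm_num)]
        simp
      · have h2 := (((hg.differentiable t ht.1).hasDerivWithinAt.rpow_const (p := σ)
          (Or.inl h0.ne')).const_mul (1 / σ)).mono (Ici_subset_Ici.2 ht.1)
        refine ⟨_, h1.fun_add h2, ?_⟩
        have h3 := mul_le_mul_of_nonneg_right (h.deriv_le t ht.1) (Real.rpow_nonneg h0.le (σ - 1))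
        have h4 : g t ^ p * g t ^ (σ - 1) = g t ^ (1 / 2 : ℝ) := by
          rw [← Real.rpow_add h0, hσ]; congr 1; ring
        have e : 1 / σ * (derivWithin g (Ici 0) t * σ * g t ^ (σ - 1))
            = derivWithin g (Ici 0) t * g t ^ (σ - 1) := by field_simp
        rw [e, ← h4]
        linarith)
  simp only [intervalIntegral.integral_same, zero_add] at key
  have : 0 ≤ 1 / σ * g T ^ σ := mul_nonneg (by positivity) (Real.rpow_nonneg (hg.nonneg T hT) _)
  linarith

/-- Splitting at the threshold `√w = z`; a pointwise substitute for Hölder's inequality. -/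
theorem le_split_sqrt {w z p : ℝ} (hw : 0 ≤ w) (hz : 0 < z) (hp : 1 ≤ p) :
    w ≤ z * w ^ (1 / 2 : ℝ) + z ^ (1 - (2 * p - 1)) * w ^ p := by
  have hs : w ^ (1 / 2 : ℝ) * w ^ (1 / 2 : ℝ) = w := by
    rw [← Real.sqrt_eq_rpow, Real.mul_self_sqrt hw]
  rcases le_or_gt (w ^ (1 / 2 : ℝ)) z with h | h
  · have h1 : w ≤ z * w ^ (1 / 2 : ℝ) := by
      calc w = w ^ (1 / 2 : ℝ) * w ^ (1 / 2 : ℝ) := hs.symm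
        _ ≤ _ := mul_le_mul_of_nonneg_right h (Real.rpow_nonneg hw _)
    have : 0 ≤ z ^ (1 - (2 * p - 1)) * w ^ p := by positivity
    linarith
  · have hw0 : 0 < w := by
      rcases hw.eq_or_lt with h0 | h0
      · rw [← h0, Real.zero_rpow (by norm_num)] at h; linarith
      · exact h0
    have h2 : (w ^ (1 / 2 : ℝ)) ^ (1 - (2 * p - 1)) ≤ z ^ (1 - (2 * p - 1)) :=
      Real.rpow_le_rpow_of_nonpos hz h.le (by linarith)
    have h3 : (w ^ (1 / 2 : ℝ)) ^ (1 - (2 * p - 1)) * w ^ p = w := by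
      rw [← Real.rpow_mul hw, ← Real.rpow_add hw0]
      have : 1 / 2 * (1 - (2 * p - 1)) + p = 1 := by ring
      rw [this, Real.rpow_one]
    have h4 := mul_le_mul_of_nonneg_right h2 (Real.rpow_nonneg hw p)
    have : 0 ≤ z * w ^ (1 / 2 : ℝ) := by positivity
    linarith

theorem le_split {w z p : ℝ} (hw : 0 ≤ w) (hz : 0 < z) (hp : 1 ≤ p) :
    w ≤ z + z ^ (1 - p) * w ^ p := by
  rcases le_or_gt w z with h | h
  · have : 0 ≤ z ^ (1 - p) * w ^ p := by positivity
    linarith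
  · have hw0 : 0 < w := hz.trans h
    have h2 : w ^ (1 - p) ≤ z ^ (1 - p) := Real.rpow_le_rpow_of_nonpos hz h.le (by linarith)
    have h3 : w ^ (1 - p) * w ^ p = w := by rw [← Real.rpow_add hw0]; simp
    have h4 := mul_le_mul_of_nonneg_right h2 (Real.rpow_nonneg hw p)
    linarith

/-- The memory term of every mode is bounded, for each `z > 0`, by a multiple of `z E(0)` and a
multiple of `z^(1-r)` times the dissipation rate. -/
def MemoryBound (k₁ k₂ ρ₁ ρ₂ l μ₀ r K C : ℝ) (g ξ : ℝ → ℝ) : Prop :=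
  ∀ (μ : ℝ) (X : Mode k₁ k₂ ρ₁ ρ₂ l μ g), μ₀ ≤ μ → ∀ t z : ℝ, 0 ≤ t → 0 < z →
    ξ t * X.memory t ≤ z * (K * X.energy 0) + C * z ^ (1 - r) * X.dissipation t

section Absorb

variable {k₁ k₂ ρ₁ ρ₂ l μ : ℝ} {g ξ : ℝ → ℝ} {p : ℝ}

/-- The hypothesis `g' ≤ -ξ g^p` bounds a memory integral with kernel `g^p` by the dissipation. -/
theorem Mode.rpow_memory_le (X : Mode k₁ k₂ ρ₁ ρ₂ l μ g) (hg : HypA1 k₂ g) (h : HypA2 g ξ p)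
    {t : ℝ} (ht : 0 ≤ t) :
    ξ t * (μ ^ 2 * variation (fun s => g s ^ p) X.b t) ≤ 2 * X.dissipation t := by
  have hp : 0 ≤ p := zero_le_one.trans h.one_le
  have hi := intervalIntegrable_variation ht
    (intervalIntegrable_of_continuousOn (hg.continuousOn_rpow hp) ht) X.deriv_b.continuousOn
  have hi' := intervalIntegrable_variation ht (hg.intervalIntegrable_kernelDeriv ht)
    X.deriv_b.continuousOn
  have h1 : ξ t * variation (fun s => g s ^ p) X.b t ≤ -variation (kernelDeriv g) X.b t := by
    rw [variation, variation, ← intervalIntegral.integral_neg,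
      ← intervalIntegral.integral_const_mul]
    apply intervalIntegral.integral_mono_on ht (hi.const_mul _) hi'.neg
    intro s hs
    have h2 : ξ t * g s ^ p ≤ -kernelDeriv g s := by
      have h3 := mul_le_mul_of_nonneg_right
        (h.antitone (mem_Ici.2 hs.1) (mem_Ici.2 ht) hs.2) (Real.rpow_nonneg (hg.nonneg s hs.1) p)
      have h4 := h.deriv_le s hs.1
      rw [kernelDeriv]; linarith
    have h5 := mul_le_mul_of_nonneg_right h2 (sq_nonneg (X.b t - X.b (t - s)))
    simp only [Pi.neg_apply]
    linarith
  have h6 := mul_le_mul_of_nonneg_left h1 (sq_nonneg μ)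
  have h7 := mul_nonneg (hg.nonneg t ht) (sq_nonneg (μ * X.b t))
  rw [Mode.dissipation]
  linarith

/-- The constant in the bound of `ψₓ²` by the energy. -/
noncomputable def energyConst (k₁ k₂ ρ₁ ρ₂ : ℝ) (g : ℝ → ℝ) : ℝ :=
  2 * (1 / ρ₁ + 1 / ρ₂ + 1 / k₁ + 1 / (k₂ - ∫ s in Ioi (0 : ℝ), g s) + 1)

theorem energyConst_pos (hg : HypA1 k₂ g) (hk₁ : 0 < k₁) (hρ₁ : 0 < ρ₁) (hρ₂ : 0 < ρ₂) :
    0 < energyConst k₁ k₂ ρ₁ ρ₂ g := by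
  have := hg.integral_lt
  rw [energyConst]; positivity

theorem Mode.bending_sq_le (X : Mode k₁ k₂ ρ₁ ρ₂ l μ g) (hg : HypA1 k₂ g) (hk₁ : 0 < k₁)
    (hρ₁ : 0 < ρ₁) (hρ₂ : 0 < ρ₂) {t : ℝ} (ht : 0 ≤ t) :
    (μ * X.b t) ^ 2 ≤ energyConst k₁ k₂ ρ₁ ρ₂ g * X.energy t := by
  have h := X.squares_le_energy hg hk₁ hρ₁ hρ₂ ht
  have hP := X.memory_nonneg hg ht
  rw [energyConst]
  linarith [sq_nonneg (X.a' t), sq_nonneg (X.b' t), sq_nonneg (X.c' t), sq_nonneg (X.shear t),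
    sq_nonneg (X.axial t)]

theorem Mode.increment_sq_le (X : Mode k₁ k₂ ρ₁ ρ₂ l μ g) (hg : HypA1 k₂ g) (hk₁ : 0 < k₁)
    (hρ₁ : 0 < ρ₁) (hρ₂ : 0 < ρ₂) {s t : ℝ} (hs : 0 ≤ s) (hst : s ≤ t) :
    μ ^ 2 * (X.b t - X.b s) ^ 2 ≤ 4 * energyConst k₁ k₂ ρ₁ ρ₂ g * X.energy s := by
  have h1 := X.bending_sq_le hg hk₁ hρ₁ hρ₂ hs
  have h2 := X.bending_sq_le hg hk₁ hρ₁ hρ₂ (hs.trans hst)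
  have h3 := mul_le_mul_of_nonneg_left
    (X.antitoneOn_energy hg hρ₁ hρ₂ (mem_Ici.2 hs) (mem_Ici.2 (hs.trans hst)) hst)
    (energyConst_pos hg hk₁ hρ₁ hρ₂).le
  linarith [sq_nonneg (μ * X.b t + μ * X.b s)]

theorem memoryBound_one (hg : HypA1 k₂ g) (h : HypA2 g ξ 1) (hk₁ : 0 < k₁) (hρ₁ : 0 < ρ₁)
    (hρ₂ : 0 < ρ₂) (μ₀ : ℝ) : MemoryBound k₁ k₂ ρ₁ ρ₂ l μ₀ 1 1 2 g ξ := by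
  intro μ X _ t z ht hz
  have h1 := X.rpow_memory_le hg h ht
  simp only [Real.rpow_one] at h1
  have h2 := mul_nonneg hz.le (X.energy_nonneg hg hk₁ hρ₁ hρ₂ le_rfl)
  rw [sub_self, Real.rpow_zero, Mode.memory]
  linarith

/-- The part of the kernel below the threshold is at most `z √g`, and `ξ √g` is integrable. -/
theorem exists_memoryBound_sqrt (hg : HypA1 k₂ g) (h : HypA2 g ξ p) (hk₁ : 0 < k₁)
    (hρ₁ : 0 < ρ₁) (hρ₂ : 0 < ρ₂) (l μ₀ : ℝ) :
    ∃ K : ℝ, 0 < K ∧ MemoryBound k₁ k₂ ρ₁ ρ₂ l μ₀ (2 * p - 1) K 2 g ξ := by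
  have hA := energyConst_pos hg hk₁ hρ₁ hρ₂
  have hp3 : 0 < 3 / 2 - p := by linarith [h.lt]
  have hg0 := hg.pos_zero
  refine ⟨4 * energyConst k₁ k₂ ρ₁ ρ₂ g * (1 / (3 / 2 - p) * g 0 ^ (3 / 2 - p)), by positivity, ?_⟩
  intro μ X _ t z ht hz
  have hE0 := X.energy_nonneg hg hk₁ hρ₁ hρ₂ le_rfl
  have hp : 0 ≤ p := zero_le_one.trans h.one_le
  have i1 := intervalIntegrable_variation ht (hg.intervalIntegrable le_rfl ht)
    X.deriv_b.continuousOn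
  have i2 : IntervalIntegrable (fun s => ξ s * g s ^ (1 / 2 : ℝ)) volume 0 t :=
    intervalIntegrable_of_continuousOn
      (h.differentiable.continuousOn.mul (hg.continuousOn_rpow (by norm_num))) ht
  have i3 := intervalIntegrable_variation ht
    (intervalIntegrable_of_continuousOn (hg.continuousOn_rpow hp) ht) X.deriv_b.continuousOn
  obtain ⟨A, hAe⟩ : ∃ x, x = 4 * energyConst k₁ k₂ ρ₁ ρ₂ g * X.energy 0 := ⟨_, rfl⟩
  have hA0 : 0 ≤ A := by rw [hAe]; positivity
  obtain ⟨Z, hZ⟩ : ∃ x, x = z ^ (1 - (2 * p - 1)) := ⟨_, rfl⟩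
  have hZ0 : 0 ≤ Z := by rw [hZ]; positivity
  have main : ξ t * X.memory t ≤ z * A * (∫ s in (0 : ℝ)..t, ξ s * g s ^ (1 / 2 : ℝ))
      + Z * (ξ t * (μ ^ 2 * variation (fun s => g s ^ p) X.b t)) := by
    rw [Mode.memory, variation, variation, ← mul_assoc, ← intervalIntegral.integral_const_mul,
      ← intervalIntegral.integral_const_mul, ← mul_assoc, ← mul_assoc,
      ← intervalIntegral.integral_const_mul,
      ← intervalIntegral.integral_add (i2.const_mul _) (i3.const_mul _)]
    apply intervalIntegral.integral_mono_on ht (i1.const_mul _)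
      ((i2.const_mul _).add (i3.const_mul _))
    intro s hs
    have hts : 0 ≤ t - s := sub_nonneg.2 hs.2
    have hgs := hg.nonneg s hs.1
    have hξt := h.pos t ht
    have b1 : μ ^ 2 * (X.b t - X.b (t - s)) ^ 2 ≤ A := by
      have := X.increment_sq_le hg hk₁ hρ₁ hρ₂ hts (sub_le_self t hs.1)
      have h2 := mul_le_mul_of_nonneg_left
        (X.antitoneOn_energy hg hρ₁ hρ₂ (mem_Ici.2 le_rfl) (mem_Ici.2 hts) hts)
        (by positivity : 0 ≤ 4 * energyConst k₁ k₂ ρ₁ ρ₂ g)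
      rw [hAe]; linarith
    have b2 := le_split_sqrt hgs hz h.one_le
    rw [← hZ] at b2
    have b3 := h.antitone (mem_Ici.2 hs.1) (mem_Ici.2 ht) hs.2
    have b4 : 0 ≤ μ ^ 2 * (X.b t - X.b (t - s)) ^ 2 := by positivity
    have b5 := mul_le_mul_of_nonneg_left b2 (mul_nonneg hξt.le b4)
    have b6 : ξ t * (z * g s ^ (1 / 2 : ℝ)) ≤ ξ s * (z * g s ^ (1 / 2 : ℝ)) :=
      mul_le_mul_of_nonneg_right b3 (by positivity)
    have b7 := mul_le_mul b6 b1 b4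
      (mul_nonneg (hξt.le.trans b3) (by positivity))
    linarith only [b5, b7]
  have h1 := mul_le_mul_of_nonneg_left (integral_mul_sqrt_le hg h ht) (mul_nonneg hz.le hA0)
  have h2 := mul_le_mul_of_nonneg_left (X.rpow_memory_le hg h ht) hZ0
  rw [← hZ]
  rw [hAe] at h1 main
  linarith only [main, h1, h2]

/-- If the energies of the modes are integrable in time, uniformly relative to `E(0)`, the
exponent in the memory bound improves from `2 p - 1` to `p`: the part of the kernel below the
threshold is bounded by the threshold itself, and the increments of `ψₓ` are integrated in time. -/
theorem exists_memoryBound_of_integral (hg : HypA1 k₂ g) (h : HypA2 g ξ p) (hk₁ : 0 < k₁)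
    (hρ₁ : 0 < ρ₁) (hρ₂ : 0 < ρ₂) {l μ₀ B : ℝ} (hB : 0 < B)
    (hint : ∀ (μ : ℝ) (X : Mode k₁ k₂ ρ₁ ρ₂ l μ g), μ₀ ≤ μ → ∀ t : ℝ, 0 ≤ t →
      ∫ s in (0 : ℝ)..t, X.energy s ≤ B * X.energy 0) :
    ∃ K C : ℝ, 0 < K ∧ 0 < C ∧ MemoryBound k₁ k₂ ρ₁ ρ₂ l μ₀ p K C g ξ := by
  have hA := energyConst_pos hg hk₁ hρ₁ hρ₂
  have hξ0 := h.pos 0 le_rfl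
  refine ⟨4 * energyConst k₁ k₂ ρ₁ ρ₂ g * B, 2 * ξ 0 ^ (p - 1), by positivity, by positivity, ?_⟩
  intro μ X hμ t z ht hz
  have hp : 0 ≤ p := zero_le_one.trans h.one_le
  have hξt := h.pos t ht
  have i1 := intervalIntegrable_variation ht (hg.intervalIntegrable le_rfl ht)
    X.deriv_b.continuousOn
  have i2 : IntervalIntegrable (fun s => X.energy (t - s)) volume 0 t :=
    (continuousOn_delay (X.continuousOn_energy hg hρ₁ hρ₂) ht).intervalIntegrable
  have i3 := intervalIntegrable_variation ht
    (intervalIntegrable_of_continuousOn (hg.continuousOn_rpow hp) ht) X.deriv_b.continuousOn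
  obtain ⟨y, hy⟩ : ∃ x, x = z / ξ t := ⟨_, rfl⟩
  have hy0 : 0 < y := by rw [hy]; positivity
  have hzy : z = ξ t * y := by rw [hy]; field_simp
  obtain ⟨A, hAe⟩ : ∃ x, x = 4 * energyConst k₁ k₂ ρ₁ ρ₂ g := ⟨_, rfl⟩
  have hA0 : 0 ≤ A := by rw [hAe]; positivity
  have main : X.memory t ≤ y * A * (∫ s in (0 : ℝ)..t, X.energy (t - s))
      + y ^ (1 - p) * (μ ^ 2 * variation (fun s => g s ^ p) X.b t) := by
    rw [Mode.memory, variation, variation, ← intervalIntegral.integral_const_mul,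
      ← intervalIntegral.integral_const_mul, ← mul_assoc,
      ← intervalIntegral.integral_const_mul,
      ← intervalIntegral.integral_add (i2.const_mul _) (i3.const_mul _)]
    apply intervalIntegral.integral_mono_on ht (i1.const_mul _)
      ((i2.const_mul _).add (i3.const_mul _))
    intro s hs
    have hts : 0 ≤ t - s := sub_nonneg.2 hs.2
    have b1 := X.increment_sq_le hg hk₁ hρ₁ hρ₂ hts (sub_le_self t hs.1)
    rw [← hAe] at b1
    have b2 := le_split (hg.nonneg s hs.1) hy0 h.one_le
    have b4 : 0 ≤ μ ^ 2 * (X.b t - X.b (t - s)) ^ 2 := by positivity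
    have b5 := mul_le_mul_of_nonneg_left b2 b4
    have b6 := mul_le_mul_of_nonneg_left b1 hy0.le
    linarith only [b5, b6]
  rw [intervalIntegral.integral_comp_sub_left (fun s => X.energy s) t, sub_self, sub_zero] at main
  have h1 := mul_le_mul_of_nonneg_left (hint μ X hμ t ht) (mul_nonneg hy0.le hA0)
  have h2 := mul_le_mul_of_nonneg_left (X.rpow_memory_le hg h ht) (Real.rpow_nonneg hy0.le (1 - p))
  have h3 := mul_le_mul_of_nonneg_left (main.trans (add_le_add_left h1 _)) hξt.le
  have h4 : y ^ (1 - p) = z ^ (1 - p) * ξ t ^ (p - 1) := by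
    have : ξ t ^ (p - 1) = ξ t ^ (-(1 - p)) := by congr 1; ring
    rw [this, Real.rpow_neg hξt.le, hy, Real.div_rpow hz.le hξt.le, div_eq_mul_inv]
  have h5 : ξ t ^ (p - 1) ≤ ξ 0 ^ (p - 1) :=
    Real.rpow_le_rpow hξt.le (h.antitone (mem_Ici.2 le_rfl) (mem_Ici.2 ht) ht)
      (by linarith [h.one_le])
  have h6 := mul_le_mul_of_nonneg_left h5
    (mul_nonneg (Real.rpow_nonneg hz.le (1 - p)) (X.dissipation_nonneg hg ht))
  rw [h4] at h2 h3
  rw [← hAe]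
  have e : z * (A * B * X.energy 0) = ξ t * (y * A * (B * X.energy 0)) := by rw [hzy]; ring
  rw [e]
  linarith only [h2, h3, h6]

end Absorb

/-! ### Decay of a single mode -/

section ModeDecay

variable {k₁ k₂ ρ₁ ρ₂ l μ μ₀ t₀ : ℝ} {g ξ : ℝ → ℝ} {r κ c C₁ K C : ℝ}

/-- A memory bound turns the Lyapunov functional of a mode into decay data for `E / E(0)`.
Positivity of `E(T)` excludes the trivial mode and makes the real powers differentiable. -/
theorem Mode.exists_decayData (X : Mode k₁ k₂ ρ₁ ρ₂ l μ g) (hμ : μ₀ ≤ μ) (hg : HypA1 k₂ g)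
    (hξ : IsWeight ξ) (hρ₁ : 0 < ρ₁) (hρ₂ : 0 < ρ₂) (ht₀ : 0 < t₀)
    (hκ : 0 < κ) (hC₁ : 0 < C₁) (hK : 0 < K) (hlyap : HasLyapunov k₁ k₂ ρ₁ ρ₂ l μ₀ t₀ κ c C₁ g)
    (hmem : MemoryBound k₁ k₂ ρ₁ ρ₂ l μ₀ r K C g ξ) {T : ℝ} (hT : t₀ ≤ T)
    (hET : 0 < X.energy T) :
    ∃ ℓ, DecayData ξ r (κ / 2) c (C₁ * C * (κ / (2 * C₁ * K)) ^ (1 - r)) t₀ T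
      (fun t => X.energy t / X.energy 0) (fun t => X.dissipation t / X.energy 0) ℓ := by
  have anti := X.antitoneOn_energy hg hρ₁ hρ₂
  have hT0 : 0 ≤ T := ht₀.le.trans hT
  have pos : ∀ t, 0 ≤ t → t ≤ T → 0 < X.energy t := fun t h0 h1 =>
    hET.trans_le (anti (mem_Ici.2 h0) (mem_Ici.2 hT0) h1)
  have hE0 := pos 0 le_rfl hT0
  obtain ⟨ℓ, hℓ⟩ := hlyap μ X hμ
  refine ⟨fun t => ℓ t / X.energy 0, ?_, ?_, ?_, ?_, ?_, ?_, ?_⟩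
  · intro t ht
    refine ((X.hasDeriv_energy hg hρ₁ hρ₂ (ht₀.le.trans ht.1)).div_const _).congr_deriv ?_
    ring
  · intro t ht
    exact div_nonneg (X.dissipation_nonneg hg (ht₀.le.trans ht.1)) hE0.le
  · intro t ht
    exact div_pos (pos t (ht₀.le.trans ht.1) ht.2) hE0
  · intro t ht
    exact (div_le_one hE0).2 (anti (mem_Ici.2 le_rfl) (mem_Ici.2 (ht₀.le.trans ht.1))
      (ht₀.le.trans ht.1))
  · intro t ht
    exact div_le_div_of_nonneg_right (hℓ t ht.1).1 hE0.le
  · intro t ht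
    rw [← mul_div_assoc]
    exact div_le_div_of_nonneg_right (hℓ t ht.1).2.1 hE0.le
  · intro t ht
    have ht0 : 0 ≤ t := ht₀.le.trans ht.1
    obtain ⟨-, -, d, hd, hdle⟩ := hℓ t ht.1
    refine ⟨_, hd.div_const _, ?_⟩
    have hx := hξ.pos t ht0
    have hEt := pos t ht0 ht.2
    obtain ⟨y, hy⟩ : ∃ y, y = ξ t * (X.energy t / X.energy 0) := ⟨_, rfl⟩
    have hy0 : 0 < y := by rw [hy]; positivity
    -- this value of `z` lets the first term of the memory bound be absorbed by half of `κ ξ E`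
    have hm := hmem μ X hμ t (κ / (2 * C₁ * K) * y) ht0 (by positivity)
    rw [Real.mul_rpow (by positivity) hy0.le] at hm
    have h1 := mul_le_mul_of_nonneg_left hdle hx.le
    have h2 := mul_le_mul_of_nonneg_left hm hC₁.le
    have e1 : C₁ * (κ / (2 * C₁ * K) * y * (K * X.energy 0)) = κ / 2 * (ξ t * X.energy t) := by
      rw [hy]; field_simp
    rw [← hy, ← mul_div_assoc, ← mul_div_assoc, div_le_iff₀ hE0, add_mul, div_mul_cancel₀ _ hE0.ne']
    have e2 : -(κ / 2) * y * X.energy 0 = -(κ / 2 * (ξ t * X.energy t)) := by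
      rw [hy]; field_simp
    rw [e2]
    rw [mul_add, e1] at h2
    linarith only [h1, h2]

theorem exists_mode_exp_decay (hg : HypA1 k₂ g) (hξ : IsWeight ξ) (hk₁ : 0 < k₁)
    (hρ₁ : 0 < ρ₁) (hρ₂ : 0 < ρ₂) (ht₀ : 0 < t₀) (hκ : 0 < κ) (hc : 0 < c) (hC₁ : 0 < C₁)
    (hK : 0 < K) (hC : 0 < C) (hlyap : HasLyapunov k₁ k₂ ρ₁ ρ₂ l μ₀ t₀ κ c C₁ g)
    (hmem : MemoryBound k₁ k₂ ρ₁ ρ₂ l μ₀ 1 K C g ξ) :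
    ∃ lam M : ℝ, 0 < lam ∧ 0 < M ∧ ∀ (μ : ℝ) (X : Mode k₁ k₂ ρ₁ ρ₂ l μ g), μ₀ ≤ μ →
      ∀ t, t₀ ≤ t → X.energy t ≤ M * Real.exp (-lam * ∫ s in t₀..t, ξ s) * X.energy 0 := by
  have hξ₀ := hξ.pos t₀ ht₀.le
  have hC' : 0 < C₁ * C * (κ / (2 * C₁ * K)) ^ (1 - 1 : ℝ) := by positivity
  refine ⟨_, _, div_pos (half_pos hκ) (add_pos (mul_pos hξ₀ hc) hC'),
    div_pos (add_pos (mul_pos hξ₀ hc) hC') hC', fun μ X hμ t ht => ?_⟩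
  have hE0 := X.energy_nonneg hg hk₁ hρ₁ hρ₂ le_rfl
  rcases (X.energy_nonneg hg hk₁ hρ₁ hρ₂ (ht₀.le.trans ht)).eq_or_lt with h0 | h0
  · rw [← h0]
    positivity
  · obtain ⟨ℓ, hdec⟩ := X.exists_decayData hμ hg hξ hρ₁ hρ₂ ht₀ hκ hC₁ hK hlyap hmem ht h0
    have hE0' : 0 < X.energy 0 := h0.trans_le (X.antitoneOn_energy hg hρ₁ hρ₂ (mem_Ici.2 le_rfl)
      (mem_Ici.2 (ht₀.le.trans ht)) (ht₀.le.trans ht))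
    have := hdec.exp_decay hξ ht₀.le ht (half_pos hκ) hc hC'
    rwa [div_le_iff₀ hE0'] at this

theorem exists_mode_poly_decay (hg : HypA1 k₂ g) (hξ : IsWeight ξ) (hk₁ : 0 < k₁)
    (hρ₁ : 0 < ρ₁) (hρ₂ : 0 < ρ₂) (ht₀ : 0 < t₀) (hr : 1 < r) (hκ : 0 < κ) (hc : 0 < c)
    (hC₁ : 0 < C₁) (hK : 0 < K) (hC : 0 < C)
    (hlyap : HasLyapunov k₁ k₂ ρ₁ ρ₂ l μ₀ t₀ κ c C₁ g)
    (hmem : MemoryBound k₁ k₂ ρ₁ ρ₂ l μ₀ r K C g ξ) :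
    ∃ M : ℝ, 0 < M ∧ ∀ (μ : ℝ) (X : Mode k₁ k₂ ρ₁ ρ₂ l μ g), μ₀ ≤ μ → ∀ t, t₀ ≤ t →
      X.energy t ≤ M * (1 / (1 + ∫ s in t₀..t, ξ s ^ r)) ^ (1 / (r - 1)) * X.energy 0 := by
  have hC' : 0 < C₁ * C * (κ / (2 * C₁ * K)) ^ (1 - r) := by positivity
  obtain ⟨M, hM, H⟩ := exists_poly_decay (t₀ := t₀) hξ ht₀.le hr (half_pos hκ) hc hC'
  refine ⟨M, hM, fun μ X hμ t ht => ?_⟩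
  have hE0 := X.energy_nonneg hg hk₁ hρ₁ hρ₂ le_rfl
  rcases (X.energy_nonneg hg hk₁ hρ₁ hρ₂ (ht₀.le.trans ht)).eq_or_lt with h0 | h0
  · rw [← h0]
    have : 0 ≤ ∫ s in t₀..t, ξ s ^ r := intervalIntegral.integral_nonneg ht fun s hs =>
      Real.rpow_nonneg (hξ.pos s (ht₀.le.trans hs.1)).le _
    positivity
  · obtain ⟨ℓ, hdec⟩ := X.exists_decayData hμ hg hξ hρ₁ hρ₂ ht₀ hκ hC₁ hK hlyap hmem ht h0
    have hE0' : 0 < X.energy 0 := h0.trans_le (X.antitoneOn_energy hg hρ₁ hρ₂ (mem_Ici.2 le_rfl)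
      (mem_Ici.2 (ht₀.le.trans ht)) (ht₀.le.trans ht))
    have := H t _ _ _ ht hdec
    rwa [div_le_iff₀ hE0'] at this

/-- An integrable decay rate makes the energies of the modes integrable in time. -/
theorem exists_integral_energy_le (hg : HypA1 k₂ g) (hk₁ : 0 < k₁) (hρ₁ : 0 < ρ₁)
    (hρ₂ : 0 < ρ₂) (ht₀ : 0 < t₀) {M : ℝ} (hM : 0 < M) {R : ℝ → ℝ}
    (hR : IntegrableOn R (Ioi t₀)) (hR0 : ∀ t, t₀ < t → 0 ≤ R t)
    (hdec : ∀ (μ : ℝ) (X : Mode k₁ k₂ ρ₁ ρ₂ l μ g), μ₀ ≤ μ → ∀ t, t₀ ≤ t →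
      X.energy t ≤ M * R t * X.energy 0) :
    ∃ B : ℝ, 0 < B ∧ ∀ (μ : ℝ) (X : Mode k₁ k₂ ρ₁ ρ₂ l μ g), μ₀ ≤ μ → ∀ t : ℝ, 0 ≤ t →
      ∫ s in (0 : ℝ)..t, X.energy s ≤ B * X.energy 0 := by
  have hI : 0 ≤ ∫ s in Ioi t₀, R s := setIntegral_nonneg measurableSet_Ioi fun s hs => hR0 s hs
  refine ⟨t₀ + M * ∫ s in Ioi t₀, R s, by positivity, fun μ X hμ t ht => ?_⟩
  have hE0 := X.energy_nonneg hg hk₁ hρ₁ hρ₂ le_rfl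
  have hc := X.continuousOn_energy hg hρ₁ hρ₂
  have short : ∀ s, 0 ≤ s → s ≤ t₀ → ∫ x in (0 : ℝ)..s, X.energy x ≤ t₀ * X.energy 0 := by
    intro s hs hst
    have h1 := intervalIntegral.integral_mono_on hs (intervalIntegrable_of_continuousOn hc hs)
      (intervalIntegrable_const (c := X.energy 0)) fun x hx =>
        X.antitoneOn_energy hg hρ₁ hρ₂ (mem_Ici.2 le_rfl) (mem_Ici.2 hx.1) hx.1
    rw [intervalIntegral.integral_const, sub_zero, smul_eq_mul] at h1
    exact h1.trans (mul_le_mul_of_nonneg_right hst hE0)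
  have hMI : 0 ≤ M * (∫ s in Ioi t₀, R s) * X.energy 0 := by positivity
  rcases le_total t t₀ with h | h
  · linarith [short t ht h]
  · have hint : IntervalIntegrable X.energy volume t₀ t :=
      (hc.mono (by rw [uIcc_of_le h]; exact fun x hx => ht₀.le.trans hx.1)).intervalIntegrable
    rw [← intervalIntegral.integral_add_adjacent_intervals
      (intervalIntegrable_of_continuousOn hc ht₀.le) hint]
    have h2 : ∫ s in t₀..t, X.energy s ≤ M * (∫ s in Ioi t₀, R s) * X.energy 0 := by
      have hRt : IntegrableOn R (Ioc t₀ t) := hR.mono_set Ioc_subset_Ioi_self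
      have h3 : ∫ s in t₀..t, X.energy s ≤ ∫ s in t₀..t, M * X.energy 0 * R s := by
        apply intervalIntegral.integral_mono_on h hint
          (((intervalIntegrable_iff_integrableOn_Ioc_of_le h).2 hRt).const_mul _)
        intro s hs
        linarith [hdec μ X hμ s hs.1]
      have h4 : ∫ s in t₀..t, R s ≤ ∫ s in Ioi t₀, R s := by
        rw [intervalIntegral.integral_of_le h]
        apply setIntegral_mono_set hR _ Ioc_subset_Ioi_self.eventuallyLE
        filter_upwards [ae_restrict_mem measurableSet_Ioi] with s hs using hR0 s hs
      rw [intervalIntegral.integral_const_mul] at h3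
      have h5 := mul_le_mul_of_nonneg_left h4 (mul_nonneg hM.le hE0)
      linarith
    linarith [short t₀ ht₀.le le_rfl]

end ModeDecay

end Bresse

/-! ### Sine and cosine series in `L²(0,L)` -/

namespace Bresse

open MeasureTheory Set Filter Topology

section Fourier

variable {L : ℝ}

theorem memLp_of_continuous (L : ℝ) {f : ℝ → ℝ} (hf : Continuous f) :
    MemLp f 2 (volume.restrict (Ioo (0 : ℝ) L)) := by
  obtain ⟨C, hC⟩ := isCompact_Icc.exists_bound_of_continuousOn (hf.continuousOn (s := Icc 0 L))
  apply MemLp.of_bound hf.aestronglyMeasurable C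
  filter_upwards [ae_restrict_mem measurableSet_Ioo] with x hx
  exact hC x (Ioo_subset_Icc_self hx)

/-- The class in `L²(0,L)` of a continuous function. -/
noncomputable def toL2 (L : ℝ) (f : ℝ → ℝ) (hf : Continuous f) : L2 L :=
  (memLp_of_continuous L hf).toLp f

theorem coeFn_toL2 (L : ℝ) {f : ℝ → ℝ} (hf : Continuous f) :
    toL2 L f hf =ᵐ[volume.restrict (Ioo (0 : ℝ) L)] f :=
  MemLp.coeFn_toLp _

theorem toL2_congr {f f' : ℝ → ℝ} (hf : Continuous f) (hf' : Continuous f') (h : f = f') :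
    toL2 L f hf = toL2 L f' hf' := by
  subst h; rfl

theorem inner_eq_integral (u v : L2 L) : inner ℝ u v = ∫ x in Ioo (0 : ℝ) L, u x * v x := by
  rw [L2.inner_def]
  apply integral_congr_ae
  filter_upwards with x
  simp [mul_comm]

theorem inner_toL2_right (u : L2 L) {f : ℝ → ℝ} (hf : Continuous f) :
    inner ℝ u (toL2 L f hf) = ∫ x in Ioo (0 : ℝ) L, u x * f x := by
  rw [inner_eq_integral]
  apply integral_congr_ae
  filter_upwards [coeFn_toL2 L hf] with x hx
  rw [hx]

theorem inner_toL2 {f f' : ℝ → ℝ} (hf : Continuous f) (hf' : Continuous f') (hL : 0 ≤ L) :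
    inner ℝ (toL2 L f hf) (toL2 L f' hf') = ∫ x in (0 : ℝ)..L, f x * f' x := by
  rw [inner_toL2_right, intervalIntegral.integral_of_le hL, integral_Ioc_eq_integral_Ioo]
  apply integral_congr_ae
  filter_upwards [coeFn_toL2 L hf] with x hx
  rw [hx]

theorem integrable_L2 (u : L2 L) : Integrable u (volume.restrict (Ioo (0 : ℝ) L)) :=
  (Lp.memLp u).integrable one_le_two

theorem integrable_mul_continuous {f h : ℝ → ℝ}
    (hf : Integrable f (volume.restrict (Ioo (0 : ℝ) L))) (hh : Continuous h) :
    Integrable (fun x => f x * h x) (volume.restrict (Ioo (0 : ℝ) L)) := by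
  obtain ⟨C, hC⟩ := isCompact_Icc.exists_bound_of_continuousOn (hh.continuousOn (s := Icc 0 L))
  apply hf.mul_bdd (c := C) hh.aestronglyMeasurable
  filter_upwards [ae_restrict_mem measurableSet_Ioo] with x hx
  exact hC x (Ioo_subset_Icc_self hx)

/-- An integrable function that is orthogonal to all test functions vanishes. -/
theorem ae_eq_zero_of_test {f : ℝ → ℝ} (hf : Integrable f (volume.restrict (Ioo (0 : ℝ) L)))
    (h : ∀ η, IsTestFun L η → ∫ x in Ioo (0 : ℝ) L, f x * η x = 0) :
    f =ᵐ[volume.restrict (Ioo (0 : ℝ) L)] 0 := by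
  have key := isOpen_Ioo.ae_eq_zero_of_integral_contDiff_smul_eq_zero (U := Ioo (0 : ℝ) L)
    (μ := volume.restrict (Ioo (0 : ℝ) L)) (f := f) (hf.locallyIntegrable.locallyIntegrableOn _)
    (fun η h1 h2 h3 => by
      refine Eq.trans ?_ (h η ⟨h1, h2, h3⟩)
      congr 1; ext x; rw [smul_eq_mul, mul_comm])
  filter_upwards [key, ae_restrict_mem measurableSet_Ioo] with x hx hx'
  exact hx hx'

/-- Completeness of the cosine system: polynomials in `cos (π x / L)` are combinations of the
functions `cos (n π x / L)`, and they are dense by the Weierstrass theorem. -/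
theorem ae_eq_zero_of_cos (hL : 0 < L) {f : ℝ → ℝ}
    (hf : Integrable f (volume.restrict (Ioo (0 : ℝ) L)))
    (h : ∀ n : ℕ, ∫ x in Ioo (0 : ℝ) L, f x * Real.cos (n * (Real.pi / L * x)) = 0) :
    f =ᵐ[volume.restrict (Ioo (0 : ℝ) L)] 0 := by
  have hpow : ∀ k n : ℕ, ∫ x in Ioo (0 : ℝ) L,
      f x * (Real.cos (Real.pi / L * x) ^ k * Real.cos (n * (Real.pi / L * x))) = 0 := by
    intro k
    induction k with
    | zero => intro n; simpa using h n
    | succ k ih =>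
      intro n
      cases n with
      | zero =>
        refine Eq.trans ?_ (ih 1)
        congr 1; ext x
        simp only [Nat.cast_zero, zero_mul, Real.cos_zero, Nat.cast_one, one_mul]
        ring
      | succ n =>
        have e : ∀ x, f x * (Real.cos (Real.pi / L * x) ^ (k + 1)
            * Real.cos ((n + 1 : ℕ) * (Real.pi / L * x)))
            = 1 / 2 * (f x * (Real.cos (Real.pi / L * x) ^ k
              * Real.cos ((n + 2 : ℕ) * (Real.pi / L * x))))
            + 1 / 2 * (f x * (Real.cos (Real.pi / L * x) ^ k
              * Real.cos (n * (Real.pi / L * x)))) := by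
          intro x
          have e1 : ((n + 2 : ℕ) : ℝ) * (Real.pi / L * x)
              = (n + 1 : ℕ) * (Real.pi / L * x) + Real.pi / L * x := by push_cast; ring
          have e2 : (n : ℝ) * (Real.pi / L * x)
              = (n + 1 : ℕ) * (Real.pi / L * x) - Real.pi / L * x := by push_cast; ring
          rw [e1, e2, Real.cos_add, Real.cos_sub]
          ring
        simp_rw [e]
        rw [integral_add, integral_const_mul, integral_const_mul, ih, ih]
        · simp
        · exact (integrable_mul_continuous hf (by fun_prop)).const_mul _
        · exact (integrable_mul_continuous hf (by fun_prop)).const_mul _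
  have hpoly : ∀ P : Polynomial ℝ, ∫ x in Ioo (0 : ℝ) L,
      f x * P.eval (Real.cos (Real.pi / L * x)) = 0 := by
    intro P
    induction P using Polynomial.induction_on' with
    | add p q hp hq =>
      simp_rw [Polynomial.eval_add, mul_add]
      rw [integral_add, hp, hq, add_zero]
      · exact integrable_mul_continuous hf (by fun_prop)
      · exact integrable_mul_continuous hf (by fun_prop)
    | monomial k a =>
      have := hpow k 0
      simp only [Nat.cast_zero, zero_mul, Real.cos_zero, mul_one] at this
      simp_rw [Polynomial.eval_monomial, mul_left_comm (f _) a]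
      rw [integral_const_mul, this, mul_zero]
  apply ae_eq_zero_of_test hf
  intro η hη
  have hc : Continuous fun y => η (L / Real.pi * Real.arccos y) :=
    hη.1.continuous.comp (by fun_prop)
  obtain ⟨A, hA⟩ : ∃ x, x = ∫ x in Ioo (0 : ℝ) L, ‖f x‖ := ⟨_, rfl⟩
  have hA0 : 0 ≤ A := by rw [hA]; exact integral_nonneg fun _ => norm_nonneg _
  have hle : ∀ ε : ℝ, 0 < ε → |∫ x in Ioo (0 : ℝ) L, f x * η x| ≤ A * ε := by
    intro ε hε
    obtain ⟨P, hP⟩ := exists_polynomial_near_of_continuousOn (-1) 1 _ hc.continuousOn ε hε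
    have e : ∫ x in Ioo (0 : ℝ) L, f x * η x
        = ∫ x in Ioo (0 : ℝ) L, f x * (η x - P.eval (Real.cos (Real.pi / L * x))) := by
      simp_rw [mul_sub]
      rw [integral_sub (integrable_mul_continuous hf hη.1.continuous)
        (integrable_mul_continuous hf (by fun_prop)), hpoly, sub_zero]
    rw [e, ← Real.norm_eq_abs, hA, ← integral_mul_const]
    refine norm_integral_le_of_norm_le (hf.norm.mul_const ε) ?_
    filter_upwards [ae_restrict_mem measurableSet_Ioo] with x hx
    rw [norm_mul]
    apply mul_le_mul_of_nonneg_left _ (norm_nonneg _)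
    have h1 := hP (Real.cos (Real.pi / L * x)) ⟨Real.neg_one_le_cos _, Real.cos_le_one _⟩
    have h2 : Real.pi / L * x ≤ Real.pi := by
      rw [div_mul_eq_mul_div, div_le_iff₀ hL]
      exact mul_le_mul_of_nonneg_left hx.2.le Real.pi_pos.le
    rw [Real.arccos_cos (mul_nonneg (div_nonneg Real.pi_pos.le hL.le) hx.1.le) h2] at h1
    have h3 : L / Real.pi * (Real.pi / L * x) = x := by
      have := Real.pi_ne_zero
      field_simp
    rw [h3, abs_sub_comm] at h1
    exact h1.le
  by_contra hne
  have hpos : 0 < |∫ x in Ioo (0 : ℝ) L, f x * η x| := abs_pos.2 hne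
  have := hle (|∫ x in Ioo (0 : ℝ) L, f x * η x| / (2 * (A + 1))) (by positivity)
  rw [← mul_div_assoc, le_div_iff₀ (by positivity)] at this
  nlinarith

/-- Completeness of the sine system: if `f` is orthogonal to all sines, then `f sin (π x / L)` is
orthogonal to all cosines. -/
theorem ae_eq_zero_of_sin (hL : 0 < L) {f : ℝ → ℝ}
    (hf : Integrable f (volume.restrict (Ioo (0 : ℝ) L)))
    (h : ∀ n : ℕ, ∫ x in Ioo (0 : ℝ) L, f x * Real.sin ((n + 1 : ℕ) * (Real.pi / L * x)) = 0) :
    f =ᵐ[volume.restrict (Ioo (0 : ℝ) L)] 0 := by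
  have h0 : ∀ n : ℕ, ∫ x in Ioo (0 : ℝ) L, f x * Real.sin (n * (Real.pi / L * x)) = 0 := by
    intro n
    cases n with
    | zero => simp
    | succ n => exact h n
  have key := ae_eq_zero_of_cos hL (f := fun x => f x * Real.sin (Real.pi / L * x))
    (integrable_mul_continuous hf (by fun_prop)) (fun n => by
      cases n with
      | zero => simpa using h0 1
      | succ n =>
        have e : ∀ x, f x * Real.sin (Real.pi / L * x) * Real.cos ((n + 1 : ℕ) * (Real.pi / L * x))
            = 1 / 2 * (f x * Real.sin ((n + 2 : ℕ) * (Real.pi / L * x)))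
            - 1 / 2 * (f x * Real.sin (n * (Real.pi / L * x))) := by
          intro x
          have e1 : ((n + 2 : ℕ) : ℝ) * (Real.pi / L * x)
              = (n + 1 : ℕ) * (Real.pi / L * x) + Real.pi / L * x := by push_cast; ring
          have e2 : (n : ℝ) * (Real.pi / L * x)
              = (n + 1 : ℕ) * (Real.pi / L * x) - Real.pi / L * x := by push_cast; ring
          rw [e1, e2, Real.sin_add, Real.sin_sub]
          ring
        simp_rw [e]
        rw [integral_sub, integral_const_mul, integral_const_mul, h0, h0]
        · simp
        · exact (integrable_mul_continuous hf (by fun_prop)).const_mul _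
        · exact (integrable_mul_continuous hf (by fun_prop)).const_mul _)
  filter_upwards [key, ae_restrict_mem measurableSet_Ioo] with x hx hx'
  have hs : 0 < Real.sin (Real.pi / L * x) := by
    apply Real.sin_pos_of_pos_of_lt_pi (mul_pos (div_pos Real.pi_pos hL) hx'.1)
    rw [div_mul_eq_mul_div, div_lt_iff₀ hL]
    exact mul_lt_mul_of_pos_left hx'.2 Real.pi_pos
  exact (mul_eq_zero.1 hx).resolve_right hs.ne'

/-- The frequency `(n + 1) π / L`. -/
noncomputable def freq (L : ℝ) (n : ℕ) : ℝ := (n + 1 : ℕ) * (Real.pi / L)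

theorem freq_pos (hL : 0 < L) (n : ℕ) : 0 < freq L n :=
  mul_pos (by positivity) (div_pos Real.pi_pos hL)

theorem le_freq (hL : 0 < L) (n : ℕ) : Real.pi / L ≤ freq L n := by
  have : (1 : ℝ) ≤ (n + 1 : ℕ) := by push_cast; linarith [Nat.cast_nonneg (α := ℝ) n]
  exact le_mul_of_one_le_left (div_pos Real.pi_pos hL).le this

/-- The normalised function `√(2/L) sin ((n + 1) π x / L)`. -/
noncomputable def sinFun (L : ℝ) (n : ℕ) (x : ℝ) : ℝ := √(2 / L) * Real.sin (freq L n * x)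

/-- The normalised function `√(2/L) cos ((n + 1) π x / L)`. -/
noncomputable def cosFun (L : ℝ) (n : ℕ) (x : ℝ) : ℝ := √(2 / L) * Real.cos (freq L n * x)

theorem contDiff_sinFun (L : ℝ) (n : ℕ) : ContDiff ℝ (⊤ : ℕ∞) (sinFun L n) := by
  unfold sinFun; fun_prop

theorem contDiff_cosFun (L : ℝ) (n : ℕ) : ContDiff ℝ (⊤ : ℕ∞) (cosFun L n) := by
  unfold cosFun; fun_prop

theorem hasDerivAt_sinFun (L : ℝ) (n : ℕ) (x : ℝ) :
    HasDerivAt (sinFun L n) (freq L n * cosFun L n x) x := by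
  have := (((hasDerivAt_id x).const_mul (freq L n)).sin).const_mul √(2 / L)
  refine this.congr_deriv ?_
  simp only [id, cosFun]; ring

theorem hasDerivAt_cosFun (L : ℝ) (n : ℕ) (x : ℝ) :
    HasDerivAt (cosFun L n) (-(freq L n * sinFun L n x)) x := by
  have := (((hasDerivAt_id x).const_mul (freq L n)).cos).const_mul √(2 / L)
  refine this.congr_deriv ?_
  simp only [id, sinFun]; ring

/-- The element of `L²(0,L)` given by `sinFun`. -/
noncomputable def sinL2 (L : ℝ) (n : ℕ) : L2 L := toL2 L _ (contDiff_sinFun L n).continuous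

/-- The element of `L²(0,L)` given by `cosFun`. -/
noncomputable def cosL2 (L : ℝ) (n : ℕ) : L2 L := toL2 L _ (contDiff_cosFun L n).continuous

/-- The constant function `1` in `L²(0,L)`. -/
noncomputable def oneL2 (L : ℝ) : L2 L := toL2 L (fun _ => 1) continuous_const

theorem integral_cos_int (hL : 0 < L) (k : ℤ) :
    ∫ x in (0 : ℝ)..L, Real.cos (k * (Real.pi / L) * x) = if k = 0 then L else 0 := by
  split_ifs with hk
  · simp [hk]
  · have hk' : (k : ℝ) * (Real.pi / L) ≠ 0 :=
      mul_ne_zero (Int.cast_ne_zero.2 hk) (div_pos Real.pi_pos hL).ne'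
    rw [intervalIntegral.integral_comp_mul_left (fun x => Real.cos x) hk', integral_cos]
    have : (k : ℝ) * (Real.pi / L) * L = k * Real.pi := by field_simp
    rw [this, Real.sin_int_mul_pi]
    simp

theorem inner_sinL2 (hL : 0 < L) (m n : ℕ) :
    inner ℝ (sinL2 L m) (sinL2 L n) = if m = n then (1 : ℝ) else 0 := by
  rw [sinL2, sinL2, inner_toL2 _ _ hL.le]
  have e : ∀ x, sinFun L m x * sinFun L n x
      = 1 / L * Real.cos (((m : ℤ) - n : ℤ) * (Real.pi / L) * x)
        - 1 / L * Real.cos (((m : ℤ) + n + 2 : ℤ) * (Real.pi / L) * x) := by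
    intro x
    have e1 : (((m : ℤ) - n : ℤ) : ℝ) * (Real.pi / L) * x = freq L m * x - freq L n * x := by
      simp only [freq]; push_cast; ring
    have e2 : (((m : ℤ) + n + 2 : ℤ) : ℝ) * (Real.pi / L) * x = freq L m * x + freq L n * x := by
      simp only [freq]; push_cast; ring
    rw [e1, e2, Real.cos_sub, Real.cos_add]
    have := Real.mul_self_sqrt (by positivity : 0 ≤ 2 / L)
    simp only [sinFun]
    linear_combination (Real.sin (freq L m * x) * Real.sin (freq L n * x)) * this
  simp_rw [e]
  rw [intervalIntegral.integral_sub (Continuous.intervalIntegrable (by fun_prop) _ _)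
    (Continuous.intervalIntegrable (by fun_prop) _ _), intervalIntegral.integral_const_mul,
    intervalIntegral.integral_const_mul, integral_cos_int hL, integral_cos_int hL,
    if_neg (by lia : ¬((m : ℤ) + n + 2 = 0))]
  by_cases h : m = n
  · subst h; simp [hL.ne']
  · rw [if_neg (by lia), if_neg h]; simp

theorem inner_cosL2 (hL : 0 < L) (m n : ℕ) :
    inner ℝ (cosL2 L m) (cosL2 L n) = if m = n then (1 : ℝ) else 0 := by
  rw [cosL2, cosL2, inner_toL2 _ _ hL.le]
  have e : ∀ x, cosFun L m x * cosFun L n x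
      = 1 / L * Real.cos (((m : ℤ) - n : ℤ) * (Real.pi / L) * x)
        + 1 / L * Real.cos (((m : ℤ) + n + 2 : ℤ) * (Real.pi / L) * x) := by
    intro x
    have e1 : (((m : ℤ) - n : ℤ) : ℝ) * (Real.pi / L) * x = freq L m * x - freq L n * x := by
      simp only [freq]; push_cast; ring
    have e2 : (((m : ℤ) + n + 2 : ℤ) : ℝ) * (Real.pi / L) * x = freq L m * x + freq L n * x := by
      simp only [freq]; push_cast; ring
    rw [e1, e2, Real.cos_sub, Real.cos_add]
    have := Real.mul_self_sqrt (by positivity : 0 ≤ 2 / L)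
    simp only [cosFun]
    linear_combination (Real.cos (freq L m * x) * Real.cos (freq L n * x)) * this
  simp_rw [e]
  rw [intervalIntegral.integral_add (Continuous.intervalIntegrable (by fun_prop) _ _)
    (Continuous.intervalIntegrable (by fun_prop) _ _), intervalIntegral.integral_const_mul,
    intervalIntegral.integral_const_mul, integral_cos_int hL, integral_cos_int hL,
    if_neg (by lia : ¬((m : ℤ) + n + 2 = 0))]
  by_cases h : m = n
  · subst h; simp [hL.ne']
  · rw [if_neg (by lia), if_neg h]; simp

theorem inner_cosL2_one (hL : 0 < L) (n : ℕ) : inner ℝ (cosL2 L n) (oneL2 L) = (0 : ℝ) := by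
  rw [cosL2, oneL2, inner_toL2 _ _ hL.le]
  have e : ∀ x, cosFun L n x * 1 = √(2 / L) * Real.cos (((n : ℤ) + 1 : ℤ) * (Real.pi / L) * x) := by
    intro x
    simp only [cosFun, freq]; push_cast; ring_nf
  simp_rw [e]
  rw [intervalIntegral.integral_const_mul, integral_cos_int hL, if_neg (by lia), mul_zero]

theorem inner_one_one (hL : 0 < L) : inner ℝ (oneL2 L) (oneL2 L) = L := by
  rw [oneL2, inner_toL2 _ _ hL.le]; simp

theorem mem_L2star_iff {u : L2 L} : u ∈ L2star L ↔ inner ℝ u (oneL2 L) = (0 : ℝ) := by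
  rw [oneL2, inner_toL2_right]
  simp [L2star]

/-- Parseval's identity for the sine system. -/
theorem hasSum_sin (hL : 0 < L) (u : L2 L) :
    HasSum (fun n => (inner ℝ u (sinL2 L n)) ^ 2) (‖u‖ ^ 2) := by
  have hv : Orthonormal ℝ (sinL2 L) := orthonormal_iff_ite.2 fun m n => inner_sinL2 hL m n
  have hbot : (Submodule.span ℝ (range (sinL2 L)))ᗮ = ⊥ := by
    rw [Submodule.eq_bot_iff]
    intro f hf
    rw [Submodule.mem_orthogonal] at hf
    have h1 : ∀ n, inner ℝ f (sinL2 L n) = (0 : ℝ) := fun n => by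
      rw [real_inner_comm]; exact hf _ (Submodule.subset_span ⟨n, rfl⟩)
    have h2 := ae_eq_zero_of_sin hL (integrable_L2 f) (fun n => by
      have h3 := h1 n
      rw [sinL2, inner_toL2_right] at h3
      have e : ∀ x, f x * sinFun L n x
          = √(2 / L) * (f x * Real.sin ((n + 1 : ℕ) * (Real.pi / L * x))) := by
        intro x; simp only [sinFun, freq, mul_assoc]; ring
      simp_rw [e] at h3
      rw [integral_const_mul] at h3
      exact (mul_eq_zero.1 h3).resolve_left (Real.sqrt_pos.2 (by positivity)).ne')
    exact (Lp.eq_zero_iff_ae_eq_zero).2 h2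
  have h := (HilbertBasis.mkOfOrthogonalEqBot hv hbot).hasSum_inner_mul_inner u u
  rw [HilbertBasis.coe_mkOfOrthogonalEqBot, real_inner_self_eq_norm_sq] at h
  refine h.congr_fun fun n => ?_
  rw [real_inner_comm u (sinL2 L n), sq]

/-- Parseval's identity for the cosine system, for functions of mean zero. -/
theorem hasSum_cos (hL : 0 < L) {u : L2 L} (hu : u ∈ L2star L) :
    HasSum (fun n => (inner ℝ u (cosL2 L n)) ^ 2) (‖u‖ ^ 2) := by
  have hu' := mem_L2star_iff.1 hu
  have hs : √L ≠ 0 := (Real.sqrt_pos.2 hL).ne'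
  let v : ℕ → L2 L := fun n => n.casesOn ((√L)⁻¹ • oneL2 L) (cosL2 L)
  have hv : Orthonormal ℝ v := by
    rw [orthonormal_iff_ite]
    intro m n
    cases m with
    | zero =>
      cases n with
      | zero =>
        change inner ℝ ((√L)⁻¹ • oneL2 L) ((√L)⁻¹ • oneL2 L) = _
        rw [real_inner_smul_left, real_inner_smul_right, inner_one_one hL, if_pos rfl]
        nth_rewrite 3 [← Real.mul_self_sqrt hL.le]
        field_simp
      | succ n =>
        change inner ℝ ((√L)⁻¹ • oneL2 L) (cosL2 L n) = _
        rw [real_inner_smul_left, real_inner_comm, inner_cosL2_one hL]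
        simp
    | succ m =>
      cases n with
      | zero =>
        change inner ℝ (cosL2 L m) ((√L)⁻¹ • oneL2 L) = _
        rw [real_inner_smul_right, inner_cosL2_one hL]
        simp
      | succ n =>
        change inner ℝ (cosL2 L m) (cosL2 L n) = _
        rw [inner_cosL2 hL]
        simp
  have hbot : (Submodule.span ℝ (range v))ᗮ = ⊥ := by
    rw [Submodule.eq_bot_iff]
    intro f hf
    rw [Submodule.mem_orthogonal] at hf
    have h1 : ∀ n, inner ℝ f (v n) = (0 : ℝ) := fun n => by
      rw [real_inner_comm]; exact hf _ (Submodule.subset_span ⟨n, rfl⟩)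
    have h2 := ae_eq_zero_of_cos hL (integrable_L2 f) (fun n => by
      have h3 := h1 n
      cases n with
      | zero =>
        change inner ℝ f ((√L)⁻¹ • oneL2 L) = _ at h3
        rw [real_inner_smul_right, oneL2, inner_toL2_right] at h3
        simpa [hs] using h3
      | succ n =>
        change inner ℝ f (cosL2 L n) = _ at h3
        rw [cosL2, inner_toL2_right] at h3
        have e : ∀ x, f x * cosFun L n x
            = √(2 / L) * (f x * Real.cos ((n + 1 : ℕ) * (Real.pi / L * x))) := by
          intro x; simp only [cosFun, freq, mul_assoc]; ring
        simp_rw [e] at h3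
        rw [integral_const_mul] at h3
        exact (mul_eq_zero.1 h3).resolve_left (Real.sqrt_pos.2 (by positivity)).ne')
    exact (Lp.eq_zero_iff_ae_eq_zero).2 h2
  have h := (HilbertBasis.mkOfOrthogonalEqBot hv hbot).hasSum_inner_mul_inner u u
  rw [HilbertBasis.coe_mkOfOrthogonalEqBot, real_inner_self_eq_norm_sq] at h
  have h0 : inner ℝ u (v 0) = (0 : ℝ) := by
    change inner ℝ u ((√L)⁻¹ • oneL2 L) = _
    rw [real_inner_smul_right, hu', mul_zero]
  rw [← hasSum_nat_add_iff' 1] at h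
  simp only [Finset.range_one, Finset.sum_singleton, h0, zero_mul, sub_zero] at h
  refine h.congr_fun fun n => ?_
  rw [real_inner_comm u (v (n + 1)), sq]

end Fourier

end Bresse

/-! ### Smooth functions in `H¹(0,L)` and in `H¹₀(0,L)` -/

namespace Bresse

open MeasureTheory Set Filter Topology

section Sobolev

variable {L : ℝ}

theorem isWeakDeriv_toL2 {f : ℝ → ℝ} (hf : ContDiff ℝ (⊤ : ℕ∞) f) :
    IsWeakDeriv L (toL2 L f hf.continuous) (toL2 L (deriv f) (hf.continuous_deriv (by simp))) := by
  intro η hη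
  have e1 : ∫ x in Ioo (0 : ℝ) L, toL2 L f hf.continuous x * deriv η x
      = ∫ x in Ioo (0 : ℝ) L, f x * deriv η x := by
    apply integral_congr_ae
    filter_upwards [coeFn_toL2 L hf.continuous] with x hx
    rw [hx]
  have e2 : ∫ x in Ioo (0 : ℝ) L, toL2 L (deriv f) (hf.continuous_deriv (by simp)) x * η x
      = ∫ x in Ioo (0 : ℝ) L, deriv f x * η x := by
    apply integral_congr_ae
    filter_upwards [coeFn_toL2 L (hf.continuous_deriv (by simp))] with x hx
    rw [hx]
  have hη' : Continuous (deriv η) := hη.1.continuous_deriv (by simp)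
  have hf' : Continuous (deriv f) := hf.continuous_deriv (by simp)
  have z1 : ∀ x, x ∉ Ioo 0 L → η x = 0 := fun x hx =>
    image_eq_zero_of_notMem_tsupport fun h => hx (hη.2.2 h)
  have z2 : ∀ x, x ∉ Ioo 0 L → deriv η x = 0 := fun x hx =>
    Function.notMem_support.1 fun h => hx (hη.2.2 (support_deriv_subset h))
  rw [e1, e2,
    setIntegral_eq_integral_of_forall_compl_eq_zero (fun x hx => by rw [z2 x hx, mul_zero]),
    setIntegral_eq_integral_of_forall_compl_eq_zero (fun x hx => by rw [z1 x hx, mul_zero])]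
  apply integral_mul_deriv_eq_deriv_mul_of_integrable
  · exact fun x _ => (hf.differentiable (by simp) x).hasDerivAt
  · exact fun x _ => (hη.1.differentiable (by simp) x).hasDerivAt
  · exact (hf.continuous.mul hη').integrable_of_hasCompactSupport hη.2.1.deriv.mul_left
  · exact (hf'.mul hη.1.continuous).integrable_of_hasCompactSupport hη.2.1.mul_left
  · exact (hf.continuous.mul hη.1.continuous).integrable_of_hasCompactSupport hη.2.1.mul_left

/-- The element of `H¹(0,L)` given by a smooth function. -/
noncomputable def toH1 (L : ℝ) (f : ℝ → ℝ) (hf : ContDiff ℝ (⊤ : ℕ∞) f) : H1 L :=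
  ⟨WithLp.toLp 2 (toL2 L f hf.continuous, toL2 L (deriv f) (hf.continuous_deriv (by simp))),
    isWeakDeriv_toL2 hf⟩

theorem continuous_fn : Continuous (fn : H1 L → L2 L) :=
  continuous_fst.comp ((WithLp.prod_continuous_ofLp 2 _ _).comp continuous_subtype_val)

theorem continuous_dx : Continuous (dx : H1 L → L2 L) :=
  continuous_snd.comp ((WithLp.prod_continuous_ofLp 2 _ _).comp continuous_subtype_val)

theorem IsWeakDeriv.unique {u v v' : L2 L} (h : IsWeakDeriv L u v) (h' : IsWeakDeriv L u v') :
    v = v' := by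
  have key := ae_eq_zero_of_test (f := fun x => v x - v' x)
    ((integrable_L2 v).sub (integrable_L2 v')) (fun η hη => by
      simp_rw [sub_mul]
      rw [integral_sub (hη.integrable_mul v) (hη.integrable_mul v')]
      linarith [h η hη, h' η hη])
  apply Lp.ext
  filter_upwards [key] with x hx
  exact sub_eq_zero.1 hx

/-- Integration by parts: no boundary terms occur when one of the factors lies in `H¹₀`. -/
theorem inner_dx_of_mem_H10 (W : H1 L) {χ : H1 L} (hχ : χ ∈ H10 L) :
    inner ℝ (dx W) (fn χ) = -inner ℝ (fn W) (dx χ) := by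
  have hcl : IsClosed {χ : H1 L | inner ℝ (dx W) (fn χ) = -inner ℝ (fn W) (dx χ)} :=
    isClosed_eq (continuous_const.inner continuous_fn)
      (continuous_const.inner continuous_dx).neg
  refine closure_minimal ?_ hcl hχ
  rintro U ⟨η, hη, hU⟩
  have hη' : Continuous (deriv η) := hη.1.continuous_deriv (by simp)
  have e0 : fn U = toL2 L η hη.1.continuous := Lp.ext (hU.trans (coeFn_toL2 L _).symm)
  have e1 : dx U = toL2 L (deriv η) hη' := by
    have h1 : IsWeakDeriv L (fn U) (dx U) := U.2
    rw [e0] at h1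
    exact h1.unique (isWeakDeriv_toL2 hη.1)
  rw [mem_ofPred_eq, e0, e1, inner_toL2_right, inner_toL2_right]
  have hW : IsWeakDeriv L (fn W) (dx W) := W.2
  rw [hW η hη, neg_neg]

theorem deriv_sinFun (L : ℝ) (n : ℕ) : deriv (sinFun L n) = fun x => freq L n * cosFun L n x :=
  funext fun x => (hasDerivAt_sinFun L n x).deriv

theorem deriv_cosFun (L : ℝ) (n : ℕ) : deriv (cosFun L n) = fun x => -(freq L n * sinFun L n x) :=
  funext fun x => (hasDerivAt_cosFun L n x).deriv

theorem toL2_const_mul {f : ℝ → ℝ} (hf : Continuous f) (k : ℝ) :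
    toL2 L (fun x => k * f x) (continuous_const.mul hf) = k • toL2 L f hf := by
  apply Lp.ext
  filter_upwards [coeFn_toL2 L (f := fun x => k * f x) (continuous_const.mul hf), coeFn_toL2 L hf,
    Lp.coeFn_smul k (toL2 L f hf)] with x h1 h2 h3
  rw [h1, h3, Pi.smul_apply, h2, smul_eq_mul]

/-- The element of `H¹(0,L)` given by `sinFun`. -/
noncomputable def sinH1 (L : ℝ) (n : ℕ) : H1 L := toH1 L _ (contDiff_sinFun L n)

/-- The element of `H¹(0,L)` given by `cosFun`. -/
noncomputable def cosH1 (L : ℝ) (n : ℕ) : H1 L := toH1 L _ (contDiff_cosFun L n)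

/-- The constant function `1` in `H¹(0,L)`. -/
noncomputable def oneH1 (L : ℝ) : H1 L := toH1 L (fun _ => 1) contDiff_const

theorem fn_sinH1 (n : ℕ) : fn (sinH1 L n) = sinL2 L n := rfl

theorem fn_cosH1 (n : ℕ) : fn (cosH1 L n) = cosL2 L n := rfl

theorem fn_oneH1 : fn (oneH1 L) = oneL2 L := rfl

theorem dx_toH1 {f h : ℝ → ℝ} (hf : ContDiff ℝ (⊤ : ℕ∞) f) (hh : Continuous h)
    (e : deriv f = h) : dx (toH1 L f hf) = toL2 L h hh :=
  toL2_congr (hf.continuous_deriv (by simp)) hh e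

theorem dx_sinH1 (n : ℕ) : dx (sinH1 L n) = freq L n • cosL2 L n := by
  rw [sinH1, dx_toH1 _ (continuous_const.mul (contDiff_cosFun L n).continuous) (deriv_sinFun L n)]
  exact toL2_const_mul _ _

theorem dx_cosH1 (n : ℕ) : dx (cosH1 L n) = -(freq L n) • sinL2 L n := by
  rw [cosH1, dx_toH1 (h := fun x => -freq L n * sinFun L n x) _
    (continuous_const.mul (contDiff_sinFun L n).continuous)]
  · exact toL2_const_mul _ _
  · rw [deriv_cosFun]
    ext x; ring

theorem dx_oneH1 : dx (oneH1 L) = 0 := by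
  rw [oneH1, dx_toH1 (h := fun _ => (0 : ℝ) * 1) _ (by fun_prop) (by ext x; simp),
    toL2_const_mul (L := L) (f := fun _ => (1 : ℝ)) continuous_const 0, zero_smul]

/-- Dominated convergence in `L²(0,L)`. -/
theorem tendsto_toL2 {f : ℕ → ℝ → ℝ} {h : ℝ → ℝ} (hf : ∀ k, Continuous (f k)) (hh : Continuous h)
    {C : ℝ} (hC : ∀ k, ∀ x ∈ Ioo 0 L, |f k x - h x| ≤ C)
    (hlim : ∀ x ∈ Ioo 0 L, Tendsto (fun k => f k x) atTop (𝓝 (h x))) :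
    Tendsto (fun k => toL2 L (f k) (hf k)) atTop (𝓝 (toL2 L h hh)) := by
  rw [tendsto_iff_norm_sub_tendsto_zero]
  have hsq : Tendsto (fun k => ‖toL2 L (f k) (hf k) - toL2 L h hh‖ ^ 2) atTop (𝓝 0) := by
    have e : ∀ k, ‖toL2 L (f k) (hf k) - toL2 L h hh‖ ^ 2
        = ∫ x in Ioo (0 : ℝ) L, (f k x - h x) ^ 2 := by
      intro k
      rw [← real_inner_self_eq_norm_sq, inner_eq_integral]
      apply integral_congr_ae
      filter_upwards [coeFn_toL2 L (hf k), coeFn_toL2 L hh,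
        Lp.coeFn_sub (toL2 L (f k) (hf k)) (toL2 L h hh)] with x h1 h2 h3
      rw [h3, Pi.sub_apply, h1, h2, sq]
    simp_rw [e]
    have := tendsto_integral_of_dominated_convergence
      (μ := volume.restrict (Ioo (0 : ℝ) L)) (F := fun k x => (f k x - h x) ^ 2)
      (f := fun _ => 0) (fun _ => C ^ 2)
      (fun k => (((hf k).sub hh).pow 2).aestronglyMeasurable)
      (integrable_const _)
      (fun k => by
        filter_upwards [ae_restrict_mem measurableSet_Ioo] with x hx
        rw [Real.norm_eq_abs, abs_pow]
        exact pow_le_pow_left₀ (abs_nonneg _) (hC k x hx) 2)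
      (by
        filter_upwards [ae_restrict_mem measurableSet_Ioo] with x hx
        have := ((hlim x hx).sub_const (h x)).pow 2
        simpa using this)
    simpa using this
  have := hsq.sqrt
  simpa [Real.sqrt_sq (norm_nonneg _)] using this

theorem exists_bound_deriv_smoothTransition :
    ∃ M : ℝ, 0 ≤ M ∧ ∀ x, |deriv Real.smoothTransition x| ≤ M ∧
      (x ∉ Icc 0 1 → deriv Real.smoothTransition x = 0) := by
  have hc : Continuous (deriv Real.smoothTransition) :=
    (Real.smoothTransition.contDiff (n := 1)).continuous_deriv (by simp)
  obtain ⟨M, hM⟩ := isCompact_Icc.exists_bound_of_continuousOn (hc.continuousOn (s := Icc 0 1))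
  have hz : ∀ x, x ∉ Icc 0 1 → deriv Real.smoothTransition x = 0 := by
    intro x hx
    rw [mem_Icc, not_and_or, not_le, not_le] at hx
    rcases hx with hx | hx
    · have : Real.smoothTransition =ᶠ[𝓝 x] fun _ => 0 := by
        filter_upwards [Iio_mem_nhds hx] with y hy
        exact Real.smoothTransition.zero_of_nonpos (le_of_lt hy)
      rw [this.deriv_eq]; simp
    · have : Real.smoothTransition =ᶠ[𝓝 x] fun _ => 1 := by
        filter_upwards [Ioi_mem_nhds hx] with y hy
        exact Real.smoothTransition.one_of_one_le (le_of_lt hy)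
      rw [this.deriv_eq]; simp
  have hM0 : 0 ≤ M := (norm_nonneg _).trans (hM 0 ⟨le_rfl, zero_le_one⟩)
  refine ⟨M, hM0, fun x => ⟨?_, hz x⟩⟩
  by_cases hx : x ∈ Icc 0 1
  · exact hM x hx
  · rw [hz x hx, abs_zero]; exact hM0

/-- The left half of a cut-off: it vanishes for `k x ≤ 1` and equals `1` for `k x ≥ 2`. -/
noncomputable def cutoff (k : ℕ) (x : ℝ) : ℝ := Real.smoothTransition (k * x - 1)

theorem contDiff_cutoff (k : ℕ) : ContDiff ℝ (⊤ : ℕ∞) (cutoff k) :=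
  Real.smoothTransition.contDiff.comp (by fun_prop)

theorem hasDerivAt_cutoff (k : ℕ) (x : ℝ) :
    HasDerivAt (cutoff k) (k * deriv Real.smoothTransition (k * x - 1)) x := by
  have h1 :
      HasDerivAt Real.smoothTransition (deriv Real.smoothTransition (k * x - 1)) (k * x - 1) :=
    ((Real.smoothTransition.contDiff (n := 1)).differentiable (by simp) _).hasDerivAt
  have h2 : HasDerivAt (fun x : ℝ => k * x - 1) k x := by
    simpa using ((hasDerivAt_id x).const_mul (k : ℝ)).sub_const 1
  exact (h1.comp x h2).congr_deriv (mul_comm _ _)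

theorem eventually_cutoff {x : ℝ} (hx : 0 < x) :
    ∀ᶠ k : ℕ in atTop, cutoff k x = 1 ∧ deriv (cutoff k) x = 0 := by
  obtain ⟨M, -, hM⟩ := exists_bound_deriv_smoothTransition
  filter_upwards [(tendsto_natCast_atTop_atTop.atTop_mul_const hx).eventually_gt_atTop (2 : ℝ)]
    with k hk
  refine ⟨Real.smoothTransition.one_of_one_le (by linarith), ?_⟩
  rw [(hasDerivAt_cutoff k x).deriv, (hM _).2 (fun h => by linarith [h.2]), mul_zero]

/-- The derivative of the cut-off is large only where a function vanishing at `0` is small. -/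
theorem exists_bound_mul_deriv_cutoff :
    ∃ M : ℝ, 0 ≤ M ∧ ∀ (k : ℕ) (x : ℝ), 0 ≤ x → |x * deriv (cutoff k) x| ≤ M := by
  obtain ⟨M, hM0, hM⟩ := exists_bound_deriv_smoothTransition
  refine ⟨2 * M, by positivity, fun k x hx => ?_⟩
  rw [(hasDerivAt_cutoff k x).deriv, ← mul_assoc, abs_mul, abs_mul, abs_of_nonneg hx,
    abs_of_nonneg (Nat.cast_nonneg k)]
  by_cases h : (k * x - 1 : ℝ) ∈ Icc 0 1
  · exact mul_le_mul (by linarith [h.2]) (hM _).1 (abs_nonneg _) zero_le_two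
  · rw [(hM _).2 h, abs_zero, mul_zero]; positivity

theorem abs_cutoff_le (k : ℕ) (x : ℝ) : |cutoff k x| ≤ 1 := by
  rw [cutoff, abs_of_nonneg (Real.smoothTransition.nonneg _)]
  exact Real.smoothTransition.le_one _

/-- A smooth function that vanishes linearly at both ends of `(0,L)` belongs to `H¹₀(0,L)`. -/
theorem toH1_mem_H10 {f : ℝ → ℝ} (hf : ContDiff ℝ (⊤ : ℕ∞) f) {A : ℝ}
    (hA : ∀ x ∈ Ioo 0 L, |f x| ≤ A * x ∧ |f x| ≤ A * (L - x)) : toH1 L f hf ∈ H10 L := by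
  obtain ⟨M, hM0, hM⟩ := exists_bound_mul_deriv_cutoff
  have hcr : ∀ k, ContDiff ℝ (⊤ : ℕ∞) fun x => cutoff k (L - x) := fun k =>
    (contDiff_cutoff k).comp (by fun_prop)
  have hη : ∀ k, ContDiff ℝ (⊤ : ℕ∞) fun x => cutoff k x * cutoff k (L - x) * f x := fun k =>
    ((contDiff_cutoff k).mul (hcr k)).mul hf
  have hd : ∀ k x, deriv (fun x => cutoff k x * cutoff k (L - x) * f x) x
      = (deriv (cutoff k) x * cutoff k (L - x) - cutoff k x * deriv (cutoff k) (L - x)) * f x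
        + cutoff k x * cutoff k (L - x) * deriv f x := by
    intro k x
    have d0 : ∀ y, HasDerivAt (cutoff k) (deriv (cutoff k) y) y := fun y =>
      (hasDerivAt_cutoff k y).differentiableAt.hasDerivAt
    have d1 := (d0 (L - x)).comp_const_sub L x
    have d2 := ((d0 x).fun_mul d1).fun_mul (hf.differentiable (by simp) x).hasDerivAt
    rw [d2.deriv]; ring
  obtain ⟨B, hB⟩ := isCompact_Icc.exists_bound_of_continuousOn
    ((hf.continuous_deriv (by simp)).continuousOn (s := Icc 0 L))
  have hlim : Tendsto (fun k => toH1 L _ (hη k)) atTop (𝓝 (toH1 L f hf)) := by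
    rw [tendsto_subtype_rng]
    refine ((WithLp.prod_continuous_toLp 2 _ _).tendsto _).comp (Tendsto.prodMk_nhds ?_ ?_)
    · apply tendsto_toL2 (C := A * L + A * L)
      · intro k x hx
        have h1 : |cutoff k x * cutoff k (L - x) * f x| ≤ 1 * |f x| := by
          rw [abs_mul, abs_mul]
          apply mul_le_mul_of_nonneg_right _ (abs_nonneg _)
          exact mul_le_one₀ (abs_cutoff_le k x) (abs_nonneg _) (abs_cutoff_le k _)
        have h2 := (hA x hx).1
        have h4 : 0 ≤ A := by
          by_contra hneg
          have := mul_neg_of_neg_of_pos (not_le.1 hneg) hx.1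
          linarith [abs_nonneg (f x)]
        have h3 : A * x ≤ A * L := mul_le_mul_of_nonneg_left hx.2.le h4
        have h5 := abs_sub (cutoff k x * cutoff k (L - x) * f x) (f x)
        linarith
      · intro x hx
        apply tendsto_const_nhds.congr'
        filter_upwards [eventually_cutoff hx.1, eventually_cutoff (sub_pos.2 hx.2)] with k h1 h2
        rw [h1.1, h2.1, one_mul, one_mul]
    · apply tendsto_toL2 (C := A * M + A * M + B + B)
      · intro k x hx
        have h4 : 0 ≤ A := by
          by_contra hneg
          have := mul_neg_of_neg_of_pos (not_le.1 hneg) hx.1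
          linarith [abs_nonneg (f x), (hA x hx).1]
        have h1 := hB x (Ioo_subset_Icc_self hx)
        rw [Real.norm_eq_abs] at h1
        have near : ∀ y, 0 ≤ y → |f x| ≤ A * y → |deriv (cutoff k) y * f x| ≤ A * M := by
          intro y hy hfy
          have h6 := hM k y hy
          rw [abs_mul, abs_of_nonneg hy] at h6
          rw [abs_mul]
          calc |deriv (cutoff k) y| * |f x| ≤ |deriv (cutoff k) y| * (A * y) :=
                mul_le_mul_of_nonneg_left hfy (abs_nonneg _)
            _ = A * (y * |deriv (cutoff k) y|) := by ring
            _ ≤ A * M := mul_le_mul_of_nonneg_left h6 h4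
        have shrink : ∀ y z w : ℝ, |y| ≤ 1 → |z| ≤ w → |y * z| ≤ w := by
          intro y z w hy hz
          rw [abs_mul]
          exact (mul_le_of_le_one_left (abs_nonneg z) hy).trans hz
        have a1 := shrink _ _ _ (abs_cutoff_le k (L - x)) (near x hx.1.le (hA x hx).1)
        have a2 := shrink _ _ _ (abs_cutoff_le k x) (near (L - x) (sub_pos.2 hx.2).le (hA x hx).2)
        have a3 := shrink _ _ _ (abs_cutoff_le k x)
          (shrink _ _ _ (abs_cutoff_le k (L - x)) h1)
        rw [hd]
        rw [abs_le] at a1 a2 a3 h1 ⊢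
        constructor <;> linarith [a1.1, a1.2, a2.1, a2.2, a3.1, a3.2, h1.1, h1.2]
      · intro x hx
        apply tendsto_const_nhds.congr'
        filter_upwards [eventually_cutoff hx.1, eventually_cutoff (sub_pos.2 hx.2)] with k h1 h2
        rw [hd, h1.1, h2.1, h1.2, h2.2]
        ring
  refine mem_closure_of_tendsto hlim ?_
  filter_upwards [eventually_ge_atTop 1] with k hk
  refine ⟨_, ⟨hη k, ?_⟩, coeFn_toL2 L (hη k).continuous⟩
  have hk0 : (0 : ℝ) < k := by exact_mod_cast hk
  have hsupp : Function.support (fun x => cutoff k x * cutoff k (L - x) * f x)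
      ⊆ Icc (1 / k : ℝ) (L - 1 / k) := by
    intro x hx
    rw [Function.mem_support] at hx
    have h1 : cutoff k x ≠ 0 := fun h => hx (by rw [h, zero_mul, zero_mul])
    have h2 : cutoff k (L - x) ≠ 0 := fun h => hx (by rw [h, mul_zero, zero_mul])
    have low : ∀ y, cutoff k y ≠ 0 → 1 / k ≤ y := by
      intro y hy
      by_contra hlt
      apply hy
      apply Real.smoothTransition.zero_of_nonpos
      rw [not_le, lt_div_iff₀ hk0] at hlt
      linarith
    exact ⟨low x h1, by linarith [low _ h2]⟩
  refine ⟨HasCompactSupport.of_support_subset_isCompact isCompact_Icc hsupp, ?_⟩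
  refine (closure_minimal hsupp isClosed_Icc).trans ?_
  intro x hx
  have : (0 : ℝ) < 1 / k := by positivity
  exact ⟨by linarith [hx.1], by linarith [hx.2]⟩

theorem sinH1_mem_H10 (hL : 0 < L) (n : ℕ) : sinH1 L n ∈ H10 L := by
  apply toH1_mem_H10 _ (A := √(2 / L) * freq L n)
  intro x hx
  have hf := freq_pos hL n
  have hs := Real.sqrt_nonneg (2 / L)
  have hsin : ∀ y, 0 ≤ y → |√(2 / L) * Real.sin (freq L n * y)| ≤ √(2 / L) * freq L n * y := by
    intro y hy
    rw [abs_mul, abs_of_nonneg hs, mul_assoc]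
    apply mul_le_mul_of_nonneg_left _ hs
    have := Real.abs_sin_le_abs (x := freq L n * y)
    rwa [abs_of_nonneg (mul_nonneg hf.le hy)] at this
  refine ⟨hsin x hx.1.le, ?_⟩
  have h1 := hsin (L - x) (sub_pos.2 hx.2).le
  have e1 : freq L n * (L - x) = (n + 1 : ℕ) * Real.pi - freq L n * x := by
    rw [freq]; field_simp
  have e2 : |Real.sin ((n + 1 : ℕ) * Real.pi - freq L n * x)| = |Real.sin (freq L n * x)| := by
    rw [Real.sin_sub, Real.sin_nat_mul_pi, zero_mul, zero_sub, abs_neg, abs_mul,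
      Real.cos_nat_mul_pi, abs_pow, abs_neg, abs_one, one_pow, one_mul]
  rw [e1, abs_mul, e2, ← abs_mul] at h1
  exact h1

end Sobolev

end Bresse

/-! ### Reduction of weak solutions to their Fourier modes -/

namespace Bresse

open MeasureTheory Set Filter Topology

section Reduction

variable {L l k₁ k₂ ρ₁ ρ₂ : ℝ} {g : ℝ → ℝ} {U₀ : State L} {u : ℝ → State L}

theorem inner_dx_sinL2 (hL : 0 < L) (W : H1 L) (n : ℕ) :
    inner ℝ (dx W) (sinL2 L n) = -(freq L n * inner ℝ (fn W) (cosL2 L n)) := by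
  have h := inner_dx_of_mem_H10 W (sinH1_mem_H10 hL n)
  rwa [fn_sinH1, dx_sinH1, real_inner_smul_right] at h

theorem inner_dx_cosL2 {φ : H1 L} (hφ : φ ∈ H10 L) (n : ℕ) :
    inner ℝ (dx φ) (cosL2 L n) = freq L n * inner ℝ (fn φ) (sinL2 L n) := by
  have h := inner_dx_of_mem_H10 (cosH1 L n) hφ
  rw [fn_cosH1, dx_cosH1, real_inner_smul_left, real_inner_comm, real_inner_comm (dx φ)] at h
  linarith

theorem dx_mem_L2star {φ : H1 L} (hφ : φ ∈ H10 L) : dx φ ∈ L2star L := by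
  have h := inner_dx_of_mem_H10 (oneH1 L) hφ
  rw [fn_oneH1, dx_oneH1, inner_zero_left, real_inner_comm] at h
  rw [mem_L2star_iff]
  linarith

theorem State.shear_mem_L2star {U : State L} (hU : U.Admissible) : U.shear l ∈ L2star L := by
  have h1 := mem_L2star_iff.1 (dx_mem_L2star hU.φ_mem)
  have h2 : inner ℝ (fn U.ψ) (oneL2 L) = (0 : ℝ) := mem_L2star_iff.1 hU.ψ_mem
  have h3 : inner ℝ (fn U.w) (oneL2 L) = (0 : ℝ) := mem_L2star_iff.1 hU.w_mem
  rw [mem_L2star_iff, State.shear, inner_add_left, inner_add_left, real_inner_smul_left, h1, h2, h3]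
  ring

theorem State.inner_shear {U : State L} (hU : U.Admissible) (n : ℕ) :
    inner ℝ (U.shear l) (cosL2 L n) = freq L n * inner ℝ (fn U.φ) (sinL2 L n)
      + inner ℝ (fn U.ψ) (cosL2 L n) + l * inner ℝ (fn U.w) (cosL2 L n) := by
  rw [State.shear, inner_add_left, inner_add_left, real_inner_smul_left,
    inner_dx_cosL2 hU.φ_mem]

theorem State.inner_axial (hL : 0 < L) (U : State L) (n : ℕ) :
    inner ℝ (U.axial l) (sinL2 L n) = -(freq L n * inner ℝ (fn U.w) (cosL2 L n)
      + l * inner ℝ (fn U.φ) (sinL2 L n)) := by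
  rw [State.axial, inner_sub_left, real_inner_smul_left, inner_dx_sinL2 hL]
  ring

theorem hasDerivWithinAt_inner_const {v : ℝ → L2 L} {v' : L2 L} {s : Set ℝ} {t : ℝ}
    (h : HasDerivWithinAt v v' s t) (w : L2 L) :
    HasDerivWithinAt (fun x => inner ℝ (v x) w) (inner ℝ v' w) s t := by
  simpa using h.inner ℝ (hasDerivWithinAt_const t s w)

/-- The Fourier mode of index `n` of a weak solution. -/
noncomputable def IsWeakSolution.mode (h : IsWeakSolution L l k₁ k₂ k₁ ρ₁ ρ₂ g U₀ u) (hL : 0 < L)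
    (n : ℕ) : Mode k₁ k₂ ρ₁ ρ₂ l (freq L n) g where
  a t := inner ℝ (fn (u t).φ) (sinL2 L n)
  b t := inner ℝ (fn (u t).ψ) (cosL2 L n)
  c t := inner ℝ (fn (u t).w) (cosL2 L n)
  a' t := inner ℝ (u t).φt (sinL2 L n)
  b' t := inner ℝ (u t).ψt (cosL2 L n)
  c' t := inner ℝ (u t).wt (cosL2 L n)
  deriv_a t ht := hasDerivWithinAt_inner_const (h.deriv_φ t ht) _
  deriv_b := ⟨fun t ht => hasDerivWithinAt_inner_const (h.deriv_ψ t ht) _,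
    h.continuous_ψt.inner continuousOn_const⟩
  deriv_c t ht := hasDerivWithinAt_inner_const (h.deriv_w t ht) _
  eq_a t ht := by
    refine (h.eq_φ _ (sinH1_mem_H10 hL n) t ht).congr_deriv ?_
    rw [fn_sinH1, dx_sinH1, real_inner_smul_right, State.inner_shear (h.admissible t ht),
      State.inner_axial hL]
    ring
  eq_b t ht := by
    refine (h.eq_ψ (cosH1 L n) t ht).congr_deriv ?_
    have e : ∀ s, g (t - s) * inner ℝ (dx (u s).ψ) (dx (cosH1 L n))
        = freq L n ^ 2 * (g (t - s) * inner ℝ (fn (u s).ψ) (cosL2 L n)) := by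
      intro s
      rw [dx_cosH1, real_inner_smul_right, inner_dx_sinL2 hL]
      ring
    simp_rw [e]
    have e2 := intervalIntegral.integral_comp_sub_left (a := 0) (b := t)
      (fun s => g s * inner ℝ (fn (u (t - s)).ψ) (cosL2 L n)) t
    simp only [sub_sub_cancel, sub_self, sub_zero] at e2
    rw [intervalIntegral.integral_const_mul, e2, fn_cosH1, dx_cosH1, real_inner_smul_right,
      inner_dx_sinL2 hL, State.inner_shear (h.admissible t ht)]
    ring
  eq_c t ht := by
    refine (h.eq_w (cosH1 L n) t ht).congr_deriv ?_
    rw [fn_cosH1, dx_cosH1, real_inner_smul_right, State.inner_shear (h.admissible t ht),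
      State.inner_axial hL]
    ring

/-- The memory part of the energy is the sum of the memory parts of the modes. -/
theorem IsWeakSolution.hasSum_memory (h : IsWeakSolution L l k₁ k₂ k₁ ρ₁ ρ₂ g U₀ u) (hL : 0 < L)
    (hg : HypA1 k₂ g) {t : ℝ} (ht : 0 ≤ t) :
    HasSum (fun n => (h.mode hL n).memory t)
      (∫ s in (0 : ℝ)..t, g (t - s) * ‖dx (u t).ψ - dx (u s).ψ‖ ^ 2) := by
  have e := intervalIntegral.integral_comp_sub_left (a := 0) (b := t)
    (fun s => g s * ‖dx (u t).ψ - dx (u (t - s)).ψ‖ ^ 2) t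
  simp only [sub_sub_cancel, sub_self, sub_zero] at e
  rw [e]
  have hdx : ContinuousOn (fun s => dx (u t).ψ - dx (u (t - s)).ψ) (uIcc 0 t) := by
    rw [uIcc_of_le ht]
    refine continuousOn_const.sub ((continuous_dx.comp_continuousOn h.continuous_ψ).comp
      (f := fun s => t - s) (by fun_prop) fun s hs => ?_)
    simpa using hs.2
  have hgc : ContinuousOn g (uIcc 0 t) := by
    rw [uIcc_of_le ht]; exact hg.continuousOn.mono Icc_subset_Ici_self
  have hsum : ∀ s, HasSum (fun n => g s * inner ℝ (dx (u t).ψ - dx (u (t - s)).ψ) (sinL2 L n) ^ 2)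
      (g s * ‖dx (u t).ψ - dx (u (t - s)).ψ‖ ^ 2) := fun s => (hasSum_sin hL _).mul_left _
  have key := intervalIntegral.hasSum_integral_of_dominated_convergence (μ := volume)
    (a := 0) (b := t)
    (F := fun n s => g s * inner ℝ (dx (u t).ψ - dx (u (t - s)).ψ) (sinL2 L n) ^ 2)
    (f := fun s => g s * ‖dx (u t).ψ - dx (u (t - s)).ψ‖ ^ 2)
    (fun n s => g s * inner ℝ (dx (u t).ψ - dx (u (t - s)).ψ) (sinL2 L n) ^ 2)
    (fun n => ((hgc.mul ((hdx.inner continuousOn_const).pow 2)).mono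
      uIoc_subset_uIcc).aestronglyMeasurable measurableSet_uIoc)
    (fun n => by
      filter_upwards with s hs
      rw [uIoc_of_le ht] at hs
      rw [Real.norm_of_nonneg (mul_nonneg (hg.nonneg s hs.1.le) (sq_nonneg _))])
    (by filter_upwards with s _ using (hsum s).summable)
    (by
      simp_rw [fun s => (hsum s).tsum_eq]
      exact (hgc.mul (hdx.norm.pow 2)).intervalIntegrable)
    (by filter_upwards with s _ using hsum s)
  refine key.congr_fun fun n => ?_
  rw [Mode.memory, variation, ← intervalIntegral.integral_const_mul]
  congr 1
  ext s
  rw [inner_sub_left, inner_dx_sinL2 hL, inner_dx_sinL2 hL]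
  simp only [IsWeakSolution.mode]
  ring

/-- The energy is the sum of the energies of the modes. -/
theorem IsWeakSolution.hasSum_energy (h : IsWeakSolution L l k₁ k₂ k₁ ρ₁ ρ₂ g U₀ u) (hL : 0 < L)
    (hg : HypA1 k₂ g) {t : ℝ} (ht : 0 ≤ t) :
    HasSum (fun n => (h.mode hL n).energy t) (Bresse.energy l k₁ k₂ k₁ ρ₁ ρ₂ g u t) := by
  have hU := h.admissible t ht
  have s := (((((((hasSum_sin hL (u t).φt).mul_left ρ₁).add
    ((hasSum_cos hL hU.ψt_mem).mul_left ρ₂)).add ((hasSum_cos hL hU.wt_mem).mul_left ρ₁)).add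
    ((hasSum_sin hL (dx (u t).ψ)).mul_left (k₂ - ∫ s in (0 : ℝ)..t, g s))).add
    ((hasSum_sin hL ((u t).axial l)).mul_left k₁)).add
    ((hasSum_cos hL (State.shear_mem_L2star (l := l) hU)).mul_left k₁)).mul_left (1 / 2) |>.add
    ((h.hasSum_memory hL hg ht).mul_left (1 / 2))
  refine s.congr_fun fun n => ?_
  rw [State.inner_shear hU, State.inner_axial hL, inner_dx_sinL2 hL, Mode.energy]
  simp only [Mode.shear, Mode.axial, IsWeakSolution.mode]
  ring

/-- A decay estimate for all modes, relative to their initial energies, carries over to weak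
solutions. -/
theorem IsWeakSolution.energy_le (h : IsWeakSolution L l k₁ k₂ k₁ ρ₁ ρ₂ g U₀ u) (hL : 0 < L)
    (hg : HypA1 k₂ g) {t R : ℝ} (ht : 0 ≤ t)
    (hdec : ∀ (μ : ℝ) (X : Mode k₁ k₂ ρ₁ ρ₂ l μ g), Real.pi / L ≤ μ →
      X.energy t ≤ R * X.energy 0) :
    Bresse.energy l k₁ k₂ k₁ ρ₁ ρ₂ g u t
      ≤ R * Bresse.energy l k₁ k₂ k₁ ρ₁ ρ₂ g (fun _ => U₀) 0 := by
  have h0 : Bresse.energy l k₁ k₂ k₁ ρ₁ ρ₂ g u 0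
      = Bresse.energy l k₁ k₂ k₁ ρ₁ ρ₂ g (fun _ => U₀) 0 := by
    simp only [Bresse.energy, h.initial, intervalIntegral.integral_same]
  rw [← h0]
  exact hasSum_le (fun n => hdec _ (h.mode hL n) (le_freq hL n)) (h.hasSum_energy hL hg ht)
    ((h.hasSum_energy hL hg le_rfl).mul_left R)

/-- The constant in a decay estimate can be chosen in terms of the initial state alone. -/
theorem exists_const_of_mode_decay (hL : 0 < L) (hg : HypA1 k₂ g) {t₀ M : ℝ} (ht₀ : 0 < t₀)
    (hM : 0 < M) {R : ℝ → ℝ} (hR : ∀ t, t₀ < t → 0 ≤ R t)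
    (hdec : ∀ (μ : ℝ) (X : Mode k₁ k₂ ρ₁ ρ₂ l μ g), Real.pi / L ≤ μ → ∀ t, t₀ ≤ t →
      X.energy t ≤ M * R t * X.energy 0) (U₀ : State L) :
    ∃ C : ℝ, 0 < C ∧ ∀ u : ℝ → State L, IsWeakSolution L l k₁ k₂ k₁ ρ₁ ρ₂ g U₀ u →
      ∀ t : ℝ, t₀ < t → Bresse.energy l k₁ k₂ k₁ ρ₁ ρ₂ g u t ≤ C * R t := by
  refine ⟨M * (|Bresse.energy l k₁ k₂ k₁ ρ₁ ρ₂ g (fun _ => U₀) 0| + 1), by positivity,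
    fun u hu t ht => ?_⟩
  have h1 := hu.energy_le hL hg (ht₀.le.trans ht.le) fun μ X hμ => hdec μ X hμ t ht.le
  have h2 : Bresse.energy l k₁ k₂ k₁ ρ₁ ρ₂ g (fun _ => U₀) 0
      ≤ |Bresse.energy l k₁ k₂ k₁ ρ₁ ρ₂ g (fun _ => U₀) 0| + 1 := by
    linarith [le_abs_self (Bresse.energy l k₁ k₂ k₁ ρ₁ ρ₂ g (fun _ => U₀) 0)]
  have h3 := mul_le_mul_of_nonneg_left h2 (mul_nonneg hM.le (hR t ht))
  linarith

end Reduction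

theorem rate_nonneg {ξ : ℝ → ℝ} (hξ : IsWeight ξ) {t₀ t r q : ℝ} (ht₀ : 0 ≤ t₀) (ht : t₀ < t) :
    0 ≤ (1 / (1 + ∫ s in t₀..t, ξ s ^ r)) ^ q := by
  have : 0 ≤ ∫ s in t₀..t, ξ s ^ r := intervalIntegral.integral_nonneg ht.le fun s hs =>
    Real.rpow_nonneg (hξ.pos s (ht₀.trans hs.1)).le _
  positivity

end Bresse


theorem mainTheorem1 (L k₁ k₂ k₃ ρ₁ ρ₂ : ℝ) (hL : 0 < L) (hk₁ : 0 < k₁) (hk₂ : 0 < k₂)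
    (hk₃ : 0 < k₃) (hρ₁ : 0 < ρ₁) (hρ₂ : 0 < ρ₂) (g ξ : ℝ → ℝ) (p : ℝ)
    (hA1 : Bresse.HypA1 k₂ g) (hA2 : Bresse.HypA2 g ξ p)
    (hspeed : k₁ / ρ₁ = k₂ / ρ₂) (hk : k₁ = k₃) :
    ∃ l₀ : ℝ, 0 < l₀ ∧ ∀ l : ℝ, 0 < l → l < l₀ → ∀ t₀ : ℝ, 0 < t₀ →
      (p = 1 → ∃ lam : ℝ, 0 < lam ∧
        ∀ U₀ : Bresse.State L, U₀.Admissible → ∃ C : ℝ, 0 < C ∧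
          ∀ u : ℝ → Bresse.State L, Bresse.IsWeakSolution L l k₁ k₂ k₃ ρ₁ ρ₂ g U₀ u →
            ∀ t : ℝ, t₀ < t → Bresse.energy l k₁ k₂ k₃ ρ₁ ρ₂ g u t ≤
              C * Real.exp (-lam * ∫ s in t₀..t, ξ s)) ∧
      (1 < p →
        ∀ U₀ : Bresse.State L, U₀.Admissible → ∃ C : ℝ, 0 < C ∧
          ∀ u : ℝ → Bresse.State L, Bresse.IsWeakSolution L l k₁ k₂ k₃ ρ₁ ρ₂ g U₀ u →
            ∀ t : ℝ, t₀ < t → Bresse.energy l k₁ k₂ k₃ ρ₁ ρ₂ g u t ≤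
              C * (1 / (1 + ∫ s in t₀..t, ξ s ^ (2 * p - 1))) ^ (1 / (2 * p - 2))) ∧
      (1 < p →
        MeasureTheory.IntegrableOn
          (fun t : ℝ => (1 / (1 + ∫ s in t₀..t, ξ s ^ (2 * p - 1))) ^ (1 / (2 * p - 2)))
          (Set.Ioi t₀) →
        ∀ U₀ : Bresse.State L, U₀.Admissible → ∃ C : ℝ, 0 < C ∧
          ∀ u : ℝ → Bresse.State L, Bresse.IsWeakSolution L l k₁ k₂ k₃ ρ₁ ρ₂ g U₀ u →
            ∀ t : ℝ, t₀ < t → Bresse.energy l k₁ k₂ k₃ ρ₁ ρ₂ g u t ≤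
              C * (1 / (1 + ∫ s in t₀..t, ξ s ^ p)) ^ (1 / (p - 1))) := by
  subst hk
  obtain ⟨l₀, hl₀, H⟩ := Bresse.exists_lyapunov hA1 hk₁ hk₂ hρ₁ hρ₂ (div_pos Real.pi_pos hL) hspeed
  refine ⟨l₀, hl₀, fun l hl hll t₀ ht₀ => ?_⟩
  obtain ⟨κ, c, C₁, hκ, hc, hC₁, hlyap⟩ := H l hl hll t₀ ht₀
  have hξ := hA2.isWeight
  have hslow : 1 < p → ∃ M : ℝ, 0 < M ∧ ∀ (μ : ℝ) (X : Bresse.Mode k₁ k₂ ρ₁ ρ₂ l μ g),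
      Real.pi / L ≤ μ → ∀ t, t₀ ≤ t → X.energy t
        ≤ M * (1 / (1 + ∫ s in t₀..t, ξ s ^ (2 * p - 1))) ^ (1 / (2 * p - 2)) * X.energy 0 := by
    intro hp
    obtain ⟨K, hK, hmem⟩ :=
      Bresse.exists_memoryBound_sqrt hA1 hA2 hk₁ hρ₁ hρ₂ l (Real.pi / L)
    have := Bresse.exists_mode_poly_decay hA1 hξ hk₁ hρ₁ hρ₂ ht₀ (by linarith) hκ hc hC₁ hK
      two_pos hlyap hmem
    rwa [show 2 * p - 1 - 1 = 2 * p - 2 by ring] at this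
  refine ⟨fun hp => ?_, fun hp U₀ _ => ?_, fun hp hint U₀ _ => ?_⟩
  · subst hp
    obtain ⟨lam, M, hlam, hM, hdec⟩ := Bresse.exists_mode_exp_decay hA1 hξ hk₁ hρ₁ hρ₂ ht₀ hκ hc
      hC₁ one_pos two_pos hlyap (Bresse.memoryBound_one hA1 hA2 hk₁ hρ₁ hρ₂ _)
    exact ⟨lam, hlam, fun U₀ _ => Bresse.exists_const_of_mode_decay hL hA1 ht₀ hM
      (fun _ _ => (Real.exp_pos _).le) hdec U₀⟩
  · obtain ⟨M, hM, hdec⟩ := hslow hp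
    exact Bresse.exists_const_of_mode_decay hL hA1 ht₀ hM
      (fun t ht => Bresse.rate_nonneg hξ ht₀.le ht) hdec U₀
  · obtain ⟨M, hM, hdec⟩ := hslow hp
    obtain ⟨B, hB, hBint⟩ := Bresse.exists_integral_energy_le hA1 hk₁ hρ₁ hρ₂ ht₀ hM hint
      (fun t ht => Bresse.rate_nonneg hξ ht₀.le ht) hdec
    obtain ⟨K, C, hK, hC, hmem⟩ :=
      Bresse.exists_memoryBound_of_integral hA1 hA2 hk₁ hρ₁ hρ₂ hB hBint
    obtain ⟨M', hM', hdec'⟩ := Bresse.exists_mode_poly_decay hA1 hξ hk₁ hρ₁ hρ₂ ht₀ hp hκ hc hC₁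
      hK hC hlyap hmem
    exact Bresse.exists_const_of_mode_decay hL hA1 ht₀ hM'
      (fun t ht => Bresse.rate_nonneg hξ ht₀.le ht) hdec' U₀
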